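/- Let $e(x)=\exp(2\pi i x)$, $q=e(\tau)$, $\operatorname{Im}\tau>0$, and let $\eta(\tau)=q^{1/24}\prod_{n\ge1}(1-q^n)$. Let $f(\tau)=\prod_{n\ge1}\eta(n\tau)^{r_n}$ with $r_n\in\mathbb Z$, almost all zero. Let $k=\frac12\sum_n r_n$ be its weight, let its level $N$ be the least common multiple of all $n$ with $r_n\ne0$ ($N=1$ if there are none), and put $x_N=\sum_{n\mid N}nr_n$ and $\Pi=\prod_{n\mid N}(N/n)^{|r_n|}$. For $\gamma=\begin{pmatrix}a&b\\c&d\end{pmatrix}\in SL_2(\mathbb Z)$ and $\varepsilon=\pm1$ put $g|_k(\gamma,\varepsilon)(\tau)=(\varepsilon\sqrt{c\tau+d})^{-2k}g(\gamma\tau)$ (principal square root). Let $\chi$ be the character of $f$ on the double cover $\{(\gamma,\varepsilon):\gamma\in\Gamma_0(N),\ \varepsilon=\pm1\}$ of $\Gamma_0(N)$, that is, $$\chi(\gamma,\varepsilon)=\varepsilon^{-2k}\,e\Big(\tfrac1{24}\sum_{n\mid N}r_n\Psi\begin{pmatrix}a&bn\\c/n&d\end{pmatrix}\Big),$$ where $\Psi\begin{pmatrix}a&b\\c&d\end{pmatrix}$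 equals $\frac{a+d}c+12s(-d,c)-3$ if $c>0$, $\frac{a+d}c+12s(d,-c)+3$ if $c<0$, $b$ if $c=0<a$, and $-b-6$ if $c=0>a$, and $s$ is the Dedekind sum. Write $\chi(\gamma)=\chi(\gamma,1)$. Let $M_k(\Gamma_0(N),\chi)$ (resp. $S_k(\Gamma_0(N),\chi)$) be the space of holomorphic functions $g$ on the upper half-plane with $g|_k(\gamma,\varepsilon)=\chi(\gamma,\varepsilon)g$ for all $\gamma\in\Gamma_0(N)$, $\varepsilon=\pm1$, such that $g|_k(\gamma,\varepsilon)$ has order $\ge0$ (resp. $>0$) at $i\infty$ for all $\gamma\in SL_2(\mathbb Z)$, $\varepsilon=\pm1$. Assume that $f$ is weakly admissible: $f$ is a holomorphic eta-quotient (each $f|_k(\gamma,\varepsilon)$ with $\gamma\in SL_2(\mathbb Z)$ has order $\ge0$ at $i\infty$), and either $\dim_{\mathbb C} M_k(\Gamma_0(N),\chi)=1$, or $\dim_{\mathbb C} M_k(\Gamma_0(N),\chi)\ge2$, $\dim_{\mathbb C} S_k(\Gamma_0(N),\chi)=1$ and $f$ is a cusp form. Let $m_f=24/\gcd\big(24,\sum_n(N/n)r_n,\sum_nnr_n\big)$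 and let $L_f$ be the multiplicative monoid of all integers $l\ge1$ with $l\equiv1\bmod m_f$ which, if $k\in\frac12+\mathbb Z$, are moreover perfect squares. For $l\ge1$ define $$T_lf(\tau)=l^{-k/2}\sum_{\substack{a\mid l\\(a,N)=1}}a^k\sum_{\substack{0\le b<d\\(a,b,d)=1}}\chi\begin{pmatrix}-Nb+ax&z\\-Nd&y\end{pmatrix}^{-1}\chi\begin{pmatrix}ay&by-dz\\N&x\end{pmatrix}^{-1}f\Big(\frac{a\tau+b}d\Big),$$ where $d=l/a$ and, for each $(a,b)$, $x,y,z$ are any integers with $(-Nb+ax)y+Ndz=1$. Then $f$ has a unique expansion $f(\tau)=\sum_{n\in\frac{x_N}{24}+\mathbb Z}c_f(n)q^n$; put $c_f(n)=0$ for rational $n\notin\frac{x_N}{24}+\mathbb Z$. For every $l\in L_f$ integers $x,y,z$ as above exist for all $(a,b)$, and there is a number $c_l\in\mathbb C$ such that $T_lf=c_lf$ for every choice of them. Moreover, $c_l$ is the unique complex number such that $$l^{-k/2}\sum_{\substack{a\mid l,\ d=l/a\\(a,N)=1}}\Big(\frac a\Pi\Big)a^k\,c_f\Big(\frac{ln}{a^2}\Big)\sum_{\substack{0\le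 b<d\\(a,b,d)=1}}\Big(\frac{-Nb}{(a,d)}\Big)^{2k}e\Big(bd\Big(\frac nl-\frac{x_N}{24}\Big)\Big)\psi_l(a,b)=c_l\,c_f(n)$$ holds for all $n\in\frac{x_N}{24}+\mathbb Z$, and $c_l$ equals the left-hand side at $n=\frac{x_N}{24}$. Here $\big(\frac a\Pi\big)$ and $\big(\frac{-Nb}{(a,d)}\big)$ are Kronecker-Jacobi symbols, and $$\psi_l(a,b)=\begin{cases}e\Big(-\frac{k+\delta}4(d-1)+\frac{(k+\delta)(l-1)(N-1)}4\Big)&\text{if }2\nmid l,\\ e\Big(-\frac{k+\delta}4(a-1)-\frac{N(k+\delta)(1+\delta_1)}4b\Big)&\text{if }2\mid l,\ 2\mid N,\\ 1&\text{if }2\mid l,\ 2\nmid N,\end{cases}$$ where $\delta=0$ or $1$ according to whether the odd part of $\Pi$ is $1$ or $3$ modulo $4$, and $\delta_1=1$ if $2\mid l$, $4\mid N$, $k\in\frac12+\mathbb Z$ and $v_2(\Pi)$ is odd, and $\delta_1=0$ otherwise. -/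

import Mathlib

open scoped MatrixGroups Manifold Real

namespace EtaQuot

noncomputable section

open UpperHalfPlane

/-- The function `e(x) = exp(2πix)`. -/
def e (x : ℂ) : ℂ := Complex.exp (2 * π * Complex.I * x)

/-! ### Eta-quotients -/

/-- The family `r` of integral exponents is finitely supported on the positive integers; it
represents the product of the `η(nτ)^{r_n}`. -/
def etaQuotient (r : ℕ+ →₀ ℤ) (τ : ℍ) : ℂ :=
  r.prod fun n k => ModularForm.eta ((n : ℂ) * (τ : ℂ)) ^ k

/-- The level: the least common multiple of all `n` with `r_n ≠ 0` (it is `1` if there are none). -/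
def level (r : ℕ+ →₀ ℤ) : ℕ := r.support.lcm fun n => (n : ℕ)

/-- Twice the weight: `2k = ∑ r_n`. -/
def twoK (r : ℕ+ →₀ ℤ) : ℤ := r.sum fun _ k => k

/-- `x_N = ∑ n r_n`. -/
def xN (r : ℕ+ →₀ ℤ) : ℤ := r.sum fun n k => (n : ℤ) * k

/-- `∑ (N/n) r_n`, where `N` is the level. -/
def xOne (r : ℕ+ →₀ ℤ) : ℤ := r.sum fun n k => ((level r / (n : ℕ) : ℕ) : ℤ) * k

/-- `Π = ∏ (N/n)^{|r_n|}`, where `N` is the level. -/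
def bigPi (r : ℕ+ →₀ ℤ) : ℕ := r.prod fun n k => (level r / (n : ℕ)) ^ k.natAbs

/-! ### The character of an eta-quotient -/

/-- The sawtooth function `((x))`. -/
def sawtooth (x : ℚ) : ℚ := if Int.fract x = 0 then 0 else Int.fract x - 1 / 2

/-- The Dedekind sum `s(h, k)`. -/
def dedekindSum (h : ℤ) (k : ℕ) : ℚ :=
  ∑ i ∈ Finset.range k, sawtooth ((i : ℚ) / k) * sawtooth ((h * i : ℚ) / k)

/-- The function `Ψ` on `SL(2, ℤ)` describing the transformation of `log η`. -/
def Psi (M : Matrix (Fin 2) (Fin 2) ℤ) : ℚ :=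
  if 0 < M 1 0 then
    ((M 0 0 : ℚ) + M 1 1) / M 1 0 + 12 * dedekindSum (-M 1 1) (M 1 0).natAbs - 3
  else if M 1 0 < 0 then
    ((M 0 0 : ℚ) + M 1 1) / M 1 0 + 12 * dedekindSum (M 1 1) (M 1 0).natAbs + 3
  else if 0 < M 0 0 then M 0 1
  else -(M 0 1 : ℚ) - 6

/-- The character of the eta-quotient with exponents `r` on the double cover of `Γ₀(N)`, whose
elements are the pairs `(M, ε)` with `M ∈ Γ₀(N)` and `ε = ±1`:
`(M, ε) ↦ ε^{-2k} e((1/24) ∑ r_n Ψ(a, bn; c/n, d))` for `M = (a, b; c, d)`. -/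
def etaChar (r : ℕ+ →₀ ℤ) (M : Matrix (Fin 2) (Fin 2) ℤ) (ε : ℤˣ) : ℂ :=
  (((ε : ℤ) : ℂ) ^ (-twoK r)) *
    e (((1 / 24 * r.sum fun n k =>
      (k : ℚ) * Psi !![M 0 0, M 0 1 * (n : ℤ); M 1 0 / (n : ℤ), M 1 1] : ℚ)) : ℂ)

/-! ### Modular forms of half-integral weight on the double cover -/

/-- The slash operator of weight `k = w/2` for the element `(γ, ε)` of the double cover of
`SL(2, ℤ)`: `(f|(γ, ε))(τ) = (ε (cτ + d)^{1/2})^{-2k} f(γτ)`, with the principal square root. -/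
def slash (w : ℤ) (γ : SL(2, ℤ)) (ε : ℤˣ) (f : ℍ → ℂ) (τ : ℍ) : ℂ :=
  (((ε : ℤ) : ℂ) * ((γ 1 0 : ℂ) * (τ : ℂ) + (γ 1 1 : ℂ)) ^ (1 / 2 : ℂ)) ^ (-w) * f (γ • τ)

lemma slash_zero (w : ℤ) (γ : SL(2, ℤ)) (ε : ℤˣ) : slash w γ ε 0 = 0 := by
  funext τ; simp [slash]

lemma slash_add (w : ℤ) (γ : SL(2, ℤ)) (ε : ℤˣ) (f g : ℍ → ℂ) :
    slash w γ ε (f + g) = slash w γ ε f + slash w γ ε g := by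
  funext τ; simp [slash, mul_add]

lemma slash_smul (w : ℤ) (γ : SL(2, ℤ)) (ε : ℤˣ) (c : ℂ) (f : ℍ → ℂ) :
    slash w γ ε (c • f) = c • slash w γ ε f := by
  funext τ; simp [slash]; ring

/-- The space `M_k(Γ₀(N), χ)`, `k = w/2`, for a function `χ` on the double cover of `Γ₀(N)`:
holomorphic functions on the upper half-plane with `f|(γ, ε) = χ(γ, ε) f` on the double cover of
`Γ₀(N)` such that every `f|(γ, ε)` with `γ ∈ SL(2, ℤ)` has order at least `0` at `i∞`, that is,
is bounded at `i∞`. -/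
def modularForms (N : ℕ) (w : ℤ) (χ : Matrix (Fin 2) (Fin 2) ℤ → ℤˣ → ℂ) :
    Submodule ℂ (ℍ → ℂ) where
  carrier := {f | MDifferentiable 𝓘(ℂ) 𝓘(ℂ) f ∧
    (∀ γ ∈ CongruenceSubgroup.Gamma0 N, ∀ ε : ℤˣ, slash w γ ε f = χ γ.1 ε • f) ∧
    ∀ (γ : SL(2, ℤ)) (ε : ℤˣ), IsBoundedAtImInfty (slash w γ ε f)}
  add_mem' := by
    rintro f g ⟨hf1, hf2, hf3⟩ ⟨hg1, hg2, hg3⟩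
    refine ⟨hf1.add hg1, fun γ hγ ε => ?_, fun γ ε => ?_⟩
    · rw [slash_add, hf2 γ hγ ε, hg2 γ hγ ε, smul_add]
    · rw [slash_add]; exact (hf3 γ ε).add (hg3 γ ε)
  zero_mem' := by
    refine ⟨mdifferentiable_const, fun γ _ ε => ?_, fun γ ε => ?_⟩
    · rw [slash_zero, smul_zero]
    · rw [slash_zero]; exact Filter.const_boundedAtFilter _ 0
  smul_mem' := by
    rintro c f ⟨hf1, hf2, hf3⟩
    refine ⟨hf1.const_smul c, fun γ hγ ε => ?_, fun γ ε => ?_⟩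
    · rw [slash_smul, hf2 γ hγ ε, smul_comm]
    · rw [slash_smul]; exact (hf3 γ ε).smul c

/-- The space `S_k(Γ₀(N), χ)` of cusp forms: those modular forms for which every `f|(γ, ε)` with
`γ ∈ SL(2, ℤ)` has positive order at `i∞`, that is, tends to zero at `i∞`. -/
def cuspForms (N : ℕ) (w : ℤ) (χ : Matrix (Fin 2) (Fin 2) ℤ → ℤˣ → ℂ) :
    Submodule ℂ (ℍ → ℂ) where
  carrier := {f | f ∈ modularForms N w χ ∧
    ∀ (γ : SL(2, ℤ)) (ε : ℤˣ), IsZeroAtImInfty (slash w γ ε f)}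
  add_mem' := by
    rintro f g ⟨hf1, hf2⟩ ⟨hg1, hg2⟩
    refine ⟨add_mem hf1 hg1, fun γ ε => ?_⟩
    rw [slash_add]; exact (hf2 γ ε).add (hg2 γ ε)
  zero_mem' := by
    refine ⟨zero_mem _, fun γ ε => ?_⟩
    rw [slash_zero]; exact Filter.zero_zeroAtFilter _
  smul_mem' := by
    rintro c f ⟨hf1, hf2⟩
    refine ⟨Submodule.smul_mem _ c hf1, fun γ ε => ?_⟩
    rw [slash_smul]; exact (hf2 γ ε).smul c

/-- A holomorphic eta-quotient: its order at every cusp is nonnegative. -/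
def IsHolomorphicEtaQuotient (r : ℕ+ →₀ ℤ) : Prop :=
  ∀ (γ : SL(2, ℤ)) (ε : ℤˣ), IsBoundedAtImInfty (slash (twoK r) γ ε (etaQuotient r))

/-- Weakly admissible eta-quotients: holomorphic eta-quotients `f` of weight `k`, level `N` and
character `χ` such that `dim M_k(Γ₀(N), χ) = 1` (type I), or `dim M_k(Γ₀(N), χ) ≥ 2`,
`dim S_k(Γ₀(N), χ) = 1` and `f` is a cusp form (type II). -/
def IsWeaklyAdmissible (r : ℕ+ →₀ ℤ) : Prop :=
  IsHolomorphicEtaQuotient r ∧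
    (Module.finrank ℂ (modularForms (level r) (twoK r) (etaChar r)) = 1 ∨
      (2 ≤ Module.finrank ℂ (modularForms (level r) (twoK r) (etaChar r)) ∧
        Module.finrank ℂ (cuspForms (level r) (twoK r) (etaChar r)) = 1 ∧
        etaQuotient r ∈ cuspForms (level r) (twoK r) (etaChar r)))

/-! ### The monoid `L_f` and the operators `T_l` -/

/-- `m_f = 24 / gcd(24, ∑ (N/n) r_n, ∑ n r_n)`. -/
def mf (r : ℕ+ →₀ ℤ) : ℕ := 24 / Nat.gcd 24 (Int.gcd (xOne r) (xN r))

/-- The monoid `L_f` of the positive integers `l ≡ 1 mod m_f` which, if `k ∈ 1/2 + ℤ`, are perfect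
squares. -/
def Lf (r : ℕ+ →₀ ℤ) : Submonoid ℕ where
  carrier := {l | 0 < l ∧ l ≡ 1 [MOD mf r] ∧ (Odd (twoK r) → IsSquare l)}
  one_mem' := ⟨one_pos, Nat.ModEq.refl 1, fun _ => IsSquare.one⟩
  mul_mem' := by
    rintro a b ⟨ha, ha', ha''⟩ ⟨hb, hb', hb''⟩
    exact ⟨Nat.mul_pos ha hb, by simpa using ha'.mul hb', fun h => (ha'' h).mul (hb'' h)⟩

/-- An admissible choice of the integers `x, y, z` (depending on `a`, `b` and `d = l/a`) in the
definition of `T_l`. The equation implies `(Nd, -Nb + ax) = 1`. -/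
structure HeckeChoice (N l : ℕ) where
  /-- the integers `x` -/
  x : ℕ → ℕ → ℤ
  /-- the integers `y` -/
  y : ℕ → ℕ → ℤ
  /-- the integers `z` -/
  z : ℕ → ℕ → ℤ
  spec : ∀ a ∈ l.divisors, N.Coprime a → ∀ b < l / a, Nat.gcd a (Nat.gcd b (l / a)) = 1 →
    (-(N : ℤ) * b + a * x a b) * y a b + N * ((l / a : ℕ) : ℤ) * z a b = 1

/-- Wohlfahrt's operator `T_l = T_{l; k, N, χ, χ'}` with `k = w/2`, computed with the choice `s`:
`T_l f(τ) = l^{-k/2} ∑_{a ∣ l, (N, a) = 1} a^k ∑_{0 ≤ b < d, (a, b, d) = 1}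
  χ(-Nb + ax, z; -Nd, y)⁻¹ χ'(ay, by - dz; N, x)⁻¹ f((aτ + b)/d)` with `d = l/a`.
Here `(aτ + b)/d` lies in the upper half-plane, so that `ofComplex` only changes its type. -/
def heckeT (l N : ℕ) (w : ℤ) (χ χ' : Matrix (Fin 2) (Fin 2) ℤ → ℤˣ → ℂ) (s : HeckeChoice N l)
    (f : ℍ → ℂ) (τ : ℍ) : ℂ :=
  (((l : ℝ) ^ (-((w : ℝ) / 2) / 2) : ℝ) : ℂ) *
    ∑ a ∈ l.divisors with N.Coprime a, (((a : ℝ) ^ ((w : ℝ) / 2) : ℝ) : ℂ) *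
      ∑ b ∈ Finset.range (l / a) with Nat.gcd a (Nat.gcd b (l / a)) = 1,
        (χ !![-(N : ℤ) * b + a * s.x a b, s.z a b; -(N : ℤ) * ((l / a : ℕ) : ℤ), s.y a b] 1)⁻¹ *
        (χ' !![a * s.y a b, b * s.y a b - ((l / a : ℕ) : ℤ) * s.z a b; (N : ℤ), s.x a b] 1)⁻¹ *
        f (ofComplex (((a : ℂ) * (τ : ℂ) + b) / ((l / a : ℕ) : ℂ)))

/-! ### Fourier coefficients and the explicit identity -/

/-- `f(τ) = ∑_{n ∈ x + ℤ} c(n) q^n` on the upper half-plane; `c` is extended by `0` to the rational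
numbers outside `x + ℤ`. -/
structure IsFourierExpansion (x : ℚ) (f : ℍ → ℂ) (c : ℚ → ℂ) : Prop where
  eq_zero : ∀ n : ℚ, (¬ ∃ m : ℤ, n = x + m) → c n = 0
  hasSum : ∀ τ : ℍ, HasSum (fun m : ℤ => c (x + m) * e (((x + m : ℚ) : ℂ) * (τ : ℂ))) (f τ)

/-- The Kronecker-Jacobi symbol `(m/n)`. -/
def kronecker (m n : ℤ) : ℤ :=
  if n = 0 then (if m.natAbs = 1 then 1 else 0)
  else (if n < 0 ∧ m < 0 then -1 else 1) *
    ZMod.χ₈ (m : ZMod 8) ^ (n.natAbs.factorization 2) *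
    jacobiSym m (n.natAbs / 2 ^ n.natAbs.factorization 2)

/-- `δ = 1` if the odd part of `Π` is `3` modulo `4`, and `δ = 0` otherwise. -/
def delta (r : ℕ+ →₀ ℤ) : ℚ :=
  if (bigPi r / 2 ^ (bigPi r).factorization 2) % 4 = 3 then 1 else 0

/-- `δ₁ = 1` if `2 ∣ l`, `4 ∣ N`, `k ∈ 1/2 + ℤ` and `v₂(Π)` is odd, and `δ₁ = 0` otherwise. -/
def deltaOne (r : ℕ+ →₀ ℤ) (l : ℕ) : ℚ :=
  if 2 ∣ l ∧ 4 ∣ level r ∧ Odd (twoK r) ∧ Odd ((bigPi r).factorization 2) then 1 else 0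

/-- The root of unity `ψ_{l,r}(a, b)`, with `d = l/a`. -/
def psi (r : ℕ+ →₀ ℤ) (l a b : ℕ) : ℂ :=
  let k : ℚ := (twoK r : ℚ) / 2
  let N : ℚ := level r
  let d : ℚ := ((l / a : ℕ) : ℚ)
  if ¬ 2 ∣ l then
    e ((-(k + delta r) / 4 * (d - 1) + (k + delta r) * ((l : ℚ) - 1) * (N - 1) / 4 : ℚ) : ℂ)
  else if 2 ∣ level r then
    e ((-(k + delta r) / 4 * ((a : ℚ) - 1)
      - N * (k + delta r) * (1 + deltaOne r l) / 4 * b : ℚ) : ℂ)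
  else 1

/-- The left-hand side of the coefficient identity, for the coefficient function `c`:
`l^{-k/2} ∑_{a ∣ l, (a, N) = 1} (a/Π) a^k c(ln/a²)
  ∑_{0 ≤ b < d, (a, b, d) = 1} (-Nb/(a, d))^{2k} e(bd(n/l - x_N/24)) ψ(a, b)` with `d = l/a`,
where `(a/Π)` and `(-Nb/(a, d))` are Kronecker-Jacobi symbols. -/
def coeffLHS (r : ℕ+ →₀ ℤ) (c : ℚ → ℂ) (l : ℕ) (n : ℚ) : ℂ :=
  (((l : ℝ) ^ (-((twoK r : ℝ) / 2) / 2) : ℝ) : ℂ) *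
    ∑ a ∈ l.divisors with a.Coprime (level r),
      (kronecker a (bigPi r) : ℂ) * (((a : ℝ) ^ ((twoK r : ℝ) / 2) : ℝ) : ℂ) *
        c ((l : ℚ) * n / (a : ℚ) ^ 2) *
      ∑ b ∈ Finset.range (l / a) with Nat.gcd a (Nat.gcd b (l / a)) = 1,
        (kronecker (-(level r : ℤ) * b) (Nat.gcd a (l / a)) : ℂ) ^ twoK r *
        e (((b : ℚ) * ((l / a : ℕ) : ℚ) * (n / l - (xN r : ℚ) / 24) : ℚ) : ℂ) *
        psi r l a b

end

end EtaQuot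

namespace EtaQuot

noncomputable section

/-! ### Dedekind sums -/

/-! Put R(τ) = f(τ/l)/f(τ). For ad = l the matrix (a, b; 0, d) factors as γ₁ · diag(1, l) · γ₂
(`tri_eq_mul`), where γ₁ and γ₂ in Γ₀(N) are the two matrices at which χ is evaluated in T_l.
Transforming f under both of them turns each summand into f(τ) R(γ₂τ) (`etaRatio_rightFactor_mul`),
so T_l f is l^{-k/2} f times a sum of translates of R (`heckeT_eq_mul`).

R is invariant under the elements of Γ₀(N) with upper right entry divisible by l (`etaRatio_smul`).
This amounts to χ(a, b; lc, d) = χ(a, lb; c, d) for N ∣ c, and it is the reason for the definition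
of L_f. In closed form χ is a product of Jacobi symbols and a 24th root of unity. The two exponents
differ by multiples of (l-1)∑(N/n)r_n and (l-1)x_N, and the symbols differ by a 2k-th power of a
symbol in l, which is 1 if 2k is even or l is a square. Hence R(γτ) depends only on the coset SL₂(ℤ)
diag(1, l) γ. The triples (a, b, d) list these cosets for γ in Γ₀(N) and right multiplication by
Γ₀(N) permutes them, so T_l f / f is invariant (`sum_etaRatio_smul`). The conditions at the cusps
survive because (a, b; 0, d)γ is again SL₂(ℤ) times an upper triangular matrix. Thus T_l f lies in
the same one-dimensional space as f (`exists_eigenvalue`).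

The multiplier of η is obtained twice by the Euclidean algorithm from η(τ+1) and η(-1/τ): with
Dedekind sums, using their reciprocity law (`isEtaMult_Psi`), and with Jacobi symbols, using
quadratic reciprocity (`isEtaMult_multOddC`, `isEtaMult_multOddD`). As η has no zeros, the
multiplier is unique and the two forms agree.

For the coefficient identity the product of the two character values must be evaluated. Since R sees
only the coset, this product does not depend on x, y, z, and b ↦ b + jd multiplies it by e(j x_N/24)
(`chiProd_shift`). So x, y, z may be taken to satisfy convenient congruences modulo 8 and 3, and the
value follows in three cases given by the parities of l and N (`HeckeChoice.kappa_eq`). Comparing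
Fourier coefficients (`fourier_coeff_eq_zero`) gives the identity, and since f = q^{x_N/24}(1 + ⋯),
the coefficient at x_N/24 is the eigenvalue. -/

lemma sawtooth_neg (x : ℚ) : sawtooth (-x) = -sawtooth x := by
  unfold sawtooth
  by_cases h : Int.fract x = 0
  · have h' : Int.fract (-x) = 0 := Int.fract_neg_eq_zero.mpr h
    simp [h, h']
  · have h' : ¬ Int.fract (-x) = 0 := fun H => h (Int.fract_neg_eq_zero.mp H)
    rw [if_neg h, if_neg h', Int.fract_neg h]
    ring

lemma sawtooth_add_int (x : ℚ) (n : ℤ) : sawtooth (x + n) = sawtooth x := by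
  simp [sawtooth]

lemma dedekindSum_neg (h : ℤ) (k : ℕ) : dedekindSum (-h) k = -dedekindSum h k := by
  unfold dedekindSum
  rw [← Finset.sum_neg_distrib]
  refine Finset.sum_congr rfl fun i _ => ?_
  rw [← mul_neg, ← sawtooth_neg]
  congr 2
  push_cast
  ring

lemma dedekindSum_add_self (h : ℤ) (k : ℕ) : dedekindSum (h + k) k = dedekindSum h k := by
  unfold dedekindSum
  refine Finset.sum_congr rfl fun i hi => ?_
  have hk : (k : ℚ) ≠ 0 := by
    have : i < k := Finset.mem_range.mp hi
    exact_mod_cast (by omega : k ≠ 0)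
  rw [← sawtooth_add_int ((h * i : ℚ) / k) i]
  congr 2
  push_cast
  field_simp

lemma dedekindSum_sub_self (h : ℤ) (k : ℕ) : dedekindSum (h - k) k = dedekindSum h k := by
  rw [← dedekindSum_add_self, sub_add_cancel]

lemma sawtooth_natCast_div {m k : ℕ} (hk : 0 < k) (hm : m % k ≠ 0) :
    sawtooth ((m : ℚ) / k) = ((m % k : ℕ) : ℚ) / k - 1 / 2 := by
  have : Int.fract ((m : ℚ) / k) = ((m % k : ℕ) : ℚ) / k := by
    rw [Int.fract_div_natCast_eq_div_natCast_mod]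
  rw [sawtooth, this, if_neg]
  have : (k : ℚ) ≠ 0 := by positivity
  have h2 : ((m % k : ℕ) : ℚ) ≠ 0 := by exact_mod_cast hm
  positivity

lemma sum_range_mul_mod {h k : ℕ} (hhk : Nat.Coprime h k) (hk : 0 < k) (g : ℕ → ℚ) :
    ∑ i ∈ Finset.range k, g (h * i % k) = ∑ i ∈ Finset.range k, g i := by
  have hmaps : ∀ i ∈ Finset.range k, h * i % k ∈ Finset.range k := fun i _ =>
    Finset.mem_range.mpr (Nat.mod_lt _ hk)
  have hinj : Set.InjOn (fun i => h * i % k) (Finset.range k) := by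
    intro i hi j hj hij
    have hi := Finset.mem_range.mp (Finset.mem_coe.mp hi)
    have hj := Finset.mem_range.mp (Finset.mem_coe.mp hj)
    have : i ≡ j [MOD k] :=
      Nat.ModEq.cancel_left_of_coprime (by rw [Nat.gcd_comm]; exact hhk) hij
    rwa [Nat.ModEq, Nat.mod_eq_of_lt hi, Nat.mod_eq_of_lt hj] at this
  refine Finset.sum_nbij (fun i => h * i % k) hmaps hinj ?_ (fun _ _ => rfl)
  exact Finset.surjOn_of_injOn_of_card_le _ hmaps hinj le_rfl

lemma sum_range_id_rat (k : ℕ) : ∑ i ∈ Finset.range k, (i : ℚ) = k * (k - 1) / 2 := by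
  induction k with
  | zero => simp
  | succ k ih => rw [Finset.sum_range_succ, ih]; push_cast; ring

lemma sum_range_sq_rat (k : ℕ) :
    ∑ i ∈ Finset.range k, (i : ℚ) ^ 2 = (k - 1) * k * (2 * k - 1) / 6 := by
  induction k with
  | zero => simp
  | succ k ih => rw [Finset.sum_range_succ, ih]; push_cast; ring

lemma cast_mod_rat (h i k : ℕ) : ((h * i % k : ℕ) : ℚ) = h * i - k * ((h * i / k : ℕ) : ℚ) := by
  have := Nat.mod_add_div (h * i) k
  have h2 : ((h * i % k : ℕ) : ℚ) + k * ((h * i / k : ℕ) : ℚ) = h * i := by exact_mod_cast this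
  linarith

/-- The Dedekind sum in terms of `∑ i ⌊hi/k⌋`. -/
lemma dedekindSum_eq_sum_floor {h k : ℕ} (hhk : Nat.Coprime h k) (hk : 0 < k) :
    dedekindSum h k = (h * ((k - 1) * k * (2 * k - 1) / 6)
      - k * ∑ i ∈ Finset.range k, (i : ℚ) * ((h * i / k : ℕ) : ℚ)) / k ^ 2 - (k - 1) / 4 := by
  have hk' : (k : ℚ) ≠ 0 := by positivity
  -- At `i = 0` the sawtooth vanishes while the polynomial expression gives (-1/2)(-1/2); the `1 /
  -- 4` corrects this.
  have h1 : dedekindSum h k = ∑ i ∈ Finset.range k,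
      (((i : ℚ) / k - 1 / 2) * (((h * i % k : ℕ) : ℚ) / k - 1 / 2) - if i = 0 then 1 / 4 else 0) := by
    unfold dedekindSum
    refine Finset.sum_congr rfl fun i hi => ?_
    rcases Nat.eq_zero_or_pos i with rfl | hi0
    · simp [sawtooth]; norm_num
    · have hik := Finset.mem_range.mp hi
      have e1 : i % k ≠ 0 := by rw [Nat.mod_eq_of_lt hik]; omega
      have e2 : h * i % k ≠ 0 := by
        intro H
        exact e1 (Nat.mod_eq_zero_of_dvd
          ((Nat.Coprime.symm hhk).dvd_of_dvd_mul_left (Nat.dvd_of_mod_eq_zero H)))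
      have e3 := sawtooth_natCast_div hk e2
      push_cast at e3 ⊢
      rw [e3, sawtooth_natCast_div hk e1, Nat.mod_eq_of_lt hik, if_neg hi0.ne']
      ring
  have hsum : ∑ i ∈ Finset.range k, ((h * i % k : ℕ) : ℚ) = k * (k - 1) / 2 := by
    rw [sum_range_mul_mod hhk hk (fun n => (n : ℚ)), sum_range_id_rat]
  have h3 : ∑ i ∈ Finset.range k, ((i : ℚ) * ((h * i % k : ℕ) : ℚ)) =
      h * ((k - 1) * k * (2 * k - 1) / 6)
      - k * ∑ i ∈ Finset.range k, (i : ℚ) * ((h * i / k : ℕ) : ℚ) := by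
    rw [← sum_range_sq_rat, Finset.mul_sum, Finset.mul_sum, ← Finset.sum_sub_distrib]
    refine Finset.sum_congr rfl fun i _ => ?_
    rw [cast_mod_rat]; ring
  rw [h1, Finset.sum_sub_distrib, Finset.sum_ite_eq' (Finset.range k) 0 (fun _ => (1 / 4 : ℚ)),
    if_pos (Finset.mem_range.mpr hk), ← h3]
  have h4 : ∑ i ∈ Finset.range k, ((i : ℚ) / k - 1 / 2) * (((h * i % k : ℕ) : ℚ) / k - 1 / 2) =
      ∑ i ∈ Finset.range k, (((i : ℚ) * ((h * i % k : ℕ) : ℚ)) / k ^ 2 - i * (1 / (2 * k))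
        - ((h * i % k : ℕ) : ℚ) * (1 / (2 * k)) + 1 / 4) := by
    refine Finset.sum_congr rfl fun i _ => ?_
    field_simp
    ring
  rw [h4, Finset.sum_add_distrib, Finset.sum_sub_distrib, Finset.sum_sub_distrib,
    ← Finset.sum_div, ← Finset.sum_mul, ← Finset.sum_mul, hsum, sum_range_id_rat]
  simp
  field_simp
  ring

/-- Multiplication by `h` permutes the residues modulo `k`, so the squares of `h * i % k = h * i - k
* (h * i / k)` sum to the squares of all residues; the left side is this sum expanded. -/
lemma sum_floor_sq {h k : ℕ} (hhk : Nat.Coprime h k) (hk : 0 < k) :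
    (h : ℚ) ^ 2 * ((k - 1) * k * (2 * k - 1) / 6)
      - 2 * h * k * ∑ i ∈ Finset.range k, (i : ℚ) * ((h * i / k : ℕ) : ℚ)
      + k ^ 2 * ∑ i ∈ Finset.range k, ((h * i / k : ℕ) : ℚ) ^ 2 = (k - 1) * k * (2 * k - 1) / 6 := by
  rw [← sum_range_sq_rat]
  conv_rhs => rw [← sum_range_mul_mod hhk hk (fun n => (n : ℚ) ^ 2)]
  rw [Finset.mul_sum, Finset.mul_sum, Finset.mul_sum, ← Finset.sum_sub_distrib,
    ← Finset.sum_add_distrib]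
  refine Finset.sum_congr rfl fun i _ => ?_
  rw [cast_mod_rat]; ring

lemma sum_floor {h k : ℕ} (hhk : Nat.Coprime h k) (hk : 0 < k) :
    ∑ i ∈ Finset.range k, ((h * i / k : ℕ) : ℚ) = (h - 1) * (k - 1) / 2 := by
  have hk' : (k : ℚ) ≠ 0 := by positivity
  have h1 := sum_range_mul_mod hhk hk (fun n => (n : ℚ))
  simp only [cast_mod_rat, Finset.sum_sub_distrib, ← Finset.mul_sum, sum_range_id_rat] at h1
  field_simp at h1 ⊢
  linarith

/-- Counting lattice points below the diagonal of a rectangle. -/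
lemma sum_floor_sq_add_floor {h k : ℕ} (hhk : Nat.Coprime h k) (hh : 0 < h) (hk : 0 < k) :
    ∑ i ∈ Finset.range k, (((h * i / k : ℕ) : ℚ) ^ 2 + ((h * i / k : ℕ) : ℚ)) =
      h * (h - 1) * (k - 1) - 2 * ∑ j ∈ Finset.range h, (j : ℚ) * ((k * j / h : ℕ) : ℚ) := by
  -- q² + q is twice the sum of the `j ≤ q`. Exchanging the order of summation then requires
  -- counting, for fixed `j`, the `i` with `j * k ≤ h * i`; no lattice point with `0 < j < h` lies
  -- on the diagonal because `h` and `k` are coprime.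
  have h1 : ∀ i ∈ Finset.range k, (((h * i / k : ℕ) : ℚ) ^ 2 + ((h * i / k : ℕ) : ℚ)) =
      2 * ∑ j ∈ Finset.range h, if j * k ≤ h * i then (j : ℚ) else 0 := by
    intro i hi
    have hik := Finset.mem_range.mp hi
    have hq : h * i / k < h := by
      rw [Nat.div_lt_iff_lt_mul hk]
      exact Nat.mul_lt_mul_of_pos_left hik hh
    have : (Finset.range h).filter (fun j => j * k ≤ h * i) = Finset.range (h * i / k + 1) := by
      ext j
      simp only [Finset.mem_filter, Finset.mem_range, Nat.lt_succ_iff, Nat.le_div_iff_mul_le hk]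
      constructor
      · exact fun H => H.2
      · intro H
        refine ⟨?_, H⟩
        exact lt_of_le_of_lt ((Nat.le_div_iff_mul_le hk).mpr H) hq
    rw [← Finset.sum_filter, this, sum_range_id_rat]
    push_cast
    ring
  have h2 : ∀ j ∈ Finset.range h, ∑ i ∈ Finset.range k, (if j * k ≤ h * i then (j : ℚ) else 0) =
      j * (k - 1 - ((k * j / h : ℕ) : ℚ)) := by
    intro j hj
    have hjh := Finset.mem_range.mp hj
    rcases Nat.eq_zero_or_pos j with rfl | hj0
    · simp
    have hq : k * j / h < k := by
      rw [Nat.div_lt_iff_lt_mul hh]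
      exact Nat.mul_lt_mul_of_pos_left hjh hk
    have hnd : ¬ h ∣ k * j := fun H => by
      have := Nat.le_of_dvd hj0 (hhk.dvd_of_dvd_mul_left H)
      omega
    have : (Finset.range k).filter (fun i => ¬ j * k ≤ h * i) = Finset.range (k * j / h + 1) := by
      ext i
      simp only [Finset.mem_filter, Finset.mem_range, Nat.lt_succ_iff, Nat.le_div_iff_mul_le hh,
        not_le]
      constructor
      · rintro ⟨-, H⟩
        rw [mul_comm i, mul_comm k]; exact H.le
      · intro H
        refine ⟨lt_of_le_of_lt ((Nat.le_div_iff_mul_le hh).mpr H) hq, ?_⟩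
        rw [mul_comm i, mul_comm k] at H
        refine lt_of_le_of_ne H fun E => hnd ⟨i, ?_⟩
        rw [E, mul_comm]
    have hc : (((Finset.range k).filter (fun i => j * k ≤ h * i)).card : ℚ) =
        k - 1 - ((k * j / h : ℕ) : ℚ) := by
      have := Finset.card_filter_add_card_filter_not (s := Finset.range k)
        (fun i => j * k ≤ h * i)
      rw [‹(Finset.range k).filter (fun i => ¬ j * k ≤ h * i) = _›, Finset.card_range,
        Finset.card_range] at this
      have h5 : (((Finset.range k).filter (fun i => j * k ≤ h * i)).card : ℚ)
        + (((k * j / h : ℕ) : ℚ) + 1) = k := by exact_mod_cast this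
      linarith
    rw [← Finset.sum_filter, Finset.sum_const, nsmul_eq_mul, hc]
    ring
  rw [Finset.sum_congr rfl h1, ← Finset.mul_sum, Finset.sum_comm, Finset.sum_congr rfl h2]
  simp only [mul_sub, Finset.sum_sub_distrib, ← Finset.sum_mul, sum_range_id_rat]
  ring

/-- The reciprocity law for Dedekind sums. -/
theorem dedekindSum_reciprocity {h k : ℕ} (hhk : Nat.Coprime h k) (hh : 0 < h) (hk : 0 < k) :
    12 * (dedekindSum h k + dedekindSum k h) = -3 + (h : ℚ) / k + (k : ℚ) / h + 1 / (h * k) := by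
  have hk' : (k : ℚ) ≠ 0 := by positivity
  have hh' : (h : ℚ) ≠ 0 := by positivity
  rw [dedekindSum_eq_sum_floor hhk hk, dedekindSum_eq_sum_floor hhk.symm hh]
  have h1 := sum_floor_sq hhk hk
  have h2 := sum_floor_sq_add_floor hhk hh hk
  rw [Finset.sum_add_distrib, sum_floor hhk hk] at h2
  set Q := ∑ i ∈ Finset.range k, (i : ℚ) * ((h * i / k : ℕ) : ℚ)
  set Q' := ∑ j ∈ Finset.range h, (j : ℚ) * ((k * j / h : ℕ) : ℚ)
  set B := ∑ i ∈ Finset.range k, ((h * i / k : ℕ) : ℚ) ^ 2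
  -- The sum of squared residues expresses `Q` through `B`, and the lattice point count expresses
  -- `B` through `Q'`; after both substitutions `Q'` cancels.
  have hQ : Q = (h ^ 2 * ((k - 1) * k * (2 * k - 1) / 6) - (k - 1) * k * (2 * k - 1) / 6
      + k ^ 2 * B) / (2 * h * k) := by
    rw [eq_div_iff (by positivity)]
    linarith
  have hB : B = h * (h - 1) * (k - 1) - 2 * Q' - (h - 1) * (k - 1) / 2 := by linarith
  rw [hQ, hB]
  field_simp
  ring

/-! ### The function `Ψ` -/

lemma Psi_pos (a b : ℤ) {c : ℤ} (d : ℤ) (hc : 0 < c) :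
    Psi !![a, b; c, d] = ((a : ℚ) + d) / c + 12 * dedekindSum (-d) c.natAbs - 3 := by
  simp [Psi, hc]

lemma Psi_zero (b : ℤ) : Psi !![1, b; 0, 1] = b := by
  simp [Psi]

lemma Psi_T (a b c d : ℤ) (hc : 0 < c) :
    Psi !![a, b + a; c, d + c] = Psi !![a, b; c, d] + 1 := by
  have h : -(d + c) = -d - (c.natAbs : ℤ) := by omega
  have hc' : (c : ℚ) ≠ 0 := by exact_mod_cast hc.ne'
  rw [Psi_pos _ _ _ hc, Psi_pos _ _ _ hc, h, dedekindSum_sub_self]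
  push_cast
  field_simp
  ring

/-- This is the reciprocity law for `c` and `d`. The constant 3 matches the factor `zeta (-3)` in
the transformation of η under τ ↦ -1/τ. -/
lemma Psi_S (a b c d : ℤ) (hc : 0 < c) (hd : 0 < d) (hdet : a * d - b * c = 1) :
    Psi !![b, -a; d, -c] = Psi !![a, b; c, d] - 3 := by
  rw [Psi_pos _ _ _ hc, Psi_pos _ _ _ hd, neg_neg, dedekindSum_neg]
  obtain ⟨m, rfl⟩ := Int.eq_ofNat_of_zero_le hc.le
  obtain ⟨n, rfl⟩ := Int.eq_ofNat_of_zero_le hd.le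
  have hm : 0 < m := by simpa using hc
  have hn : 0 < n := by simpa using hd
  have hcop : Nat.Coprime m n := by
    rw [← Nat.isCoprime_iff_coprime]
    exact ⟨-b, a, by linarith⟩
  have hrec := dedekindSum_reciprocity hcop hm hn
  have hm' : (m : ℚ) ≠ 0 := by positivity
  have hn' : (n : ℚ) ≠ 0 := by positivity
  have hdet' : (a : ℚ) * n - b * m = 1 := by exact_mod_cast hdet
  simp only [Int.natAbs_natCast, Int.cast_natCast]
  push_cast
  have : ((b : ℚ) + -m) / n - (a + n) / m = - (m : ℚ) / n - n / m - 1 / (m * n) := by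
    field_simp
    linear_combination -hdet'
  linear_combination this + hrec

lemma Psi_S_zero (b : ℤ) : Psi !![b, -1; 1, 0] = Psi !![1, b; 0, 1] - 3 := by
  rw [Psi_pos _ _ _ one_pos, Psi_zero]
  simp [dedekindSum, sawtooth]

lemma Psi_neg_of_neg (a b : ℤ) {c : ℤ} (d : ℤ) (hc : c < 0) :
    Psi !![a, b; c, d] = Psi !![-a, -b; -c, -d] + 6 := by
  rw [Psi_pos _ _ _ (neg_pos.mpr hc)]
  have hc' : (c : ℚ) ≠ 0 := by exact_mod_cast hc.ne
  simp only [Psi, Matrix.of_apply, Matrix.cons_val', Matrix.cons_val_zero, Matrix.cons_val_one,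
    Matrix.cons_val_fin_one, hc.not_gt, hc, if_true, if_false, neg_neg, Int.natAbs_neg]
  push_cast
  field_simp
  ring

lemma Psi_neg_one (b : ℤ) : Psi !![-1, b; 0, -1] = Psi !![1, -b; 0, 1] - 6 := by
  rw [Psi_zero]
  simp [Psi]

end

end EtaQuot

namespace EtaQuot

noncomputable section

open scoped NumberTheorySymbols
open UpperHalfPlane

/-! ### Roots of unity -/

/-- The function `x ↦ e(x/24)` on the rational numbers. -/
def zeta (x : ℚ) : ℂ := e ((x / 24 : ℚ) : ℂ)

lemma e_add (x y : ℂ) : e (x + y) = e x * e y := by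
  simp only [e, ← Complex.exp_add]; ring_nf

lemma e_ne_zero (x : ℂ) : e x ≠ 0 := Complex.exp_ne_zero _

lemma e_int (n : ℤ) : e n = 1 := by
  rw [e, mul_comm]; exact Complex.exp_int_mul_two_pi_mul_I n

lemma e_zero : e 0 = 1 := by simp [e]

lemma e_neg (x : ℂ) : e (-x) = (e x)⁻¹ := by
  simp only [e, ← Complex.exp_neg]; ring_nf

lemma zeta_add (x y : ℚ) : zeta (x + y) = zeta x * zeta y := by
  simp only [zeta, ← e_add]; push_cast; ring_nf

lemma zeta_zero : zeta 0 = 1 := by simp [zeta, e_zero]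

lemma zeta_neg (x : ℚ) : zeta (-x) = (zeta x)⁻¹ := by
  simp only [zeta, ← e_neg]; push_cast; ring_nf

lemma zeta_zpow (x : ℚ) (n : ℤ) : zeta x ^ n = zeta (n * x) := by
  simp only [zeta, e, ← Complex.exp_int_mul]
  congr 1; push_cast; ring

lemma zeta_eq_of_dvd {x y : ℤ} (h : (24 : ℤ) ∣ x - y) : zeta x = zeta y := by
  obtain ⟨n, hn⟩ := h
  have : (x : ℚ) = y + 24 * n := by
    have : x = y + 24 * n := by linarith
    exact_mod_cast this
  rw [this, zeta_add]
  have : zeta (24 * n) = 1 := by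
    rw [zeta, ← e_int n]; congr 1; push_cast; ring
  rw [this, mul_one]

lemma zeta_twelve : zeta 12 = -1 := by
  rw [zeta, e, ← Complex.exp_pi_mul_I]; congr 1; push_cast; ring

lemma zeta_six : zeta 6 = Complex.I := by
  rw [zeta, e]
  refine Eq.trans ?_ Complex.exp_pi_div_two_mul_I
  congr 1; push_cast; ring

lemma zeta_neg_six : zeta (-6) = -Complex.I := by
  rw [zeta_neg, zeta_six, Complex.inv_I]

lemma zeta_twelve_mul (n : ℤ) : zeta (12 * n) = (-1) ^ n := by
  rw [mul_comm, ← zeta_zpow, zeta_twelve]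

/-! ### The principal square root -/

/-- The principal square root. -/
def csq (z : ℂ) : ℂ := z ^ (1 / 2 : ℂ)

lemma csq_sq (z : ℂ) : csq z ^ 2 = z := by
  simp [csq]

lemma csq_ne_zero {z : ℂ} (hz : z ≠ 0) : csq z ≠ 0 := fun h => hz (by rw [← csq_sq z, h]; simp)

lemma csq_re_pos {z : ℂ} (hz : z ∈ Complex.slitPlane) : 0 < (csq z).re := by
  have h0 : z ≠ 0 := Complex.slitPlane_ne_zero hz
  rw [csq, Complex.cpow_def_of_ne_zero h0, Complex.exp_re]
  refine mul_pos (Real.exp_pos _) ?_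
  have h1 := Complex.mem_slitPlane_iff_arg.mp hz
  have h2 := Complex.neg_pi_lt_arg z
  have h3 := lt_of_le_of_ne (Complex.arg_le_pi z) h1.1
  have : (Complex.log z * (1 / 2)).im = z.arg / 2 := by
    rw [show (1 / 2 : ℂ) = ((1 / 2 : ℝ) : ℂ) by norm_num, Complex.im_mul_ofReal, Complex.log_im]
    ring
  rw [this]
  exact Real.cos_pos_of_mem_Ioo ⟨by linarith, by linarith⟩

lemma mem_slitPlane_of_im_pos {z : ℂ} (hz : 0 < z.im) : z ∈ Complex.slitPlane := Or.inr hz.ne'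

lemma csq_im (z : ℂ) : 2 * (csq z).re * (csq z).im = z.im := by
  conv_rhs => rw [← csq_sq z]
  rw [sq, Complex.mul_im]; ring

lemma csq_im_pos {z : ℂ} (hz : 0 < z.im) : 0 < (csq z).im := by
  have h1 := csq_re_pos (mem_slitPlane_of_im_pos hz)
  have h2 := csq_im z
  by_contra h
  nlinarith [not_lt.mp h]

lemma csq_unique {z s : ℂ} (hz : z ∈ Complex.slitPlane) (hs : s ^ 2 = z) (h : 0 ≤ s.re) :
    s = csq z := by
  rw [← csq_sq z] at hs
  rcases sq_eq_sq_iff_eq_or_eq_neg.mp hs with h1 | h1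
  · exact h1
  · have := csq_re_pos hz
    rw [h1, Complex.neg_re] at h
    linarith

lemma csq_neg {z : ℂ} (hz : 0 < z.im) : csq (-z) = -Complex.I * csq z := by
  refine (csq_unique ?_ ?_ ?_).symm
  · right; simpa using hz.ne'
  · rw [mul_pow, csq_sq]; simp
  · simpa using (csq_im_pos hz).le

lemma csq_neg_one : csq (-1) = Complex.I := by
  rw [csq, Complex.cpow_def_of_ne_zero (by norm_num), Complex.log_neg_one]
  refine Eq.trans ?_ Complex.exp_pi_div_two_mul_I
  congr 1; ring

lemma csq_one : csq 1 = 1 := by simp [csq]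

lemma csq_I : csq Complex.I = zeta 3 := by
  rw [csq, Complex.cpow_def_of_ne_zero Complex.I_ne_zero, Complex.log_I, zeta, e]
  congr 1; push_cast; ring

/-- The two sides agree up to sign. With the wrong sign the product would lie in the open third
quadrant. As `csq u` has positive real part and `csq v` lies in the first quadrant, the product has
positive imaginary part if `csq u` is not below the real axis, and positive real part if it is not
above. -/
lemma csq_mul_of_im_pos {u v : ℂ} (hu : u ∈ Complex.slitPlane) (hv : 0 < v.im)
    (huv : 0 < (u * v).im) : csq u * csq v = csq (u * v) := by
  have h1 := csq_re_pos hu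
  have h3 := csq_re_pos (mem_slitPlane_of_im_pos hv)
  have h4 := csq_im_pos hv
  have h5 : (csq u * csq v) ^ 2 = csq (u * v) ^ 2 := by rw [mul_pow, csq_sq, csq_sq, csq_sq]
  rcases sq_eq_sq_iff_eq_or_eq_neg.mp h5 with h | h
  · exact h
  · exfalso
    have h6 := csq_im_pos huv
    have h8 := csq_re_pos (mem_slitPlane_of_im_pos huv)
    have h7 := congrArg Complex.im h
    have h9 := congrArg Complex.re h
    rw [Complex.mul_im, Complex.neg_im] at h7
    rw [Complex.mul_re, Complex.neg_re] at h9
    rcases le_total 0 (csq u).im with h2 | h2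
    · nlinarith [mul_pos h1 h4, mul_nonneg h2 h3.le]
    · nlinarith [mul_pos h1 h3, mul_nonneg (neg_nonneg.mpr h2) h4.le]

/-! ### The multiplier system of the eta function -/

lemma mobius_im {a b c d : ℝ} (hdet : a * d - b * c = 1) (τ : ℂ) :
    (((a : ℂ) * τ + b) / ((c : ℂ) * τ + d)).im = τ.im / Complex.normSq ((c : ℂ) * τ + d) := by
  rw [Complex.div_im]
  simp only [Complex.add_im, Complex.mul_im, Complex.ofReal_re, Complex.ofReal_im, Complex.add_re,
    Complex.mul_re]
  rw [← sub_div]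
  congr 1
  linear_combination τ.im * hdet

lemma denom_ne_zero {c d : ℤ} (h : IsCoprime c d) {τ : ℂ} (hτ : 0 < τ.im) :
    (c : ℂ) * τ + d ≠ 0 := by
  intro H
  have h1 : (c : ℝ) * τ.im = 0 := by simpa using congrArg Complex.im H
  have h2 : (c : ℝ) * τ.re + d = 0 := by simpa using congrArg Complex.re H
  rw [mul_eq_zero] at h1
  rcases h1 with h1 | h1
  · rw [h1, zero_mul, zero_add] at h2
    have hc : c = 0 := by exact_mod_cast h1
    have hd : d = 0 := by exact_mod_cast h2
    rw [hc, hd] at h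
    exact not_isUnit_zero (isCoprime_zero_left.mp h)
  · exact hτ.ne' h1

lemma isCoprime_bottom {a b c d : ℤ} (hdet : a * d - b * c = 1) : IsCoprime c d :=
  ⟨-b, a, by linarith⟩

lemma mobius_im_pos {a b c d : ℤ} (hdet : a * d - b * c = 1) {τ : ℂ} (hτ : 0 < τ.im) :
    0 < (((a : ℂ) * τ + b) / ((c : ℂ) * τ + d)).im := by
  have := mobius_im (a := a) (b := b) (c := c) (d := d) (by exact_mod_cast hdet) τ
  push_cast at this
  rw [this]
  exact div_pos hτ (Complex.normSq_pos.mpr (denom_ne_zero (isCoprime_bottom hdet) hτ))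

/-- `v` is the value of the multiplier system of `η` at the matrix `(a, b; c, d)`. -/
def IsEtaMult (a b c d : ℤ) (v : ℂ) : Prop :=
  ∀ τ : ℂ, 0 < τ.im → ModularForm.eta (((a : ℂ) * τ + b) / ((c : ℂ) * τ + d)) =
    v * csq ((c : ℂ) * τ + d) * ModularForm.eta τ

/-- One point suffices because η has no zeros. This is what allows the Dedekind sum in the character
to be replaced by Jacobi symbols. -/
lemma IsEtaMult.unique {a b c d : ℤ} (hdet : a * d - b * c = 1) {v v' : ℂ}
    (h : IsEtaMult a b c d v) (h' : IsEtaMult a b c d v') : v = v' := by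
  have h1 := h Complex.I (by simp)
  rw [h' Complex.I (by simp)] at h1
  have h2 : ModularForm.eta Complex.I ≠ 0 := ModularForm.eta_ne_zero (by simp)
  have h3 := csq_ne_zero (denom_ne_zero (isCoprime_bottom hdet) (τ := Complex.I) (by simp))
  exact (mul_right_cancel₀ h3 (mul_right_cancel₀ h2 h1)).symm

lemma eta_add_one (τ : ℂ) : ModularForm.eta (τ + 1) = zeta 1 * ModularForm.eta τ := by
  unfold ModularForm.eta
  have h1 : Function.Periodic.qParam 24 (τ + 1) = zeta 1 * Function.Periodic.qParam 24 τ := by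
    simp only [Function.Periodic.qParam, zeta, e, ← Complex.exp_add]
    congr 1; push_cast; ring
  have h2 : ∀ n, ModularForm.eta_q n (τ + 1) = ModularForm.eta_q n τ := by
    intro n
    simp [ModularForm.eta_q_eq_pow, mul_add, Complex.exp_add]
  simp only [h1, h2, mul_assoc]

lemma eta_neg_inv {τ : ℂ} (hτ : 0 < τ.im) :
    ModularForm.eta (-1 / τ) = zeta (-3) * csq τ * ModularForm.eta τ := by
  have := ModularForm.eta_comp_eq_csqrt_I_inv (x := τ) hτ
  rw [zeta_neg, ← csq_I]
  simpa [Complex.sqrt, csq, mul_assoc] using this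

lemma isEtaMult_one : IsEtaMult 1 0 0 1 1 := fun τ _ => by simp [csq_one]

lemma IsEtaMult.mul_T {a b c d : ℤ} {v : ℂ} (h : IsEtaMult a b c d v) :
    IsEtaMult a (b + a) c (d + c) (v * zeta 1) := fun τ hτ => by
  have := h (τ + 1) (by simpa using hτ)
  rw [eta_add_one] at this
  push_cast
  rw [show (a : ℂ) * τ + (b + a) = a * (τ + 1) + b by ring,
    show (c : ℂ) * τ + (d + c) = c * (τ + 1) + d by ring, this]
  ring

lemma IsEtaMult.mul_T_inv {a b c d : ℤ} {v : ℂ} (h : IsEtaMult a (b + a) c (d + c) (v * zeta 1)) :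
    IsEtaMult a b c d v := fun τ hτ => by
  have := h (τ - 1) (by simpa using hτ)
  have h2 := eta_add_one (τ - 1)
  rw [sub_add_cancel] at h2
  push_cast at this
  rw [show (a : ℂ) * τ + b = a * (τ - 1) + (b + a) by ring,
    show (c : ℂ) * τ + d = c * (τ - 1) + (d + c) by ring, this, h2]
  ring

lemma im_neg_one_div_pos {τ : ℂ} (hτ : 0 < τ.im) : 0 < (-1 / τ).im := by
  have h0 : τ ≠ 0 := by rintro rfl; simp at hτ
  have := div_pos hτ (Complex.normSq_pos.mpr h0)
  simpa [Complex.div_im, neg_div] using this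

/-- Positivity of `d` puts dτ - c in the upper half-plane and keeps c(-1/τ) + d off the branch cut
(also for `c = 0`), so the square roots multiply without a sign. -/
lemma csq_S_cocycle {c d : ℤ} (hd : 0 < d) {τ : ℂ} (hτ : 0 < τ.im) :
    csq ((c : ℂ) * (-1 / τ) + d) * csq τ = csq ((d : ℂ) * τ + ((-c : ℤ) : ℂ)) := by
  have h0 : τ ≠ 0 := by rintro rfl; simp at hτ
  have h1 : ((c : ℂ) * (-1 / τ) + d) * τ = (d : ℂ) * τ + ((-c : ℤ) : ℂ) := by
    push_cast; field_simp; ring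
  have him : ((c : ℂ) * (-1 / τ) + d).im = c * (-1 / τ).im := by
    simp
  rw [← h1]
  refine csq_mul_of_im_pos ?_ hτ ?_
  · rcases eq_or_ne c 0 with h | h
    · left; rw [h]; simpa using hd
    · right
      rw [him]
      have : (c : ℝ) ≠ 0 := by exact_mod_cast h
      exact mul_ne_zero this (im_neg_one_div_pos hτ).ne'
  · rw [h1]
    have : (0 : ℝ) < d := by exact_mod_cast hd
    simp only [Complex.add_im, Complex.mul_im, Complex.intCast_re, Complex.intCast_im]
    simpa using mul_pos this hτ

lemma IsEtaMult.mul_S {a b c d : ℤ} (hd : 0 < d) {v : ℂ} (h : IsEtaMult a b c d v) :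
    IsEtaMult b (-a) d (-c) (v * zeta (-3)) := fun τ hτ => by
  have h0 : τ ≠ 0 := by rintro rfl; simp at hτ
  have h2 := im_neg_one_div_pos hτ
  have := h (-1 / τ) h2
  rw [eta_neg_inv hτ] at this
  rw [← csq_S_cocycle hd hτ]
  have h3 : ((b : ℂ) * τ + ((-a : ℤ) : ℂ)) / ((d : ℂ) * τ + ((-c : ℤ) : ℂ)) =
      ((a : ℂ) * (-1 / τ) + b) / ((c : ℂ) * (-1 / τ) + d) := by
    have e1 : (b : ℂ) * τ + ((-a : ℤ) : ℂ) = ((a : ℂ) * (-1 / τ) + b) * τ := by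
      push_cast; field_simp; ring
    have e2 : (d : ℂ) * τ + ((-c : ℤ) : ℂ) = ((c : ℂ) * (-1 / τ) + d) * τ := by
      push_cast; field_simp; ring
    rw [e1, e2, mul_div_mul_right _ _ h0]
  rw [h3, this]
  ring

lemma IsEtaMult.mul_S_inv {a b c d : ℤ} (hd : 0 < d) {v : ℂ}
    (h : IsEtaMult b (-a) d (-c) (v * zeta (-3))) : IsEtaMult a b c d v := fun τ hτ => by
  have h0 : τ ≠ 0 := by rintro rfl; simp at hτ
  have h2 := im_neg_one_div_pos hτ
  have h4 : -1 / (-1 / τ) = τ := by field_simp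
  have h5 := csq_S_cocycle (c := c) hd h2
  have h6 := eta_neg_inv h2
  have := h (-1 / τ) h2
  rw [h4] at h5 h6
  rw [← h5] at this
  rw [h6]
  have h3 : ((b : ℂ) * (-1 / τ) + ((-a : ℤ) : ℂ)) / ((d : ℂ) * (-1 / τ) + ((-c : ℤ) : ℂ)) =
      ((a : ℂ) * τ + b) / ((c : ℂ) * τ + d) := by
    have e1 : ((b : ℂ) * (-1 / τ) + ((-a : ℤ) : ℂ)) = ((a : ℂ) * τ + b) * (-1 / τ) := by
      push_cast; field_simp; ring
    have e2 : ((d : ℂ) * (-1 / τ) + ((-c : ℤ) : ℂ)) = ((c : ℂ) * τ + d) * (-1 / τ) := by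
      push_cast; field_simp; ring
    rw [e1, e2, mul_div_mul_right _ _ (by simpa using h0)]
  rw [← h3, this]
  ring

lemma IsEtaMult.neg {a b c d : ℤ} (hc : c < 0) {v : ℂ} (h : IsEtaMult (-a) (-b) (-c) (-d) v) :
    IsEtaMult a b c d (v * zeta 6) := fun τ hτ => by
  have := h τ hτ
  push_cast at this
  have h1 : 0 < (-(c : ℂ) * τ + -d).im := by
    have : (c : ℝ) < 0 := by exact_mod_cast hc
    simp; nlinarith
  have h2 := csq_neg h1
  rw [show -(-(c : ℂ) * τ + -d) = c * τ + d by ring] at h2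
  rw [h2, zeta_six]
  rw [show (-(a : ℂ) * τ + -b) / (-(c : ℂ) * τ + -d) = (a * τ + b) / (c * τ + d) by
    rw [← neg_div_neg_eq]; ring_nf] at this
  rw [this]
  linear_combination (csq (-(c : ℂ) * τ + -d) * v * ModularForm.eta τ) * Complex.I_sq

/-- Induction along the Euclidean algorithm for matrices with positive lower left entry. -/
lemma euclid_induction {P : ℤ → ℤ → ℤ → ℤ → Prop} (hone : ∀ b, P 1 b 0 1)
    (hT : ∀ a b c d, 0 < c → a * d - b * c = 1 → P a b c d → P a (b + a) c (d + c))
    (hT' : ∀ a b c d, 0 < c → a * d - b * c = 1 → P a (b + a) c (d + c) → P a b c d)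
    (hS : ∀ a b c d, 0 ≤ c → 0 < d → a * d - b * c = 1 → P a b c d → P b (-a) d (-c)) :
    ∀ a b c d : ℤ, 0 < c → a * d - b * c = 1 → P a b c d := by
  have hshift : ∀ a b c d : ℤ, 0 < c → a * d - b * c = 1 → ∀ j : ℤ,
      P a (b + j * a) c (d + j * c) → P a b c d := by
    intro a b c d hc hdet j
    induction j with
    | zero => simp
    | succ j ih =>
      intro h
      refine ih (hT' _ _ _ _ hc (by linear_combination hdet) ?_)
      convert h using 1 <;> ring
    | pred j ih =>
      intro h
      refine ih ?_
      have := hT _ _ _ _ hc (by linear_combination hdet) h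
      convert this using 1 <;> ring
  suffices H : ∀ n : ℕ, ∀ a b c d : ℤ, 0 < c → c.natAbs = n → a * d - b * c = 1 → P a b c d from
    fun a b c d hc hdet => H _ a b c d hc rfl hdet
  intro n
  induction n using Nat.strong_induction_on with
  | _ n ih =>
    intro a b c d hc hn hdet
    have e1 := Int.emod_add_mul_ediv (-d) c
    have e2 := Int.emod_nonneg (-d) hc.ne'
    have e3 := Int.emod_lt_of_pos (-d) hc
    set r := (-d) % c
    set j := (-d) / c
    -- The shift makes the lower right entry equal to `-r` with `0 ≤ r < c`. The shifted matrix is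
    -- then the image under `hS` of one with lower left entry `r`, which is smaller; for `r = 0` the
    -- determinant forces `c = 1`.
    apply hshift a b c d hc hdet j
    have e4 : d + j * c = -r := by linarith
    rw [e4]
    have hdet' : (-(b + j * a)) * c - a * r = 1 := by linear_combination hdet - a * e4
    have key : P (-(b + j * a)) a r c := by
      rcases e2.eq_or_lt with h | h
      · rw [← h] at hdet' ⊢
        simp only [mul_zero, sub_zero] at hdet'
        have hc1 : c = 1 := by
          have := Int.eq_one_or_neg_one_of_mul_eq_one' hdet'
          omega
        subst hc1
        rw [mul_one] at hdet'
        rw [hdet']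
        exact hone a
      · exact ih r.natAbs (by omega) _ _ _ _ h rfl hdet'
    have := hS _ _ _ _ e2 hc hdet' key
    simpa using this

/-- The multiplier system of the eta function in terms of Dedekind sums. -/
theorem isEtaMult_Psi {a b c d : ℤ} (hdet : a * d - b * c = 1) :
    IsEtaMult a b c d (zeta (Psi !![a, b; c, d])) := by
  have hzero : ∀ b : ℤ, IsEtaMult 1 b 0 1 (zeta (Psi !![1, b; 0, 1])) := by
    intro b
    induction b with
    | zero => simpa [Psi_zero, zeta_zero] using isEtaMult_one
    | succ j ih =>
      rw [Psi_zero] at ih ⊢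
      have := ih.mul_T
      rw [← zeta_add] at this
      simpa using this
    | pred j ih =>
      rw [Psi_zero] at ih ⊢
      refine IsEtaMult.mul_T_inv ?_
      rw [← zeta_add]
      simpa using ih
  have hpos : ∀ a b c d : ℤ, 0 < c → a * d - b * c = 1 →
      IsEtaMult a b c d (zeta (Psi !![a, b; c, d])) := by
    apply euclid_induction (P := fun a b c d => IsEtaMult a b c d (zeta (Psi !![a, b; c, d]))) hzero
    · intro a b c d hc hdet h
      rw [Psi_T _ _ _ _ hc, zeta_add]
      exact h.mul_T
    · intro a b c d hc hdet h
      rw [Psi_T _ _ _ _ hc, zeta_add] at h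
      exact h.mul_T_inv
    · intro a b c d hc hd hdet h
      rcases hc.eq_or_lt with rfl | hc
      · have h1 : a * d = 1 := by linarith
        have hd1 : d = 1 := by
          have := Int.eq_one_or_neg_one_of_mul_eq_one' h1
          omega
        subst hd1
        rw [mul_one] at h1
        subst h1
        rw [neg_zero, Psi_S_zero, sub_eq_add_neg, zeta_add]
        simpa using h.mul_S one_pos
      · rw [Psi_S _ _ _ _ hc hd hdet, sub_eq_add_neg, zeta_add]
        exact h.mul_S hd
  rcases lt_trichotomy c 0 with hc | rfl | hc
  · rw [Psi_neg_of_neg _ _ _ hc, zeta_add]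
    exact (hpos _ _ _ _ (neg_pos.mpr hc) (by linear_combination hdet)).neg hc
  · have h1 : a * d = 1 := by linarith
    rcases Int.eq_one_or_neg_one_of_mul_eq_one' h1 with ⟨rfl, rfl⟩ | ⟨rfl, rfl⟩
    · exact hzero b
    · rw [Psi_neg_one, sub_eq_add_neg, zeta_add]
      intro τ hτ
      have := hzero (-b) τ hτ
      simp only [Int.cast_zero, zero_mul, zero_add, Int.cast_neg, Int.cast_one, csq_one, csq_neg_one,
        zeta_neg_six] at this ⊢
      rw [show (-1 * τ + (b : ℂ)) / -1 = (1 * τ + -b) / 1 by ring, this]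
      linear_combination (zeta (Psi !![1, -b; 0, 1]) * ModularForm.eta τ) * Complex.I_sq
  · exact hpos _ _ _ _ hc hdet

/-- The exponent in the explicit form of the multiplier system of `η`. -/
def etaExp (a b c d : ℤ) : ℤ := (a + d) * c - b * d * (c ^ 2 - 1)

lemma twentyFour_dvd_of_odd {c : ℤ} (hc : Odd c) : (24 : ℤ) ∣ (c ^ 2 - 1) * c := by
  have h8 : (8 : ℤ) ∣ c ^ 2 - 1 := Int.eight_dvd_sq_sub_one_of_odd hc
  have h3 : (3 : ℤ) ∣ (c ^ 2 - 1) * c := by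
    have h : c % 3 = 0 ∨ c % 3 = 1 ∨ c % 3 = 2 := by omega
    apply Int.dvd_of_emod_eq_zero
    rcases h with h | h | h <;> simp [pow_two, Int.mul_emod, Int.sub_emod, h]
  exact IsCoprime.mul_dvd (by norm_num : IsCoprime (8 : ℤ) 3) (h8.mul_right c) h3

lemma jacobi_neg_one_eq_zeta {d : ℕ} (hd : Odd d) : ((J(-1 | d) : ℤ) : ℂ) = zeta (6 * (d - 1)) := by
  obtain ⟨m, rfl⟩ := hd
  rw [jacobiSym.at_neg_one ⟨m, rfl⟩, ZMod.χ₄_eq_neg_one_pow (by omega)]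
  have h : (2 * m + 1) / 2 = m := by omega
  rw [h, show (6 : ℚ) * (((2 * m + 1 : ℕ) : ℚ) - 1) = 12 * ((m : ℤ) : ℚ) by push_cast; ring,
    zeta_twelve_mul]
  push_cast
  rw [zpow_natCast]

lemma jacobi_reciprocity_zeta {c d : ℕ} (hc : Odd c) (hd : Odd d) :
    ((J(c | d) : ℤ) : ℂ) = ((J(d | c) : ℤ) : ℂ) * zeta (3 * (c - 1) * (d - 1)) := by
  rw [jacobiSym.quadratic_reciprocity hc hd]
  obtain ⟨m, rfl⟩ := hc
  obtain ⟨n, rfl⟩ := hd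
  have h : (2 * m + 1) / 2 = m := by omega
  have h' : (2 * n + 1) / 2 = n := by omega
  rw [h, h', show (3 : ℚ) * (((2 * m + 1 : ℕ) : ℚ) - 1) * (((2 * n + 1 : ℕ) : ℚ) - 1) =
    12 * (((m * n : ℕ) : ℤ) : ℚ) by push_cast; ring, zeta_twelve_mul, zpow_natCast]
  push_cast
  ring

/-- The value of the multiplier system of `η` at a matrix with odd lower left entry `c > 0`. -/
def multOddC (a b c d : ℤ) : ℂ := ((J(d | c.natAbs) : ℤ) : ℂ) * zeta ((etaExp a b c d - 3 * c : ℤ))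

lemma multOddC_T {a b c d : ℤ} (hc : 0 < c) (hodd : Odd c) (hdet : a * d - b * c = 1) :
    multOddC a (b + a) c (d + c) = multOddC a b c d * zeta 1 := by
  have h1 : J(d + c | c.natAbs) = J(d | c.natAbs) := by
    apply jacobiSym.mod_left'
    rw [Int.natCast_natAbs, abs_of_pos hc]; simp
  have h2 : zeta ((etaExp a (b + a) c (d + c) - 3 * c : ℤ)) =
      zeta ((etaExp a b c d - 3 * c + 1 : ℤ)) := by
    apply zeta_eq_of_dvd
    have : etaExp a (b + a) c (d + c) - 3 * c - (etaExp a b c d - 3 * c + 1) =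
        (c ^ 2 - 1) * c * (-(a + 2 * b)) := by
      unfold etaExp
      linear_combination (-(c ^ 2 - 1)) * hdet
    rw [this]
    exact (twentyFour_dvd_of_odd hodd).mul_right _
  rw [multOddC, multOddC, h1, h2]
  push_cast
  rw [zeta_add]
  ring

/-- Quadratic reciprocity and the value of (-1/d), both written as 24th roots of unity, account
exactly for the change of the exponent. -/
lemma multOddC_S {a b c d : ℤ} (hc : 0 < c) (hd : 0 < d) (hodd : Odd c) (hodd' : Odd d)
    (hdet : a * d - b * c = 1) :
    multOddC b (-a) d (-c) = multOddC a b c d * zeta (-3) := by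
  obtain ⟨m, rfl⟩ := Int.eq_ofNat_of_zero_le hc.le
  obtain ⟨n, rfl⟩ := Int.eq_ofNat_of_zero_le hd.le
  have hm : Odd m := by exact_mod_cast hodd
  have hn : Odd n := by exact_mod_cast hodd'
  unfold multOddC
  simp only [Int.natAbs_natCast]
  rw [neg_eq_neg_one_mul (m : ℤ), jacobiSym.mul_left, Int.cast_mul, jacobi_neg_one_eq_zeta hn,
    jacobi_reciprocity_zeta hm hn]
  have h2 : zeta (6 * ((n : ℚ) - 1)) * zeta (3 * (m - 1) * (n - 1)) *
      zeta ((etaExp b (-a) n (-1 * m) - 3 * n : ℤ)) = zeta ((etaExp a b m n - 3 * m : ℤ)) * zeta (-3)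
      := by
    rw [← zeta_add, ← zeta_add, ← zeta_add]
    have hdet' : (a : ℚ) * n - b * m = 1 := by exact_mod_cast hdet
    congr 1
    unfold etaExp
    push_cast
    linear_combination (-(m : ℚ) * n) * hdet'
  linear_combination ((J((n : ℤ) | m) : ℤ) : ℂ) * h2

/-- A Euclidean descent on `c` that stays within odd lower left entries. Since `multOddC_S` needs
both bottom entries odd, the remainder used is whichever of `r` and `c - r` is odd. -/
theorem isEtaMult_multOddC {a b c d : ℤ} (hc : 0 < c) (hodd : Odd c) (hdet : a * d - b * c = 1) :
    IsEtaMult a b c d (multOddC a b c d) := by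
  have hshift : ∀ a b c d : ℤ, 0 < c → Odd c → a * d - b * c = 1 → ∀ j : ℤ,
      IsEtaMult a (b + j * a) c (d + j * c) (multOddC a (b + j * a) c (d + j * c)) →
      IsEtaMult a b c d (multOddC a b c d) := by
    intro a b c d hc hodd hdet j
    induction j with
    | zero => simp
    | succ j ih =>
      intro h
      refine ih (IsEtaMult.mul_T_inv ?_)
      rw [← multOddC_T hc hodd (by linear_combination hdet)]
      convert h using 1 <;> ring_nf
    | pred j ih =>
      intro h
      refine ih ?_
      have := h.mul_T
      rw [← multOddC_T hc hodd (by linear_combination hdet)] at this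
      convert this using 1 <;> ring_nf
  suffices H : ∀ n : ℕ, ∀ a b c d : ℤ, 0 < c → Odd c → c.natAbs = n → a * d - b * c = 1 →
      IsEtaMult a b c d (multOddC a b c d) from H _ a b c d hc hodd rfl hdet
  clear hdet hodd hc a b c d
  intro n
  induction n using Nat.strong_induction_on with
  | _ n ih =>
    intro a b c d hc hodd hn hdet
    rcases eq_or_ne c 1 with rfl | hc1
    · apply hshift a b 1 d hc hodd hdet (-d)
      have h1 := (isEtaMult_Psi (show (1 : ℤ) * 1 - a * 0 = 1 by ring)).mul_S one_pos
      rw [Psi_zero] at h1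
      have hb : b + -d * a = -1 := by linear_combination -hdet
      have hd : d + -d * 1 = 0 := by ring
      rw [hb, hd]
      have h2 : multOddC a (-1) 1 0 = zeta a * zeta (-3) := by
        unfold multOddC etaExp
        rw [← zeta_add]
        simp
        ring_nf
      rw [h2]
      simpa using h1
    · have e1 := Int.emod_add_mul_ediv d c
      have e2 := Int.emod_nonneg d hc.ne'
      have e3 := Int.emod_lt_of_pos d hc
      set r := d % c
      set j := d / c
      have hr0 : r ≠ 0 := by
        intro h0
        have : c ∣ 1 := ⟨a * j - b, by rw [← hdet]; linear_combination (-a) * e1 + a * h0⟩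
        have := Int.eq_one_of_dvd_one hc.le this
        exact hc1 this
      rcases Int.even_or_odd r with hr | hr
      -- One shift more than division by `c` prescribes: the lower right entry becomes `-(c - r)`,
      -- which is odd and of absolute value less than `c`.
      · apply hshift a b c d hc hodd hdet (-j - 1)
        have hodd' : Odd (c - r) := hodd.sub_even hr
        have e4 : d + (-j - 1) * c = -(c - r) := by linarith
        have hdet' : (-(b + (-j - 1) * a)) * c - a * (c - r) = 1 := by
          linear_combination hdet - a * e4
        have h1 := (ih (c - r).natAbs (by omega) _ _ _ _ (by omega) hodd' rfl hdet').mul_S hc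
        rw [← multOddC_S (by omega) hc hodd' hodd hdet'] at h1
        rw [e4]
        simpa using h1
      · apply hshift a b c d hc hodd hdet (-j)
        have e4 : d + -j * c = r := by linarith
        rw [e4]
        have hdet' : a * r - (b + -j * a) * c = 1 := by linear_combination hdet - a * e4
        refine IsEtaMult.mul_S_inv (by omega) ?_
        rw [← multOddC_S hc (by omega) hodd hr hdet']
        refine ih r.natAbs (by omega) _ _ _ _ (by omega) hr rfl ?_
        linear_combination hdet'

/-- The value of the multiplier system of `η` at a matrix with odd lower right entry `d > 0`. -/
def multOddD (a b c d : ℤ) : ℂ :=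
  ((J(c | d.natAbs) : ℤ) : ℂ) * zeta ((etaExp a b c d + 3 * d - 3 - 3 * c * d : ℤ))

/-- Multiplication by S moves the odd entry `d` to the lower left, where the previous formula
applies. No condition on the sign or parity of `c` is needed. -/
theorem isEtaMult_multOddD {a b c d : ℤ} (hd : 0 < d) (hodd : Odd d)
    (hdet : a * d - b * c = 1) : IsEtaMult a b c d (multOddD a b c d) := by
  refine IsEtaMult.mul_S_inv hd ?_
  have h1 := isEtaMult_multOddC (a := b) (b := -a) hd hodd (d := -c) (by linear_combination hdet)
  convert h1 using 1
  obtain ⟨n, rfl⟩ := Int.eq_ofNat_of_zero_le hd.le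
  have hn : Odd n := by exact_mod_cast hodd
  unfold multOddC multOddD
  simp only [Int.natAbs_natCast]
  rw [neg_eq_neg_one_mul c, jacobiSym.mul_left, Int.cast_mul, jacobi_neg_one_eq_zeta hn]
  have h2 : zeta (6 * ((n : ℚ) - 1)) * zeta ((etaExp b (-a) n (-1 * c) - 3 * n : ℤ)) =
      zeta ((etaExp a b c n + 3 * n - 3 - 3 * c * n : ℤ)) * zeta (-3) := by
    rw [← zeta_add, ← zeta_add]
    have hdet' : (a : ℚ) * n - b * c = 1 := by exact_mod_cast hdet
    congr 1
    unfold etaExp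
    push_cast
    linear_combination (-(c : ℚ) * n) * hdet'
  linear_combination (-((J(c | n) : ℤ) : ℂ)) * h2

end

end EtaQuot

namespace EtaQuot

noncomputable section

open scoped NumberTheorySymbols
open UpperHalfPlane

/-! ### Eta-quotients and their characters -/

/-- The eta-quotient as a function on the complex numbers. -/
def etaQ (r : ℕ+ →₀ ℤ) (τ : ℂ) : ℂ :=
  r.prod fun n k => ModularForm.eta ((n : ℂ) * τ) ^ k

lemma etaQuotient_apply (r : ℕ+ →₀ ℤ) (τ : ℍ) : etaQuotient r τ = etaQ r τ := rfl

lemma natCast_mul_im_pos (n : ℕ+) {τ : ℂ} (hτ : 0 < τ.im) : 0 < ((n : ℂ) * τ).im := by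
  have : (0 : ℝ) < (n : ℕ) := by exact_mod_cast n.pos
  simpa using mul_pos this hτ

lemma etaQ_ne_zero (r : ℕ+ →₀ ℤ) {τ : ℂ} (hτ : 0 < τ.im) : etaQ r τ ≠ 0 :=
  Finset.prod_ne_zero_iff.mpr fun n _ =>
    zpow_ne_zero _ (ModularForm.eta_ne_zero (natCast_mul_im_pos n hτ))

lemma differentiableAt_etaQ (r : ℕ+ →₀ ℤ) {τ : ℂ} (hτ : 0 < τ.im) :
    DifferentiableAt ℂ (etaQ r) τ := by
  unfold etaQ Finsupp.prod
  refine DifferentiableAt.fun_finsetProd fun n _ => ?_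
  have h := natCast_mul_im_pos n hτ
  refine DifferentiableAt.zpow ?_ (Or.inl (ModularForm.eta_ne_zero h))
  exact (ModularForm.differentiableAt_eta_of_mem_upperHalfPlaneSet h).comp τ (by fun_prop)

lemma dvd_level (r : ℕ+ →₀ ℤ) {n : ℕ+} (hn : n ∈ r.support) : (n : ℕ) ∣ level r :=
  Finset.dvd_lcm hn

lemma level_pos (r : ℕ+ →₀ ℤ) : 0 < level r := by
  refine Nat.pos_of_ne_zero fun h => ?_
  obtain ⟨n, -, hn⟩ := Finset.lcm_eq_zero_iff.mp h
  exact n.ne_zero hn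

/-- The complementary divisor `N/n` of a divisor `n` of the level `N`. -/
def codiv (r : ℕ+ →₀ ℤ) (n : ℕ+) : ℕ := level r / (n : ℕ)

lemma codiv_mul (r : ℕ+ →₀ ℤ) {n : ℕ+} (hn : n ∈ r.support) : codiv r n * n = level r :=
  Nat.div_mul_cancel (dvd_level r hn)

lemma codiv_mul_int (r : ℕ+ →₀ ℤ) {n : ℕ+} (hn : n ∈ r.support) :
    (codiv r n : ℤ) * (n : ℕ) = level r := by exact_mod_cast codiv_mul r hn

lemma codiv_pos (r : ℕ+ →₀ ℤ) {n : ℕ+} (hn : n ∈ r.support) : 0 < codiv r n :=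
  Nat.pos_of_ne_zero fun h => by
    have := codiv_mul r hn
    rw [h, zero_mul] at this
    exact (level_pos r).ne this

lemma level_mul_ediv (r : ℕ+ →₀ ℤ) {n : ℕ+} (hn : n ∈ r.support) (t : ℤ) :
    ((level r : ℤ) * t) / ((n : ℕ) : ℤ) = codiv r n * t := by
  rw [← codiv_mul_int r hn]
  have : ((n : ℕ) : ℤ) ≠ 0 := by exact_mod_cast n.ne_zero
  rw [show (codiv r n : ℤ) * ((n : ℕ) : ℤ) * t = (codiv r n * t) * ((n : ℕ) : ℤ) by ring]
  exact Int.mul_ediv_cancel _ this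

lemma det_scaled {r : ℕ+ →₀ ℤ} {n : ℕ+} (hn : n ∈ r.support) {a b t d : ℤ}
    (hdet : a * d - b * ((level r : ℤ) * t) = 1) :
    a * d - (b * (n : ℕ)) * (codiv r n * t) = 1 := by
  rw [← hdet, ← codiv_mul_int r hn]; ring

lemma prod_zeta_zpow (r : ℕ+ →₀ ℤ) (x : ℕ+ → ℚ) :
    ∏ n ∈ r.support, zeta (x n) ^ r n = zeta (∑ n ∈ r.support, r n * x n) := by
  induction r.support using Finset.cons_induction with
  | empty => simp [zeta_zero]
  | cons n s hn ih => rw [Finset.prod_cons, Finset.sum_cons, ih, zeta_add, zeta_zpow]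

lemma etaChar_apply (r : ℕ+ →₀ ℤ) (M : Matrix (Fin 2) (Fin 2) ℤ) (ε : ℤˣ) :
    etaChar r M ε = ((ε : ℤ) : ℂ) ^ (-twoK r) * etaChar r M 1 := by
  simp [etaChar]

/-- By uniqueness of the multiplier, any known formula for the factors may stand in for `Psi`. -/
lemma etaChar_eq_prod (r : ℕ+ →₀ ℤ) {a b t d : ℤ} {v : ℕ+ → ℂ}
    (hdet : a * d - b * ((level r : ℤ) * t) = 1)
    (hv : ∀ n ∈ r.support, IsEtaMult a (b * (n : ℕ)) (codiv r n * t) d (v n)) :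
    etaChar r !![a, b; (level r : ℤ) * t, d] 1 = ∏ n ∈ r.support, v n ^ r n := by
  have h1 : etaChar r !![a, b; (level r : ℤ) * t, d] 1 = zeta (∑ n ∈ r.support,
      (r n : ℚ) * Psi !![a, b * (n : ℕ); codiv r n * t, d]) := by
    simp only [etaChar, Finsupp.sum, Units.val_one, Int.cast_one, one_zpow, one_mul, zeta]
    rw [one_div, inv_mul_eq_div]
    congr 3
    refine Finset.sum_congr rfl fun n hn => ?_
    simp [level_mul_ediv r hn]
  rw [h1, ← prod_zeta_zpow]
  refine Finset.prod_congr rfl fun n hn => ?_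
  rw [(hv n hn).unique (det_scaled hn hdet) (isEtaMult_Psi (det_scaled hn hdet))]

/-- The point n·γτ is (a, bn; c/n, d) applied to nτ, and this matrix has the same denominator cτ + d
for every `n`; so the square roots combine to the power `twoK r`. -/
lemma etaQ_mobius (r : ℕ+ →₀ ℤ) {a b c d : ℤ} (hc : (level r : ℤ) ∣ c) (hdet : a * d - b * c = 1)
    {τ : ℂ} (hτ : 0 < τ.im) :
    etaQ r (((a : ℂ) * τ + b) / ((c : ℂ) * τ + d)) =
      etaChar r !![a, b; c, d] 1 * csq ((c : ℂ) * τ + d) ^ twoK r * etaQ r τ := by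
  obtain ⟨t, rfl⟩ := hc
  rw [etaChar_eq_prod r hdet (fun n hn => isEtaMult_Psi (det_scaled hn hdet))]
  unfold etaQ twoK Finsupp.prod Finsupp.sum
  have h0 := csq_ne_zero (denom_ne_zero (isCoprime_bottom hdet) hτ)
  have h1 : csq ((((level r : ℤ) * t : ℤ) : ℂ) * τ + d) ^ (∑ n ∈ r.support, r n) =
      ∏ n ∈ r.support, csq ((((level r : ℤ) * t : ℤ) : ℂ) * τ + d) ^ r n := by
    induction r.support using Finset.cons_induction with
    | empty => simp
    | cons n s hn ih => rw [Finset.prod_cons, Finset.sum_cons, ← ih, zpow_add₀ h0]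
  rw [h1, ← Finset.prod_mul_distrib, ← Finset.prod_mul_distrib]
  refine Finset.prod_congr rfl fun n hn => ?_
  have h2 := isEtaMult_Psi (det_scaled hn hdet) _ (natCast_mul_im_pos n hτ)
  have h3 : ((codiv r n * t : ℤ) : ℂ) * ((n : ℂ) * τ) = (((level r : ℤ) * t : ℤ) : ℂ) * τ := by
    rw [← codiv_mul_int r hn]; push_cast; ring
  rw [h3] at h2
  have h4 : (n : ℂ) * (((a : ℂ) * τ + b) / ((((level r : ℤ) * t : ℤ) : ℂ) * τ + d)) =
      ((a : ℂ) * ((n : ℂ) * τ) + ((b * (n : ℕ) : ℤ) : ℂ)) /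
        ((((level r : ℤ) * t : ℤ) : ℂ) * τ + d) := by
    push_cast; ring
  beta_reduce
  rw [h4, h2, mul_zpow, mul_zpow]

lemma coe_smul_eq (γ : SL(2, ℤ)) (τ : ℍ) :
    ((γ • τ : ℍ) : ℂ) = ((γ 0 0 : ℤ) * (τ : ℂ) + (γ 0 1 : ℤ)) / ((γ 1 0 : ℤ) * (τ : ℂ) + (γ 1 1 : ℤ)) := by
  rw [UpperHalfPlane.specialLinearGroup_apply]
  simp

lemma det_SL (γ : SL(2, ℤ)) : γ 0 0 * γ 1 1 - γ 0 1 * γ 1 0 = 1 := by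
  have := γ.det_coe
  rwa [Matrix.det_fin_two] at this

lemma mem_Gamma0_iff_dvd {N : ℕ} {γ : SL(2, ℤ)} :
    γ ∈ CongruenceSubgroup.Gamma0 N ↔ (N : ℤ) ∣ γ 1 0 := by
  rw [CongruenceSubgroup.Gamma0_mem]
  exact ZMod.intCast_zmod_eq_zero_iff_dvd _ _

lemma SL_coe_eq (γ : SL(2, ℤ)) : γ.1 = !![γ 0 0, γ 0 1; γ 1 0, γ 1 1] :=
  Matrix.eta_fin_two _

lemma etaQuotient_smul (r : ℕ+ →₀ ℤ) {γ : SL(2, ℤ)} (hγ : γ ∈ CongruenceSubgroup.Gamma0 (level r))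
    (τ : ℍ) : etaQuotient r (γ • τ) =
      etaChar r γ.1 1 * csq ((γ 1 0 : ℤ) * (τ : ℂ) + (γ 1 1 : ℤ)) ^ twoK r * etaQuotient r τ := by
  rw [etaQuotient_apply, etaQuotient_apply, coe_smul_eq,
    etaQ_mobius r (mem_Gamma0_iff_dvd.mp hγ) (det_SL γ) τ.im_pos, ← SL_coe_eq]

lemma denom_SL_ne_zero (γ : SL(2, ℤ)) (τ : ℍ) : (γ 1 0 : ℂ) * (τ : ℂ) + (γ 1 1 : ℂ) ≠ 0 :=
  denom_ne_zero (isCoprime_bottom (det_SL γ)) τ.im_pos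

/-- The product of an eta-quotient with an invariant function transforms like the eta-quotient. -/
lemma slash_etaQuotient_mul (r : ℕ+ →₀ ℤ) {h : ℍ → ℂ}
    (hh : ∀ γ ∈ CongruenceSubgroup.Gamma0 (level r), ∀ τ, h (γ • τ) = h τ)
    {γ : SL(2, ℤ)} (hγ : γ ∈ CongruenceSubgroup.Gamma0 (level r)) (ε : ℤˣ) :
    slash (twoK r) γ ε (etaQuotient r * h) = etaChar r γ.1 ε • (etaQuotient r * h) := by
  funext τ
  have h0 := csq_ne_zero (denom_SL_ne_zero γ τ)
  simp only [slash, Pi.mul_apply, Pi.smul_apply, smul_eq_mul]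
  rw [hh γ hγ, etaQuotient_smul r hγ, etaChar_apply r γ.1 ε, mul_zpow]
  change _ * csq _ ^ (-twoK r) * _ = _
  rw [zpow_neg (csq _)]
  field_simp

lemma mdifferentiable_etaQuotient (r : ℕ+ →₀ ℤ) :
    MDifferentiable 𝓘(ℂ) 𝓘(ℂ) (etaQuotient r) := by
  rw [UpperHalfPlane.mdifferentiable_iff]
  refine DifferentiableOn.congr
    (fun z hz => (differentiableAt_etaQ r hz).differentiableWithinAt) fun z hz => ?_
  simp [etaQuotient_apply, ofComplex_apply_of_im_pos hz]

lemma etaQuotient_mem_modularForms {r : ℕ+ →₀ ℤ} (hr : IsHolomorphicEtaQuotient r) :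
    etaQuotient r ∈ modularForms (level r) (twoK r) (etaChar r) := by
  refine ⟨mdifferentiable_etaQuotient r, fun γ hγ ε => ?_, hr⟩
  simpa using slash_etaQuotient_mul r (h := 1) (fun _ _ _ => rfl) hγ ε

end

end EtaQuot

namespace EtaQuot

noncomputable section

open scoped NumberTheorySymbols
open UpperHalfPlane

/-! ### Explicit form of the character -/

/-- `mf r` times the gcd is 24, and the gcd divides both sums. The congruence defining L_f enters
the proof only through these two divisibilities. -/
lemma twentyFour_dvd_of_mem_Lf {r : ℕ+ →₀ ℤ} {l : ℕ} (hl : l ∈ Lf r) :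
    (24 : ℤ) ∣ ((l : ℤ) - 1) * xOne r ∧ (24 : ℤ) ∣ ((l : ℤ) - 1) * xN r := by
  obtain ⟨-, h, -⟩ := hl
  set g := Nat.gcd 24 (Int.gcd (xOne r) (xN r)) with hg
  have hg24 : g * mf r = 24 := Nat.mul_div_cancel' (Nat.gcd_dvd_left _ _)
  have h1 : ((mf r : ℕ) : ℤ) ∣ (l : ℤ) - 1 := by
    have := (Nat.modEq_iff_dvd.mp h.symm)
    simpa using this
  have h24 : (24 : ℤ) = (mf r : ℤ) * g := by
    rw [mul_comm]; exact_mod_cast hg24.symm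
  have hgd : g ∣ Int.gcd (xOne r) (xN r) := Nat.gcd_dvd_right _ _
  have hgo : (g : ℤ) ∣ xOne r := (Int.natCast_dvd_natCast.mpr hgd).trans (Int.gcd_dvd_left ..)
  have hgn : (g : ℤ) ∣ xN r := (Int.natCast_dvd_natCast.mpr hgd).trans (Int.gcd_dvd_right ..)
  rw [h24]
  exact ⟨mul_dvd_mul h1 hgo, mul_dvd_mul h1 hgn⟩

lemma jacobi_zpow_eq_pow_natAbs {a : ℤ} {b : ℕ} (h : a.gcd b = 1) (n : ℤ) :
    ((J(a | b) : ℤ) : ℂ) ^ n = ((J(a | b) ^ n.natAbs : ℤ) : ℂ) := by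
  rcases Int.natAbs_eq n with hn | hn <;> conv_lhs => rw [hn]
  · rw [zpow_natCast]; push_cast; rfl
  · rw [zpow_neg, zpow_natCast, ← inv_pow]
    rcases jacobiSym.eq_one_or_neg_one h with h' | h' <;> simp [h', inv_neg]

lemma jacobi_zpow_even {a : ℤ} {b : ℕ} (h : a.gcd b = 1) {n : ℤ} (hn : Even n) :
    ((J(a | b) : ℤ) : ℂ) ^ n = 1 := by
  rcases jacobiSym.eq_one_or_neg_one h with h' | h' <;> simp [h', hn.neg_one_zpow]

/-- For integral weight the power is even; for half-integral weight `l` is a square. -/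
lemma jacobi_Lf_zpow {r : ℕ+ →₀ ℤ} {l : ℕ} (hl : l ∈ Lf r) {d : ℕ} (h : (l : ℤ).gcd d = 1) :
    ((J(l | d) : ℤ) : ℂ) ^ twoK r = 1 := by
  rcases Int.even_or_odd (twoK r) with hw | hw
  · exact jacobi_zpow_even h hw
  · obtain ⟨s, rfl⟩ := hl.2.2 hw
    have h2 : (s : ℤ).gcd d = 1 := by
      rw [Int.gcd_natCast_natCast] at h ⊢
      exact Nat.Coprime.coprime_mul_right h
    have : J((s * s : ℕ) | d) = 1 := by
      push_cast
      rw [jacobiSym.mul_left, ← sq, jacobiSym.sq_one h2]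
    rw [this]; simp

lemma zpow_sum_eq_prod {z : ℂ} (hz : z ≠ 0) (r : ℕ+ →₀ ℤ) :
    ∏ n ∈ r.support, z ^ r n = z ^ twoK r := by
  unfold twoK Finsupp.sum
  induction r.support using Finset.cons_induction with
  | empty => simp
  | cons n s hn ih => rw [Finset.prod_cons, Finset.sum_cons, ih, zpow_add₀ hz]

lemma isCoprime_codiv {r : ℕ+ →₀ ℤ} {x : ℤ} (h : IsCoprime x (level r)) {n : ℕ+}
    (hn : n ∈ r.support) : IsCoprime x (codiv r n) := by
  rw [← codiv_mul_int r hn] at h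
  exact h.of_mul_right_left

lemma prod_jacobi_codiv_left {r : ℕ+ →₀ ℤ} {y : ℕ} (hy : IsCoprime (y : ℤ) (level r)) :
    ∏ n ∈ r.support, ((J(codiv r n | y) : ℤ) : ℂ) ^ r n = ((J(bigPi r | y) : ℤ) : ℂ) := by
  have h1 : ∏ n ∈ r.support, ((J(codiv r n | y) : ℤ) : ℂ) ^ r n =
      ∏ n ∈ r.support, ((J(codiv r n | y) ^ (r n).natAbs : ℤ) : ℂ) :=
    Finset.prod_congr rfl fun n hn => jacobi_zpow_eq_pow_natAbs
      (Int.isCoprime_iff_gcd_eq_one.mp (isCoprime_codiv hy hn).symm) _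
  rw [h1, ← Int.cast_prod]
  congr 1
  unfold bigPi Finsupp.prod
  change _ = J(((∏ n ∈ r.support, codiv r n ^ (r n).natAbs : ℕ) : ℤ) | y)
  induction r.support using Finset.cons_induction with
  | empty => simp [jacobiSym.one_left]
  | cons n s hn ih =>
    rw [Finset.prod_cons, Finset.prod_cons, ih]
    push_cast
    rw [jacobiSym.mul_left, jacobiSym.pow_left]

lemma prod_jacobi_codiv_right {r : ℕ+ →₀ ℤ} {y : ℤ} (hy : IsCoprime y (level r)) :
    ∏ n ∈ r.support, ((J(y | codiv r n) : ℤ) : ℂ) ^ r n = ((J(y | bigPi r) : ℤ) : ℂ) := by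
  have h1 : ∏ n ∈ r.support, ((J(y | codiv r n) : ℤ) : ℂ) ^ r n =
      ∏ n ∈ r.support, ((J(y | codiv r n) ^ (r n).natAbs : ℤ) : ℂ) :=
    Finset.prod_congr rfl fun n hn => jacobi_zpow_eq_pow_natAbs
      (Int.isCoprime_iff_gcd_eq_one.mp (isCoprime_codiv hy hn)) _
  rw [h1, ← Int.cast_prod]
  congr 1
  unfold bigPi Finsupp.prod
  change _ = J(y | ∏ n ∈ r.support, codiv r n ^ (r n).natAbs)
  have h2 : ∀ n ∈ r.support, codiv r n ≠ 0 := fun n hn => (codiv_pos r hn).ne'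
  revert h2
  generalize r.support = s
  intro h2
  induction s using Finset.cons_induction with
  | empty => simp [jacobiSym.one_right]
  | cons n s hn ih =>
    have h3 : ∀ n ∈ s, codiv r n ≠ 0 := fun m hm => h2 m (Finset.mem_cons_of_mem hm)
    rw [Finset.prod_cons, Finset.prod_cons, ih h3, jacobiSym.mul_right', jacobiSym.pow_right]
    · exact pow_ne_zero _ (h2 n (Finset.mem_cons_self n s))
    · exact Finset.prod_ne_zero_iff.mpr fun n hn => pow_ne_zero _ (h3 n hn)

lemma sum_exp_aux (r : ℕ+ →₀ ℤ) (A B C : ℤ) :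
    ∑ n ∈ r.support, (r n) * (A * codiv r n + B * (n : ℕ) + C) =
      A * xOne r + B * xN r + C * twoK r := by
  unfold xOne xN twoK Finsupp.sum
  rw [Finset.mul_sum, Finset.mul_sum, Finset.mul_sum, ← Finset.sum_add_distrib,
    ← Finset.sum_add_distrib]
  refine Finset.sum_congr rfl fun n _ => ?_
  change _ = A * ((codiv r n : ℤ) * r n) + _ + _
  ring

lemma prod_jacobi_zeta (r : ℕ+ →₀ ℤ) (j : ℕ+ → ℤ) (E : ℕ+ → ℤ) (A B C : ℤ)
    (hE : ∀ n ∈ r.support, E n = A * codiv r n + B * (n : ℕ) + C) :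
    ∏ n ∈ r.support, ((j n : ℂ) * zeta (E n)) ^ r n =
      (∏ n ∈ r.support, (j n : ℂ) ^ r n) *
        zeta ((A * xOne r + B * xN r + C * twoK r : ℤ) : ℚ) := by
  simp only [mul_zpow, Finset.prod_mul_distrib]
  rw [prod_zeta_zpow, ← sum_exp_aux]
  congr 2
  push_cast
  refine Finset.sum_congr rfl fun n hn => ?_
  rw [hE n hn]; push_cast; rfl

lemma isCoprime_natAbs {a b : ℤ} (h : IsCoprime a b) : IsCoprime ((a.natAbs : ℕ) : ℤ) b := by
  rw [Int.natCast_natAbs]; exact (IsCoprime.abs_left_iff _ _).mpr h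

/-- The character of an eta-quotient at a matrix with odd lower right entry `d > 0`. -/
theorem etaChar_odd_right (r : ℕ+ →₀ ℤ) {a b t d : ℤ} (hd : 0 < d) (hodd : Odd d)
    (hdet : a * d - b * ((level r : ℤ) * t) = 1) :
    etaChar r !![a, b; (level r : ℤ) * t, d] 1 =
      ((J(t | d.natAbs) : ℤ) : ℂ) ^ twoK r * ((J(bigPi r | d.natAbs) : ℤ) : ℂ) *
      zeta ((((a - 2 * d) * t - level r * b * d * t ^ 2) * xOne r + b * d * xN r
        + 3 * (d - 1) * twoK r : ℤ) : ℚ) := by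
  have hcop : IsCoprime d ((level r : ℤ) * t) := ⟨a, -b, by linarith⟩
  have hcop' := isCoprime_natAbs hcop
  have ht : t.gcd d.natAbs = 1 := Int.isCoprime_iff_gcd_eq_one.mp hcop'.of_mul_right_right.symm
  rw [etaChar_eq_prod r hdet (fun n hn => isEtaMult_multOddD hd hodd (det_scaled hn hdet))]
  unfold multOddD
  -- Because N/n times n is N, the exponent belonging to `n` is a linear combination of N/n, n and 1
  -- with coefficients independent of `n`. Summed against the exponents r_n these give `xOne r`, `xN
  -- r` and `twoK r`.
  rw [prod_jacobi_zeta r _ _ ((a - 2 * d) * t - level r * b * d * t ^ 2) (b * d) (3 * (d - 1))]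
  · congr 1
    simp only [jacobiSym.mul_left, Int.cast_mul, mul_zpow, Finset.prod_mul_distrib]
    rw [prod_jacobi_codiv_left hcop'.of_mul_right_left, zpow_sum_eq_prod, mul_comm]
    exact_mod_cast jacobiSym.ne_zero ht
  · intro n hn
    unfold etaExp
    linear_combination (-(b * d * t ^ 2 * codiv r n)) * codiv_mul_int r hn

/-- The character of an eta-quotient at a matrix with odd lower left entry `> 0`. -/
theorem etaChar_odd_left (r : ℕ+ →₀ ℤ) {a b t d : ℤ} (ht : 0 < t) (hodd : Odd ((level r : ℤ) * t))
    (hdet : a * d - b * ((level r : ℤ) * t) = 1) :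
    etaChar r !![a, b; (level r : ℤ) * t, d] 1 =
      ((J(d | t.natAbs) : ℤ) : ℂ) ^ twoK r * ((J(d | bigPi r) : ℤ) : ℂ) *
      zeta ((((a + d - 3) * t - level r * b * d * t ^ 2) * xOne r + b * d * xN r : ℤ) : ℚ) := by
  have hcop : IsCoprime d ((level r : ℤ) * t) := ⟨a, -b, by linarith⟩
  have ht' : d.gcd t.natAbs = 1 := by
    rw [← Int.isCoprime_iff_gcd_eq_one]
    exact (isCoprime_natAbs hcop.of_mul_right_right.symm).symm
  have hodd' : ∀ n ∈ r.support, Odd ((codiv r n : ℤ) * t) := fun n hn => by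
    rw [← codiv_mul_int r hn] at hodd
    exact Int.odd_mul.mpr ⟨(Int.odd_mul.mp (Int.odd_mul.mp hodd).1).1, (Int.odd_mul.mp hodd).2⟩
  have hpos : ∀ n ∈ r.support, 0 < (codiv r n : ℤ) * t := fun n hn =>
    mul_pos (by exact_mod_cast codiv_pos r hn) ht
  rw [etaChar_eq_prod r hdet
    (fun n hn => isEtaMult_multOddC (hpos n hn) (hodd' n hn) (det_scaled hn hdet))]
  unfold multOddC
  rw [prod_jacobi_zeta r _ _ ((a + d - 3) * t - level r * b * d * t ^ 2) (b * d) 0, zero_mul,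
    add_zero]
  · congr 1
    have h1 : ∀ n ∈ r.support, ((J(d | ((codiv r n : ℤ) * t).natAbs) : ℤ) : ℂ) ^ r n =
        ((J(d | t.natAbs) : ℤ) : ℂ) ^ r n * ((J(d | codiv r n) : ℤ) : ℂ) ^ r n := fun n hn => by
      rw [Int.natAbs_mul, Int.natAbs_natCast, jacobiSym.mul_right' _ (codiv_pos r hn).ne'
        (by omega), Int.cast_mul, mul_zpow, mul_comm]
    rw [Finset.prod_congr rfl h1, Finset.prod_mul_distrib,
      prod_jacobi_codiv_right hcop.of_mul_right_left, zpow_sum_eq_prod]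
    exact_mod_cast jacobiSym.ne_zero ht'
  · intro n hn
    unfold etaExp
    linear_combination (-(b * d * t ^ 2 * codiv r n)) * codiv_mul_int r hn

/-- The character is compatible with conjugation by `diag(1, l)` for `l ∈ L_f`. -/
lemma etaChar_conj_odd_right {r : ℕ+ →₀ ℤ} {l : ℕ} (hl : l ∈ Lf r) {a b t d : ℤ} (hd : 0 < d)
    (hodd : Odd d) (hdet : a * d - l * b * ((level r : ℤ) * t) = 1) :
    etaChar r !![a, b; (level r : ℤ) * (l * t), d] 1 =
      etaChar r !![a, l * b; (level r : ℤ) * t, d] 1 := by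
  obtain ⟨⟨u, hu⟩, ⟨v, hv⟩⟩ := twentyFour_dvd_of_mem_Lf hl
  have hcop : IsCoprime (l : ℤ) d :=
    ⟨-(b * ((level r : ℤ) * t)), a, by linear_combination hdet⟩
  rw [etaChar_odd_right r hd hodd (by linear_combination hdet), etaChar_odd_right r hd hodd hdet,
    jacobiSym.mul_left, Int.cast_mul, mul_zpow,
    jacobi_Lf_zpow hl (Int.isCoprime_iff_gcd_eq_one.mp (isCoprime_natAbs hcop.symm).symm), one_mul]
  congr 1
  -- The difference of the exponents is a combination of (l-1)`xOne r` = 24u and (l-1)`xN r` = 24v.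
  refine zeta_eq_of_dvd ⟨((a - 2 * d) * t - level r * b * d * t ^ 2 * l) * u - b * d * v, ?_⟩
  linear_combination ((a - 2 * d) * t - level r * b * d * t ^ 2 * l) * hu - b * d * hv

lemma etaChar_conj_odd_left {r : ℕ+ →₀ ℤ} {l : ℕ} (hl : l ∈ Lf r) {a b t d : ℤ} (ht : 0 < t)
    (hodd : Odd ((level r : ℤ) * t)) (hlodd : Odd l)
    (hdet : a * d - l * b * ((level r : ℤ) * t) = 1) :
    etaChar r !![a, b; (level r : ℤ) * (l * t), d] 1 =
      etaChar r !![a, l * b; (level r : ℤ) * t, d] 1 := by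
  obtain ⟨⟨u, hu⟩, ⟨v, hv⟩⟩ := twentyFour_dvd_of_mem_Lf hl
  have hl0 : 0 < l := hl.1
  have hcop : IsCoprime (l : ℤ) d :=
    ⟨-(b * ((level r : ℤ) * t)), a, by linear_combination hdet⟩
  have hlodd' : Odd (l : ℤ) := by exact_mod_cast hlodd
  have h1 : ((J(d | l) : ℤ) : ℂ) ^ twoK r = 1 := by
    rcases Int.even_or_odd (twoK r) with hw | hw
    · exact jacobi_zpow_even (Int.isCoprime_iff_gcd_eq_one.mp hcop.symm) hw
    · obtain ⟨s, rfl⟩ := hl.2.2 hw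
      have h2 : d.gcd s = 1 := by
        rw [← Int.isCoprime_iff_gcd_eq_one]
        push_cast at hcop
        exact hcop.of_mul_left_left.symm
      have hs : s ≠ 0 := by rintro rfl; simp at hl0
      rw [jacobiSym.mul_right' _ hs hs, ← sq, jacobiSym.sq_one h2]
      simp
  have h2 : ((l : ℤ) * t).natAbs = l * t.natAbs := by rw [Int.natAbs_mul, Int.natAbs_natCast]
  rw [etaChar_odd_left r (mul_pos (by exact_mod_cast hl0) ht)
      (by rw [mul_left_comm]; exact hlodd'.mul hodd) (by linear_combination hdet),
    etaChar_odd_left r ht hodd hdet, h2, jacobiSym.mul_right' _ hl0.ne' (by omega), Int.cast_mul,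
    mul_zpow, h1, one_mul]
  congr 1
  refine zeta_eq_of_dvd ⟨((a + d - 3) * t - level r * b * d * t ^ 2 * l) * u - b * d * v, ?_⟩
  linear_combination ((a + d - 3) * t - level r * b * d * t ^ 2 * l) * hu - b * d * hv

/-! ### The quotient `f(τ/l)/f(τ)` -/

/-- The function `f(τ/l)/f(τ)` for an eta-quotient `f`. -/
def etaRatio (r : ℕ+ →₀ ℤ) (l : ℕ) (τ : ℍ) : ℂ := etaQ r ((τ : ℂ) / l) / etaQ r τ

lemma div_natCast_im_pos {l : ℕ} (hl : 0 < l) {τ : ℂ} (hτ : 0 < τ.im) : 0 < (τ / l).im := by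
  have h : (0 : ℝ) < l := by exact_mod_cast hl
  rw [Complex.div_natCast_im]
  exact div_pos hτ h

/-- Numerator and denominator transform under (a, b; lNt, d) at τ/l and (a, lb; Nt, d) at τ. Both
have the denominator Ntτ + d, so only the two character values remain, and `hχ` cancels them. -/
lemma etaRatio_mobius_of_etaChar_eq {r : ℕ+ →₀ ℤ} {l : ℕ} (hl : 0 < l) {a b t d : ℤ}
    (hdet : a * d - l * b * ((level r : ℤ) * t) = 1)
    (hχ : etaChar r !![a, b; (level r : ℤ) * (l * t), d] 1 =
      etaChar r !![a, l * b; (level r : ℤ) * t, d] 1) {τ : ℂ} (hτ : 0 < τ.im) :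
    let σ := ((a : ℂ) * τ + (l * b : ℤ)) / (((level r : ℤ) * t : ℤ) * τ + d)
    etaQ r (σ / l) / etaQ r σ = etaQ r (τ / l) / etaQ r τ := by
  intro σ
  have hl0 : (l : ℂ) ≠ 0 := by exact_mod_cast hl.ne'
  have hτl := div_natCast_im_pos hl hτ
  have h1 := etaQ_mobius r (dvd_mul_right (level r : ℤ) t) hdet hτ
  have h2 := etaQ_mobius r (dvd_mul_right (level r : ℤ) (l * t)) (a := a) (b := b) (d := d)
    (by linear_combination hdet) hτl
  have h3 : (((level r : ℤ) * (l * t) : ℤ) : ℂ) * (τ / l) + d =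
      (((level r : ℤ) * t : ℤ) : ℂ) * τ + d := by push_cast; field_simp
  have h4 : σ / l = ((a : ℂ) * (τ / l) + b) / ((((level r : ℤ) * t : ℤ) : ℂ) * τ + d) := by
    simp only [σ]
    rw [div_right_comm]
    congr 1
    push_cast
    field_simp
  rw [h3, ← h4, hχ] at h2
  rw [h2, show etaQ r σ = _ from h1]
  have h5 := csq_ne_zero (denom_ne_zero (isCoprime_bottom hdet) hτ)
  have h6 := etaQ_ne_zero r hτ
  have h7 := etaQ_ne_zero r (mobius_im_pos hdet hτ)
  rw [h1] at h7
  have h8 : etaChar r !![a, l * b; (level r : ℤ) * t, d] 1 ≠ 0 := by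
    intro h; rw [h] at h7; simp at h7
  field_simp

/-- `f(τ/l)/f(τ)` is invariant under the matrices in `Γ₀(N)` with upper right entry divisible by
`l`. -/
lemma etaRatio_smul {r : ℕ+ →₀ ℤ} {l : ℕ} (hl : l ∈ Lf r) {γ : SL(2, ℤ)}
    (hγ : γ ∈ CongruenceSubgroup.Gamma0 (level r)) (hlγ : (l : ℤ) ∣ γ 0 1) (τ : ℍ) :
    etaRatio r l (γ • τ) = etaRatio r l τ := by
  have hl0 : 0 < l := hl.1
  -- The closed forms of the character need an odd and positive bottom entry. If `d` is even, the
  -- determinant makes both Nt and `l` odd; a negative entry is handled by passing to -γ, which acts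
  -- in the same way.
  have main : ∀ a b t d : ℤ, a * d - l * b * ((level r : ℤ) * t) = 1 →
      (etaChar r !![a, b; (level r : ℤ) * (l * t), d] 1 =
        etaChar r !![a, l * b; (level r : ℤ) * t, d] 1) ∨
      (etaChar r !![-a, -b; (level r : ℤ) * (l * -t), -d] 1 =
        etaChar r !![-a, l * -b; (level r : ℤ) * -t, -d] 1) := by
    intro a b t d hdet
    rcases Int.even_or_odd d with hd | hd
    · have h1 : Odd (l * b * ((level r : ℤ) * t)) := by
        have := hd.mul_left a
        have h2 : l * b * ((level r : ℤ) * t) = a * d - 1 := by linarith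
        rw [h2]; exact this.sub_odd odd_one
      have h2 := (Int.odd_mul.mp h1).2
      have h3 : Odd l := by exact_mod_cast (Int.odd_mul.mp (Int.odd_mul.mp h1).1).1
      rcases lt_trichotomy t 0 with ht | ht | ht
      · right
        exact etaChar_conj_odd_left hl (by omega) (by rw [mul_neg]; exact h2.neg) h3
          (by linear_combination hdet)
      · subst ht; simp at h2
      · left
        exact etaChar_conj_odd_left hl ht h2 h3 hdet
    · rcases lt_trichotomy d 0 with ht | ht | ht
      · right
        exact etaChar_conj_odd_right hl (by omega) hd.neg (by linear_combination hdet)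
      · subst ht; simp at hd
      · left
        exact etaChar_conj_odd_right hl ht hd hdet
  obtain ⟨t, ht⟩ := mem_Gamma0_iff_dvd.mp hγ
  obtain ⟨b, hb⟩ := hlγ
  have hdet := det_SL γ
  unfold etaRatio
  rw [coe_smul_eq]
  rw [ht, hb] at hdet ⊢
  rcases main _ _ _ _ hdet with h | h
  · exact etaRatio_mobius_of_etaChar_eq hl0 hdet h τ.im_pos
  · have := etaRatio_mobius_of_etaChar_eq hl0 (by linear_combination hdet) h τ.im_pos
    simp only at this
    rw [← this]
    have h2 : ((-γ 0 0 : ℤ) * (τ : ℂ) + (l * -b : ℤ)) / (((level r : ℤ) * -t : ℤ) * (τ : ℂ)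
        + (-γ 1 1 : ℤ)) = ((γ 0 0 : ℤ) * (τ : ℂ) + (l * b : ℤ)) / (((level r : ℤ) * t : ℤ) * (τ : ℂ)
        + (γ 1 1 : ℤ)) := by
      rw [← neg_div_neg_eq]
      push_cast
      congr 1 <;> ring
    rw [h2]

end

end EtaQuot

namespace EtaQuot

noncomputable section

open scoped NumberTheorySymbols
open UpperHalfPlane

/-! ### Solving the coprimality conditions -/

/-- Take for `x` the product of the primes dividing `m` but not `c`: a prime of `m` outside `c`
divides `a * x` but not `c`, while a prime of `m` inside `c` divides neither `x` nor, by hypothesis,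
`a`. -/
lemma exists_isCoprime_add_mul {a c m : ℤ} (hm : m ≠ 0)
    (h : ∀ p : ℤ, Prime p → p ∣ a → p ∣ c → ¬ p ∣ m) : ∃ x : ℤ, IsCoprime (a * x + c) m := by
  classical
  let S := m.natAbs.primeFactors.filter fun p : ℕ => ¬ (p : ℤ) ∣ c
  refine ⟨∏ p ∈ S, (p : ℤ), isCoprime_of_prime_dvd (fun H => hm H.2) fun p hp h1 h2 => ?_⟩
  have hpn : p.natAbs.Prime := Int.prime_iff_natAbs_prime.mp hp
  by_cases hc : p ∣ c
  · have h3 : p ∣ a * ∏ p ∈ S, (p : ℤ) := (dvd_add_left hc).mp h1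
    rcases hp.dvd_or_dvd h3 with h4 | h4
    · exact h p hp h4 hc h2
    · obtain ⟨q, hq, hpq⟩ := (Prime.dvd_finsetProd_iff hp _).mp h4
      have hq' := Finset.mem_filter.mp hq
      have hqp := Nat.prime_of_mem_primeFactors hq'.1
      have : p.natAbs = q := by
        have := Int.natAbs_dvd_natAbs.mpr hpq
        rw [Int.natAbs_natCast] at this
        exact (Nat.prime_dvd_prime_iff_eq hpn hqp).mp this
      refine hq'.2 ?_
      rw [← this]
      exact Int.natAbs_dvd.mpr hc
  · have hmem : p.natAbs ∈ S := by
      refine Finset.mem_filter.mpr ⟨?_, fun H => hc (Int.natAbs_dvd.mp H)⟩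
      exact Nat.mem_primeFactors.mpr ⟨hpn, Int.natAbs_dvd_natAbs.mpr h2, by simpa using hm⟩
    have h3 : p ∣ ∏ p ∈ S, (p : ℤ) := by
      rw [← Int.natAbs_dvd]
      exact Finset.dvd_prod_of_mem (fun p : ℕ => (p : ℤ)) hmem
    exact hc ((dvd_add_right (h3.mul_left a)).mp h1)

lemma exists_isCoprime_add_mul_of_modEq {a c m q : ℤ} (hm : m ≠ 0) (hq : IsCoprime q a)
    (h : ∀ p : ℤ, Prime p → p ∣ a → p ∣ c → ¬ p ∣ m) :
    ∃ x : ℤ, q ∣ a * x + c - 1 ∧ IsCoprime (a * x + c) m := by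
  obtain ⟨u, v, huv⟩ := hq
  have h0 : a * (v * (1 - c)) + c - 1 = q * (-u * (1 - c)) := by linear_combination (1 - c) * huv
  obtain ⟨t, ht⟩ := exists_isCoprime_add_mul (a := a * q) (c := a * (v * (1 - c)) + c) hm
    (fun p hp h1 h2 h3 => by
      have hpq : ¬ p ∣ q := fun H => hp.not_isUnit (isUnit_of_dvd_one (by
        have := dvd_sub h2 (h0 ▸ H.mul_right (-u * (1 - c)))
        simpa using this))
      have hpa : p ∣ a := (hp.dvd_or_dvd h1).resolve_right hpq
      exact h p hp hpa ((dvd_add_right (hpa.mul_right _)).mp h2) h3)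
  refine ⟨v * (1 - c) + q * t, ⟨-u * (1 - c) + a * t, by linear_combination h0⟩, ?_⟩
  convert ht using 1
  ring

/-- The conditions on the upper triangular matrix `(a, b; 0, d)`. -/
structure IsHeckeTriple (N a : ℕ) (b : ℤ) (d : ℕ) : Prop where
  a_pos : 0 < a
  d_pos : 0 < d
  coprime : Nat.Coprime N a
  primitive : ∀ p : ℤ, Prime p → p ∣ a → p ∣ b → ¬ p ∣ d

lemma isHeckeTriple_iff_gcd {N a b d : ℕ} (ha : 0 < a) (hd : 0 < d) (hN : Nat.Coprime N a) :
    IsHeckeTriple N a b d ↔ Nat.gcd a (Nat.gcd b d) = 1 := by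
  constructor
  · intro h
    by_contra hne
    obtain ⟨p, hp, hpd⟩ := Nat.exists_prime_and_dvd hne
    rw [Nat.dvd_gcd_iff, Nat.dvd_gcd_iff] at hpd
    exact h.primitive p (Nat.prime_iff_prime_int.mp hp) (by exact_mod_cast hpd.1)
      (by exact_mod_cast hpd.2.1) (by exact_mod_cast hpd.2.2)
  · intro h
    refine ⟨ha, hd, hN, fun p hp h1 h2 h3 => ?_⟩
    have h4 : p.natAbs ∣ Nat.gcd a (Nat.gcd b d) :=
      Nat.dvd_gcd (Int.natAbs_dvd_natAbs.mpr h1)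
        (Nat.dvd_gcd (Int.natAbs_dvd_natAbs.mpr h2) (Int.natAbs_dvd_natAbs.mpr h3))
    rw [h, Nat.dvd_one] at h4
    exact hp.not_isUnit (Int.isUnit_iff_natAbs_eq.mpr h4)

/-- First `x` is chosen so that A = -Nb + ax is 1 modulo `q` and prime to M = Ndq; the primitivity
of the triple removes the obstruction. A Bézout identity for A and M gives `y` and `z`, with the
factor `q` of M absorbed into `z`, and then A ≡ 1 forces `y` ≡ 1 modulo `q`. Multiples of M are
added to make `x` and `y` positive. -/
lemma IsHeckeTriple.exists_choice {N a : ℕ} {b : ℤ} {d : ℕ} (h : IsHeckeTriple N a b d)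
    (hN : 0 < N) {q : ℤ} (hq : 0 < q) (hqa : IsCoprime q a) :
    ∃ x y z : ℤ, 0 < x ∧ 0 < y ∧ (-(N : ℤ) * b + a * x) * y + N * d * z = 1 ∧
      q ∣ -(N : ℤ) * b + a * x - 1 ∧ q ∣ y - 1 ∧ q ∣ z := by
  have hd := h.d_pos
  have hm : (N : ℤ) * d * q ≠ 0 := by positivity
  have hcop : ∀ p : ℤ, Prime p → p ∣ a → ¬ p ∣ N := fun p hp h1 h2 =>
    hp.not_isUnit ((Nat.isCoprime_iff_coprime.mpr h.coprime).isUnit_of_dvd' h2 h1)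
  obtain ⟨x₀, hx1, hx2⟩ := exists_isCoprime_add_mul_of_modEq (a := a) (c := -(N : ℤ) * b) hm hqa
    (fun p hp h1 h2 h3 => by
      have hpb : p ∣ b := (hp.dvd_or_dvd h2).resolve_left fun H => hcop p hp h1 (dvd_neg.mp H)
      rcases hp.dvd_or_dvd h3 with h4 | h4
      · exact h.primitive p hp h1 hpb ((hp.dvd_or_dvd h4).resolve_left (hcop p hp h1))
      · exact hp.not_isUnit (hqa.isUnit_of_dvd' h4 h1))
  set M : ℤ := (N : ℤ) * d * q with hM
  have hMpos : 0 < M := by positivity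
  have hx3 : IsCoprime (-(N : ℤ) * b + a * (x₀ + M * (|x₀| + 1))) M := by
    have h1 := hx2.add_mul_left_left (a * (|x₀| + 1))
    have h2 : -(N : ℤ) * b + a * (x₀ + M * (|x₀| + 1)) =
        a * x₀ + -(N : ℤ) * b + M * (a * (|x₀| + 1)) := by ring
    rwa [h2]
  set x := x₀ + M * (|x₀| + 1) with hx
  have hxpos : 0 < x := by
    have h1 := neg_abs_le x₀
    have h2 : |x₀| + 1 ≤ M * (|x₀| + 1) := le_mul_of_one_le_left (by positivity) hMpos
    omega
  obtain ⟨y₀, z₀, hyz⟩ := hx3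
  set A := -(N : ℤ) * b + a * x with hA
  have hqA : q ∣ A - 1 := by
    have : A - 1 = (a * x₀ + -(N : ℤ) * b - 1) + q * (N * d * (a * (|x₀| + 1))) := by
      rw [hA, hx, hM]; ring
    rw [this]
    exact dvd_add hx1 (dvd_mul_right _ _)
  have heq : A * (y₀ + M * (|y₀| + 1)) + N * d * (q * (z₀ - A * (|y₀| + 1))) = 1 := by
    rw [← hyz, hM]; ring
  have hypos : 0 < y₀ + M * (|y₀| + 1) := by
    have h1 := neg_abs_le y₀
    have h2 : |y₀| + 1 ≤ M * (|y₀| + 1) := le_mul_of_one_le_left (by positivity) hMpos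
    omega
  refine ⟨x, _, _, hxpos, hypos, heq, hqA, ?_, dvd_mul_right _ _⟩
  obtain ⟨s, hs⟩ := hqA
  refine ⟨-(s * (y₀ + M * (|y₀| + 1))) - N * d * (z₀ - A * (|y₀| + 1)), ?_⟩
  linear_combination heq - (y₀ + M * (|y₀| + 1)) * hs

/-! ### Decompositions of upper triangular matrices -/

/-- The matrix `diag(1, l)`. -/
def diagOne (l : ℕ) : Matrix (Fin 2) (Fin 2) ℤ := !![1, 0; 0, l]

/-- The upper triangular matrix `(a, b; 0, d)`. -/
def tri (a : ℕ) (b : ℤ) (d : ℕ) : Matrix (Fin 2) (Fin 2) ℤ := !![(a : ℤ), b; 0, d]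

/-- The matrix `(ay, by - dz; N, x)` in the decomposition of `(a, b; 0, d)`. -/
def rightFactor {N a : ℕ} {b : ℤ} {d : ℕ} {x y z : ℤ}
    (h : (-(N : ℤ) * b + a * x) * y + N * d * z = 1) : SL(2, ℤ) :=
  ⟨!![a * y, b * y - d * z; (N : ℤ), x], by rw [Matrix.det_fin_two_of]; linear_combination h⟩

/-- The matrix `(-Nb + ax, z; -Nd, y)` in the decomposition of `(a, b; 0, d)`. -/
def leftFactor {N a : ℕ} {b : ℤ} {d : ℕ} {x y z : ℤ}
    (h : (-(N : ℤ) * b + a * x) * y + N * d * z = 1) : SL(2, ℤ) :=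
  ⟨!![-(N : ℤ) * b + a * x, z; -(N : ℤ) * d, y], by
    rw [Matrix.det_fin_two_of]; linear_combination h⟩

lemma rightFactor_mem {N a : ℕ} {b : ℤ} {d : ℕ} {x y z : ℤ}
    (h : (-(N : ℤ) * b + a * x) * y + N * d * z = 1) :
    rightFactor h ∈ CongruenceSubgroup.Gamma0 N :=
  mem_Gamma0_iff_dvd.mpr (dvd_refl (N : ℤ))

lemma tri_eq_mul {N a : ℕ} {b : ℤ} {d : ℕ} {x y z : ℤ}
    (h : (-(N : ℤ) * b + a * x) * y + N * d * z = 1) :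
    tri a b d = (leftFactor h).1 * diagOne (a * d) * (rightFactor h).1 := by
  simp only [tri, leftFactor, rightFactor, diagOne, Matrix.mul_fin_two]
  push_cast
  congr 1
  ext i j
  fin_cases i <;> fin_cases j <;> simp
  · linear_combination (-(a : ℤ)) * h
  · linear_combination (-(b : ℤ)) * h
  · ring
  · linear_combination (-(d : ℤ)) * h

/-- The hypothesis `h` says that diag(1, l) conjugates γ'γ⁻¹ to an integral matrix, that is, `l`
divides its upper right entry; so f(τ/l)/f(τ) is invariant under it. Hence the translate by γ
depends only on the coset SL(2, ℤ) diag(1, l) γ. -/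
lemma etaRatio_eq_of_decomposition {r : ℕ+ →₀ ℤ} {l : ℕ} (hl : l ∈ Lf r) {γ γ' k : SL(2, ℤ)}
    (hγ : γ ∈ CongruenceSubgroup.Gamma0 (level r)) (hγ' : γ' ∈ CongruenceSubgroup.Gamma0 (level r))
    (h : diagOne l * γ'.1 = k.1 * diagOne l * γ.1) (τ : ℍ) :
    etaRatio r l (γ' • τ) = etaRatio r l (γ • τ) := by
  have h1 : diagOne l * (γ' * γ⁻¹ : SL(2, ℤ)).1 = k.1 * diagOne l := by
    have : γ.1 * (γ⁻¹ : SL(2, ℤ)).1 = 1 := by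
      have := congrArg Subtype.val (mul_inv_cancel γ)
      simpa only [Matrix.SpecialLinearGroup.coe_mul, Matrix.SpecialLinearGroup.coe_one] using this
    rw [Matrix.SpecialLinearGroup.coe_mul, ← Matrix.mul_assoc, h, Matrix.mul_assoc, this,
      Matrix.mul_one]
  have h2 : (l : ℤ) ∣ (γ' * γ⁻¹) 0 1 := by
    have := congrFun (congrFun h1 0) 1
    simp only [diagOne, Matrix.mul_apply, Fin.sum_univ_two] at this
    simp at this
    exact ⟨k.1 0 1, by rw [mul_comm]; simpa using this⟩
  have h3 := etaRatio_smul hl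
    (mul_mem hγ' (inv_mem hγ)) h2 (γ • τ)
  rw [← h3, ← mul_smul, inv_mul_cancel_right]

/-- Every matrix of the form `(p, q; l N t, l s)` arising from `Γ₀(N)` can be reduced to an upper
triangular one by left multiplication with `Γ₀(N)`. -/
lemma exists_reduction {N l : ℕ} (hl : 0 < l) {γ : SL(2, ℤ)}
    (hγ : γ ∈ CongruenceSubgroup.Gamma0 N) :
    ∃ (a b d : ℕ) (ρ : SL(2, ℤ)), ρ ∈ CongruenceSubgroup.Gamma0 N ∧ a * d = l ∧ b < d ∧
      IsHeckeTriple N a b d ∧ ρ.1 * (diagOne l * γ.1) = tri a b d := by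
  obtain ⟨t, ht⟩ := mem_Gamma0_iff_dvd.mp hγ
  have hdet := det_SL γ
  set p := γ 0 0
  set q := γ 0 1
  set s := γ 1 1
  rw [ht] at hdet
  have hl' : (l : ℤ) ≠ 0 := by exact_mod_cast hl.ne'
  have hne : ¬ (p = 0 ∧ (l : ℤ) * t = 0) := by
    rintro ⟨h1, h2⟩
    have h3 : t = 0 := (mul_eq_zero.mp h2).resolve_left hl'
    rw [h1, h3] at hdet
    simp at hdet
  -- The first column of diag(1, l)γ is (p, lNt), and `p` is prime to `N`, so `g` is its gcd. The
  -- bottom row (-Nu, v) of `ρ` annihilates this column and keeps `ρ` in Γ₀(N).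
  set g := Int.gcd p (l * t) with hg
  have hgpos : 0 < g := Nat.pos_of_ne_zero fun H => hne (by
    have := Int.gcd_eq_zero_iff.mp (hg ▸ H); exact this)
  obtain ⟨v, hv⟩ : (g : ℤ) ∣ p := Int.gcd_dvd_left ..
  obtain ⟨u, hu⟩ : (g : ℤ) ∣ l * t := Int.gcd_dvd_right ..
  have hg0 : (g : ℤ) ≠ 0 := by exact_mod_cast hgpos.ne'
  have huv : IsCoprime v u := by
    have := Int.gcd_eq_gcd_ab p (l * t)
    rw [← hg] at this
    refine ⟨Int.gcdA p (l * t), Int.gcdB p (l * t), mul_left_cancel₀ hg0 ?_⟩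
    linear_combination -this - Int.gcdA p (l * t) * hv - Int.gcdB p (l * t) * hu
  have hpN : IsCoprime p (N : ℤ) := ⟨s, -(q * t), by linear_combination hdet⟩
  have hvN : IsCoprime v (N : ℤ) := by rw [hv] at hpN; exact hpN.of_mul_left_right
  obtain ⟨α, β, hαβ⟩ := hvN.mul_right huv
  have hp : α * p + β * (l * ((N : ℤ) * t)) = g := by
    linear_combination (g : ℤ) * hαβ + α * hv + β * N * hu
  set d₀ := -((N : ℤ) * u) * q + v * (l * s) with hd₀
  set b₀ := α * q + β * (l * s) with hb₀
  have hgd : (g : ℤ) * d₀ = l := by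
    rw [hd₀]
    linear_combination (l : ℤ) * hdet - (l * s) * hv + N * q * hu
  have hd₀pos : 0 < d₀ := by
    have h1 : 0 < (g : ℤ) * d₀ := by rw [hgd]; exact_mod_cast hl
    exact pos_of_mul_pos_right h1 (by positivity)
  obtain ⟨d, hd⟩ := Int.eq_ofNat_of_zero_le hd₀pos.le
  have hdpos : 0 < d := by rw [hd] at hd₀pos; exact_mod_cast hd₀pos
  have hdz : (d : ℤ) ≠ 0 := by exact_mod_cast hdpos.ne'
  obtain ⟨b, hb⟩ := Int.eq_ofNat_of_zero_le (Int.emod_nonneg b₀ hdz)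
  have hbd : b < d := by
    have := Int.emod_lt_of_pos b₀ (by exact_mod_cast hdpos : (0 : ℤ) < d)
    rw [hb] at this
    exact_mod_cast this
  have hbj := Int.emod_add_mul_ediv b₀ d
  rw [hb] at hbj
  set j := b₀ / d
  have hdetρ : (α + j * (N * u)) * v - (β - j * v) * -((N : ℤ) * u) = 1 := by
    linear_combination hαβ
  let ρ : SL(2, ℤ) := ⟨!![α + j * (N * u), β - j * v; -((N : ℤ) * u), v], by
    rw [Matrix.det_fin_two_of]; exact hdetρ⟩
  have hρ : ρ.1 * (diagOne l * γ.1) = tri g b d := by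
    have hγe : γ.1 = !![p, q; (N : ℤ) * t, s] := by rw [SL_coe_eq γ, ht]
    rw [hγe]
    simp only [ρ, diagOne, tri, Matrix.mul_fin_two]
    ext i j'
    fin_cases i <;> fin_cases j' <;> simp
    · linear_combination hp - j * N * v * hu + j * N * u * hv
    · linear_combination -hbj - j * hd₀ - j * hd + hb₀
    · linear_combination (-N * u : ℤ) * hv + N * v * hu
    · linear_combination -hd₀ + hd
  refine ⟨g, b, d, ρ, mem_Gamma0_iff_dvd.mpr ⟨-u, show -((N : ℤ) * u) = N * -u by ring⟩, ?_, hbd,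
    ⟨hgpos, hdpos, ?_, ?_⟩, hρ⟩
  · rw [hd] at hgd; exact_mod_cast hgd
  · rw [← Nat.isCoprime_iff_coprime]
    rw [hv] at hpN
    exact hpN.of_mul_left_left.symm
  -- A prime dividing `g`, `b` and `d` would divide the top row (p, q) of diag(1, l)γ, which is the
  -- top row of γ itself and hence primitive.
  · intro e he h1 h2 h3
    have h5 : diagOne l * γ.1 = (ρ⁻¹ : SL(2, ℤ)).1 * tri g b d := by
      rw [← hρ, ← Matrix.mul_assoc]
      have := congrArg Subtype.val (inv_mul_cancel ρ)
      simp only [Matrix.SpecialLinearGroup.coe_mul, Matrix.SpecialLinearGroup.coe_one] at this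
      rw [this, Matrix.one_mul]
    have h6 : e ∣ p := by
      have := congrFun (congrFun h5 0) 0
      simp only [diagOne, tri, Matrix.mul_apply, Fin.sum_univ_two] at this
      simp at this
      change γ.1 0 0 = _ at this
      rw [show p = γ.1 0 0 from rfl, this]
      exact h1.mul_left _
    have h7 : e ∣ q := by
      have := congrFun (congrFun h5 0) 1
      simp only [diagOne, tri, Matrix.mul_apply, Fin.sum_univ_two] at this
      simp at this
      change γ.1 0 1 = _ at this
      rw [show q = γ.1 0 1 from rfl, this]
      exact dvd_add (h2.mul_left _) (h3.mul_left _)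
    refine he.not_isUnit (isUnit_of_dvd_one ?_)
    rw [← hdet]
    exact dvd_sub (h6.mul_right _) (h7.mul_right _)

lemma tri_unique {a b d a' b' d' : ℕ} (ha : 0 < a) (ha' : 0 < a')
    (hb : b < d) (hb' : b' < d') {ρ : SL(2, ℤ)}
    (h : ρ.1 * tri a b d = tri a' b' d') : a = a' ∧ b = b' ∧ d = d' := by
  have hdet := det_SL ρ
  have e (i j) := congrFun (congrFun h i) j
  simp only [tri, Matrix.mul_apply, Fin.sum_univ_two] at e
  have h00 := e 0 0
  have h01 := e 0 1
  have h10 := e 1 0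
  have h11 := e 1 1
  simp at h00 h01 h10 h11
  have h10' : ρ 1 0 = 0 := h10.resolve_right ha.ne'
  rw [h10'] at h11 hdet
  rw [mul_zero, sub_zero] at hdet
  have hα : ρ 0 0 = 1 ∧ ρ 1 1 = 1 := by
    rcases Int.eq_one_or_neg_one_of_mul_eq_one' hdet with h1 | h1
    · exact h1
    · rw [h1.1] at h00; omega
  rw [hα.2] at h11
  rw [hα.1] at h00 h01
  have hdd : d = d' := by omega
  refine ⟨by omega, ?_, hdd⟩
  subst hdd
  have : (b' : ℤ) = b + ρ 0 1 * d := by linarith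
  have h2 : ρ 0 1 = 0 := by
    by_contra hne
    rcases lt_or_gt_of_ne hne with h3 | h3 <;> nlinarith
  rw [h2] at this
  omega

end

end EtaQuot

namespace EtaQuot

noncomputable section

open scoped NumberTheorySymbols
open UpperHalfPlane

/-! ### The terms of the Hecke operator -/

lemma csq_one_div_natCast_zpow {a : ℕ} (ha : 0 < a) (w : ℤ) :
    csq (1 / a) ^ (-w) = (((a : ℝ) ^ ((w : ℝ) / 2) : ℝ) : ℂ) := by
  have h1 : csq (1 / a) = (((a : ℝ) ^ (-(1 / 2) : ℝ) : ℝ) : ℂ) := by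
    rw [csq, Complex.ofReal_cpow (by positivity)]
    push_cast
    rw [Complex.cpow_neg, one_div (a : ℂ), Complex.inv_cpow]
    rw [Complex.natCast_arg]; exact Real.pi_pos.ne
  have ha' : (0 : ℝ) ≤ a := by positivity
  rw [h1, ← Complex.ofReal_zpow, ← Real.rpow_intCast, ← Real.rpow_mul ha']
  congr 2
  push_cast
  ring

/-- The roots of `u` and `v` lie in the fourth and the first quadrant, so their product has positive
real part and is the principal root. -/
lemma csq_mul_eq_of_im_neg {u v : ℂ} {t : ℝ} (hu : u.im < 0) (hv : 0 < v.im) (ht : 0 < t)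
    (h : u * v = t) : csq u * csq v = csq t := by
  have hu' : u ∈ Complex.slitPlane := Or.inr hu.ne
  have h1 := csq_re_pos hu'
  have h2 : (csq u).im < 0 := by
    have := csq_im u
    by_contra H
    nlinarith [not_lt.mp H]
  have h3 := csq_re_pos (mem_slitPlane_of_im_pos hv)
  have h4 := csq_im_pos hv
  refine csq_unique ?_ ?_ ?_
  · left; simpa using ht
  · rw [mul_pow, csq_sq, csq_sq, h]
  · rw [Complex.mul_re]
    nlinarith [mul_pos h1 h3, mul_pos (neg_pos.mpr h2) h4]

lemma tri_im_pos {a d : ℕ} (ha : 0 < a) (hd : 0 < d) (b : ℤ) {τ : ℂ} (hτ : 0 < τ.im) :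
    0 < (((a : ℂ) * τ + b) / d).im := by
  rw [Complex.div_natCast_im]
  have h1 : (0 : ℝ) < a := by exact_mod_cast ha
  have h2 : (0 : ℝ) < d := by exact_mod_cast hd
  simp
  positivity

/-- The terms of the Hecke operator are translates of `f(τ/l)/f(τ)`, up to the factor `f`. -/
lemma etaRatio_rightFactor_mul (r : ℕ+ →₀ ℤ) {a d : ℕ} {b x y z : ℤ} (ha : 0 < a) (hd : 0 < d)
    (h : (-(level r : ℤ) * b + a * x) * y + level r * d * z = 1) (τ : ℍ) :
    etaRatio r (a * d) (rightFactor h • τ) * etaQ r τ =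
      (etaChar r !![-(level r : ℤ) * b + a * x, z; -(level r : ℤ) * d, y] 1)⁻¹ *
      (etaChar r !![a * y, b * y - d * z; (level r : ℤ), x] 1)⁻¹ *
      ((((a : ℝ) ^ ((twoK r : ℝ) / 2) : ℝ) : ℂ) * etaQ r (((a : ℂ) * τ + b) / d)) := by
  have hτ := τ.im_pos
  have hN := level_pos r
  have ha0 : (a : ℂ) ≠ 0 := by exact_mod_cast ha.ne'
  have hd0 : (d : ℂ) ≠ 0 := by exact_mod_cast hd.ne'
  have hdet1 := det_SL (leftFactor h)
  have hdet2 := det_SL (rightFactor h)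
  have hσ := coe_smul_eq (rightFactor h) τ
  set σ : ℂ := ((rightFactor h • τ : ℍ) : ℂ) with hσdef
  have hσim : 0 < σ.im := (rightFactor h • τ).im_pos
  have e00 : rightFactor h 0 0 = a * y := rfl
  have e01 : rightFactor h 0 1 = b * y - d * z := rfl
  have e10 : rightFactor h 1 0 = level r := rfl
  have e11 : rightFactor h 1 1 = x := rfl
  have f00 : leftFactor h 0 0 = -(level r : ℤ) * b + a * x := rfl
  have f01 : leftFactor h 0 1 = z := rfl
  have f10 : leftFactor h 1 0 = -(level r : ℤ) * d := rfl
  have f11 : leftFactor h 1 1 = y := rfl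
  rw [f00, f01, f10, f11] at hdet1
  rw [e00, e01, e10, e11] at hdet2 hσ
  have hl : 0 < a * d := Nat.mul_pos ha hd
  have hwim := div_natCast_im_pos hl hσim
  set w : ℂ := σ / ((a * d : ℕ) : ℂ) with hw
  have hD : ((level r : ℤ) : ℂ) * (τ : ℂ) + x ≠ 0 := denom_ne_zero (isCoprime_bottom hdet2) hτ
  have hF2 := etaQ_mobius r (dvd_refl (level r : ℤ)) hdet2 hτ
  rw [← hσ] at hF2
  have hDim : 0 < (((level r : ℤ) : ℂ) * (τ : ℂ) + x).im := by
    have h1 : (0 : ℝ) < level r := by exact_mod_cast hN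
    simp
    positivity
  set D : ℂ := ((level r : ℤ) : ℂ) * (τ : ℂ) + x with hDdef
  have hDe : D = (level r : ℂ) * τ + x := by rw [hDdef]; push_cast; rfl
  have hc : (-(level r : ℂ) * b + a * x) * y + level r * d * z = 1 := by exact_mod_cast h
  have hwe : w * (a * d * D) = a * y * τ + (b * y - d * z) := by
    rw [hw, hσ, Nat.cast_mul]
    field_simp
    push_cast
    ring
  -- By the cocycle relation the denominators of the two factors multiply to 1/a. One is in the
  -- lower and one in the upper half-plane, so their square roots multiply without a sign; this is
  -- the origin of the factor a^k in T_l.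
  have hden : ((-(level r : ℤ) * d : ℤ) : ℂ) * w + y = 1 / (a * D) := by
    rw [eq_div_iff (mul_ne_zero ha0 hD)]
    push_cast
    linear_combination (-(level r : ℂ)) * hwe + hc + a * y * hDe
  have hnum : ((-(level r : ℤ) * b + a * x : ℤ) : ℂ) * w + z = (a * τ + b) / (a * d * D) := by
    rw [eq_div_iff (mul_ne_zero (mul_ne_zero ha0 hd0) hD)]
    push_cast
    linear_combination (-(level r : ℂ) * b + a * x) * hwe + (a * τ + b) * hc + a * d * z * hDe
  have hM : (((-(level r : ℤ) * b + a * x : ℤ) : ℂ) * w + z) /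
      (((-(level r : ℤ) * d : ℤ) : ℂ) * w + y) = (a * τ + b) / d := by
    rw [hden, hnum]; field_simp
  have hF1 := etaQ_mobius r (⟨-d, by ring⟩ : (level r : ℤ) ∣ -(level r : ℤ) * d) hdet1 hwim
  rw [hM] at hF1
  have hcsq : csq (((-(level r : ℤ) * d : ℤ) : ℂ) * w + y) * csq D = csq (1 / a) := by
    have := csq_mul_eq_of_im_neg (u := ((-(level r : ℤ) * d : ℤ) : ℂ) * w + y)
      (v := D) (t := 1 / a) ?_ hDim ?_ ?_
    · rw [this]; push_cast; rfl
    · have h1 : (0 : ℝ) < level r := by exact_mod_cast hN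
      have h2 : (0 : ℝ) < d := by exact_mod_cast hd
      have : (((-(level r : ℤ) * d : ℤ) : ℂ) * w + y).im = -(level r * d * w.im) := by
        push_cast
        simp
      rw [this]
      have : 0 < level r * d * w.im := by positivity
      linarith
    · positivity
    · rw [hden]; push_cast; field_simp
  have hF3 := etaQ_ne_zero r hσim
  have hF4 := etaQ_ne_zero r (tri_im_pos ha hd b hτ)
  have hF5 := etaQ_ne_zero r hτ
  rw [hF1] at hF4
  rw [hF2] at hF3
  have hF6 : csq (1 / (a : ℂ)) ≠ 0 := csq_ne_zero (by simpa using ha0)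
  rw [← hcsq] at hF6
  have hχ1 := left_ne_zero_of_mul (left_ne_zero_of_mul hF4)
  have hχ2 := left_ne_zero_of_mul (left_ne_zero_of_mul hF3)
  have hj1 := left_ne_zero_of_mul hF6
  have hj2 := right_ne_zero_of_mul hF6
  rw [hF1, ← csq_one_div_natCast_zpow ha, ← hcsq, mul_zpow, zpow_neg, zpow_neg]
  unfold etaRatio
  rw [← hσdef, ← hw, hF2]
  field_simp

/-! ### Invariance of the Hecke sum -/

/-- The index set of the sum defining the Hecke operator. -/
def heckeIndex (N l : ℕ) : Finset (Σ _ : ℕ, ℕ) :=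
  (l.divisors.filter fun a => N.Coprime a).sigma fun a =>
    (Finset.range (l / a)).filter fun b => Nat.gcd a (Nat.gcd b (l / a)) = 1

lemma mem_heckeIndex {N l : ℕ} {i : Σ _ : ℕ, ℕ} : i ∈ heckeIndex N l ↔
    (i.1 ∈ l.divisors ∧ N.Coprime i.1) ∧ i.2 < l / i.1 ∧ Nat.gcd i.1 (Nat.gcd i.2 (l / i.1)) = 1 := by
  simp [heckeIndex, Finset.mem_sigma]

lemma mem_heckeIndex_spec {N l : ℕ} {i : Σ _ : ℕ, ℕ} (hi : i ∈ heckeIndex N l) :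
    IsHeckeTriple N i.1 i.2 (l / i.1) ∧ i.1 * (l / i.1) = l ∧ i.2 < l / i.1 := by
  obtain ⟨⟨h1, h2⟩, h3, h4⟩ := mem_heckeIndex.mp hi
  have h5 := Nat.pos_of_mem_divisors h1
  have h6 := Nat.dvd_of_mem_divisors h1
  exact ⟨(isHeckeTriple_iff_gcd h5 (by omega) h2).mpr h4, Nat.mul_div_cancel' h6, h3⟩

/-- Reducing diag(1, l)·(R i)·δ to upper triangular form defines a self-map of the finite index set.
It is injective, since equal images give left equivalent triangular matrices and these coincide by
`tri_unique`; so it is a permutation. Corresponding terms are equal by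
`etaRatio_eq_of_decomposition`. -/
lemma sum_etaRatio_smul {r : ℕ+ →₀ ℤ} {l : ℕ} (hl : l ∈ Lf r) (R : (Σ _ : ℕ, ℕ) → SL(2, ℤ))
    (hR : ∀ i ∈ heckeIndex (level r) l, R i ∈ CongruenceSubgroup.Gamma0 (level r) ∧
      ∃ k : SL(2, ℤ), tri i.1 i.2 (l / i.1) = k.1 * diagOne l * (R i).1)
    {δ : SL(2, ℤ)} (hδ : δ ∈ CongruenceSubgroup.Gamma0 (level r)) (τ : ℍ) :
    ∑ i ∈ heckeIndex (level r) l, etaRatio r l (R i • δ • τ) =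
      ∑ i ∈ heckeIndex (level r) l, etaRatio r l (R i • τ) := by
  have hl0 : 0 < l := hl.1
  have key : ∀ i ∈ heckeIndex (level r) l, ∃ j ∈ heckeIndex (level r) l, ∃ ρ : SL(2, ℤ),
      ρ.1 * (diagOne l * (R i * δ).1) = tri j.1 j.2 (l / j.1) := by
    intro i hi
    obtain ⟨a, b, d, ρ, -, had, hbd, htri, hρ⟩ := exists_reduction (N := level r) hl0
      (mul_mem (hR i hi).1 hδ)
    have hda : l / a = d := by rw [← had]; exact Nat.mul_div_cancel_left _ htri.a_pos
    refine ⟨⟨a, b⟩, mem_heckeIndex.mpr ⟨⟨?_, htri.coprime⟩, ?_, ?_⟩, ρ, ?_⟩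
    · exact Nat.mem_divisors.mpr ⟨⟨d, had.symm⟩, hl0.ne'⟩
    · simpa only [hda] using hbd
    · simp only [hda]
      exact (isHeckeTriple_iff_gcd htri.a_pos htri.d_pos htri.coprime).mp htri
    · simpa only [hda] using hρ
  choose! φ hφ ρ hρ using key
  have hinj : Set.InjOn φ (heckeIndex (level r) l) := by
    intro i hi j hj hij
    have hi' := Finset.mem_coe.mp hi
    have hj' := Finset.mem_coe.mp hj
    obtain ⟨-, k, hk⟩ := hR i hi'
    obtain ⟨-, k', hk'⟩ := hR j hj'
    have h1 := hρ i hi'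
    have h2 := hρ j hj'
    rw [hij, ← h2] at h1
    simp only [Matrix.SpecialLinearGroup.coe_mul] at h1
    have hδδ : δ.1 * (δ⁻¹ : SL(2, ℤ)).1 = 1 := by
      simpa only [Matrix.SpecialLinearGroup.coe_mul, Matrix.SpecialLinearGroup.coe_one] using
        congrArg Subtype.val (mul_inv_cancel δ)
    have inv (g : SL(2, ℤ)) : (g⁻¹ : SL(2, ℤ)).1 * g.1 = 1 := by
      simpa only [Matrix.SpecialLinearGroup.coe_mul, Matrix.SpecialLinearGroup.coe_one] using
        congrArg Subtype.val (inv_mul_cancel g)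
    have h3 : (ρ i).1 * (diagOne l * (R i).1) = (ρ j).1 * (diagOne l * (R j).1) := by
      have := congrArg (fun X => X * (δ⁻¹ : SL(2, ℤ)).1) h1
      simpa only [Matrix.mul_assoc, hδδ, Matrix.mul_one] using this
    have h4 : diagOne l * (R i).1 = (k⁻¹ : SL(2, ℤ)).1 * tri i.1 i.2 (l / i.1) := by
      rw [hk, Matrix.mul_assoc, ← Matrix.mul_assoc _ k.1, inv, Matrix.one_mul]
    have h5 : tri j.1 j.2 (l / j.1) = (k' * (ρ j)⁻¹ * ρ i * k⁻¹ : SL(2, ℤ)).1 *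
        tri i.1 i.2 (l / i.1) := by
      simp only [Matrix.SpecialLinearGroup.coe_mul, Matrix.mul_assoc]
      rw [← h4, h3, ← Matrix.mul_assoc _ (ρ j).1, inv, Matrix.one_mul, hk', Matrix.mul_assoc]
    have h6 := mem_heckeIndex_spec hi'
    have h7 := mem_heckeIndex_spec hj'
    obtain ⟨h8, h9, -⟩ := tri_unique h6.1.a_pos h7.1.a_pos h6.2.2 h7.2.2 h5.symm
    exact Sigma.ext h8 (heq_of_eq h9)
  refine Finset.sum_nbij φ hφ hinj (Finset.surjOn_of_injOn_of_card_le _ hφ hinj le_rfl) ?_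
  intro i hi
  obtain ⟨-, k, hk⟩ := hR (φ i) (hφ i hi)
  have h1 := hρ i hi
  rw [hk] at h1
  have inv : ((ρ i)⁻¹ : SL(2, ℤ)).1 * (ρ i).1 = 1 := by
    simpa only [Matrix.SpecialLinearGroup.coe_mul, Matrix.SpecialLinearGroup.coe_one] using
      congrArg Subtype.val (inv_mul_cancel (ρ i))
  rw [← mul_smul]
  refine etaRatio_eq_of_decomposition hl (k := (ρ i)⁻¹ * k) (hR _ (hφ i hi)).1
    (mul_mem (hR i hi).1 hδ) ?_ τ
  rw [show ((ρ i)⁻¹ * k : SL(2, ℤ)).1 = ((ρ i)⁻¹ : SL(2, ℤ)).1 * k.1 from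
    Matrix.SpecialLinearGroup.coe_mul _ _, Matrix.mul_assoc, Matrix.mul_assoc,
    ← Matrix.mul_assoc k.1, ← h1, ← Matrix.mul_assoc, inv, Matrix.one_mul]

end

end EtaQuot

namespace EtaQuot

noncomputable section

open scoped NumberTheorySymbols
open UpperHalfPlane

/-! ### The Hecke operator preserves the space -/

/-- The matrices `(ay, by - dz; N, x)` belonging to a choice of `x, y, z`. -/
def HeckeChoice.right {N l : ℕ} (s : HeckeChoice N l) (i : Σ _ : ℕ, ℕ) : SL(2, ℤ) :=
  if h : (-(N : ℤ) * (i.2 : ℤ) + i.1 * s.x i.1 i.2) * s.y i.1 i.2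
    + N * ((l / i.1 : ℕ) : ℤ) * s.z i.1 i.2 = 1 then rightFactor h else 1

lemma HeckeChoice.spec_of_mem {N l : ℕ} (s : HeckeChoice N l) {i : Σ _ : ℕ, ℕ}
    (hi : i ∈ heckeIndex N l) : (-(N : ℤ) * (i.2 : ℤ) + i.1 * s.x i.1 i.2) * s.y i.1 i.2
    + N * ((l / i.1 : ℕ) : ℤ) * s.z i.1 i.2 = 1 := by
  obtain ⟨⟨h1, h2⟩, h3, h4⟩ := mem_heckeIndex.mp hi
  exact s.spec _ h1 h2 _ h3 h4

lemma HeckeChoice.right_spec {N l : ℕ} (s : HeckeChoice N l) {i : Σ _ : ℕ, ℕ}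
    (hi : i ∈ heckeIndex N l) : s.right i ∈ CongruenceSubgroup.Gamma0 N ∧
      ∃ k : SL(2, ℤ), tri i.1 i.2 (l / i.1) = k.1 * diagOne l * (s.right i).1 := by
  have h := s.spec_of_mem hi
  rw [HeckeChoice.right, dif_pos h]
  refine ⟨rightFactor_mem h, leftFactor h, ?_⟩
  have := tri_eq_mul h
  rwa [(mem_heckeIndex_spec hi).2.1] at this

lemma coe_ofComplex_tri {a d : ℕ} (ha : 0 < a) (hd : 0 < d) (b : ℕ) (τ : ℍ) :
    ((ofComplex (((a : ℂ) * (τ : ℂ) + b) / (d : ℂ)) : ℍ) : ℂ) = ((a : ℂ) * (τ : ℂ) + b) / (d : ℂ) := by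
  have h := tri_im_pos ha hd b τ.im_pos
  rw [Int.cast_natCast] at h
  rw [ofComplex_apply_of_im_pos h]

/-- The coefficient of `f((aτ+b)/d)` in the Hecke operator, without the power of `a`. -/
def HeckeChoice.kappa {l : ℕ} {r : ℕ+ →₀ ℤ} (s : HeckeChoice (level r) l) (i : Σ _ : ℕ, ℕ) : ℂ :=
  (etaChar r !![-(level r : ℤ) * (i.2 : ℤ) + i.1 * s.x i.1 i.2, s.z i.1 i.2;
      -(level r : ℤ) * ((l / i.1 : ℕ) : ℤ), s.y i.1 i.2] 1)⁻¹ *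
    (etaChar r !![i.1 * s.y i.1 i.2, (i.2 : ℤ) * s.y i.1 i.2 - ((l / i.1 : ℕ) : ℤ) * s.z i.1 i.2;
      (level r : ℤ), s.x i.1 i.2] 1)⁻¹

lemma heckeT_eq_sum {r : ℕ+ →₀ ℤ} {l : ℕ} (s : HeckeChoice (level r) l) (τ : ℍ) :
    heckeT l (level r) (twoK r) (etaChar r) (etaChar r) s (etaQuotient r) τ =
      (((l : ℝ) ^ (-((twoK r : ℝ) / 2) / 2) : ℝ) : ℂ) * ∑ i ∈ heckeIndex (level r) l,
        s.kappa i * ((((i.1 : ℝ) ^ ((twoK r : ℝ) / 2) : ℝ) : ℂ) *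
          etaQ r (((i.1 : ℂ) * τ + i.2) / ((l / i.1 : ℕ) : ℂ))) := by
  unfold heckeT
  congr 1
  rw [heckeIndex, Finset.sum_sigma]
  refine Finset.sum_congr rfl fun a ha => ?_
  rw [Finset.mul_sum]
  refine Finset.sum_congr rfl fun b hb => ?_
  have hmem : (⟨a, b⟩ : Σ _ : ℕ, ℕ) ∈ heckeIndex (level r) l := Finset.mem_sigma.mpr ⟨ha, hb⟩
  have h := (mem_heckeIndex_spec hmem).1
  rw [etaQuotient_apply, coe_ofComplex_tri h.a_pos h.d_pos]
  unfold HeckeChoice.kappa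
  ring

/-- The inverse character values in T_l are exactly those that turn f((aτ + b)/d) into f times a
translate of f(τ/l)/f(τ), so the modularity of T_l f reduces to invariance of the second factor. -/
lemma heckeT_eq_mul {r : ℕ+ →₀ ℤ} {l : ℕ} (s : HeckeChoice (level r) l) :
    heckeT l (level r) (twoK r) (etaChar r) (etaChar r) s (etaQuotient r) =
      etaQuotient r * fun τ => (((l : ℝ) ^ (-((twoK r : ℝ) / 2) / 2) : ℝ) : ℂ) *
        ∑ i ∈ heckeIndex (level r) l, etaRatio r l (s.right i • τ) := by
  funext τ
  rw [heckeT_eq_sum, Pi.mul_apply]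
  rw [mul_left_comm]
  congr 1
  rw [Finset.mul_sum]
  refine Finset.sum_congr rfl fun i hi => ?_
  have hs := s.spec_of_mem hi
  have h := mem_heckeIndex_spec hi
  have := etaRatio_rightFactor_mul r h.1.a_pos h.1.d_pos hs τ
  rw [h.2.1] at this
  rw [HeckeChoice.right, dif_pos hs, mul_comm (etaQuotient r τ), etaQuotient_apply, this]
  unfold HeckeChoice.kappa
  push_cast
  rfl

lemma slash_heckeT {r : ℕ+ →₀ ℤ} {l : ℕ} (hl : l ∈ Lf r) (s : HeckeChoice (level r) l)
    {γ : SL(2, ℤ)} (hγ : γ ∈ CongruenceSubgroup.Gamma0 (level r)) (ε : ℤˣ) :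
    slash (twoK r) γ ε (heckeT l (level r) (twoK r) (etaChar r) (etaChar r) s (etaQuotient r)) =
      etaChar r γ.1 ε •
        heckeT l (level r) (twoK r) (etaChar r) (etaChar r) s (etaQuotient r) := by
  rw [heckeT_eq_mul]
  refine slash_etaQuotient_mul r (fun δ hδ τ => ?_) hγ ε
  rw [sum_etaRatio_smul hl s.right (fun i hi => s.right_spec hi) hδ]

lemma mdifferentiable_heckeT {r : ℕ+ →₀ ℤ} {l : ℕ} (s : HeckeChoice (level r) l) :
    MDifferentiable 𝓘(ℂ) 𝓘(ℂ)
      (heckeT l (level r) (twoK r) (etaChar r) (etaChar r) s (etaQuotient r)) := by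
  rw [UpperHalfPlane.mdifferentiable_iff]
  refine DifferentiableOn.congr (f := fun z => (((l : ℝ) ^ (-((twoK r : ℝ) / 2) / 2) : ℝ) : ℂ) *
    ∑ i ∈ heckeIndex (level r) l, s.kappa i * ((((i.1 : ℝ) ^ ((twoK r : ℝ) / 2) : ℝ) : ℂ) *
      etaQ r (((i.1 : ℂ) * z + i.2) / ((l / i.1 : ℕ) : ℂ)))) ?_ fun z hz => ?_
  · refine DifferentiableOn.const_mul (DifferentiableOn.fun_sum fun i hi => ?_) _
    refine ((DifferentiableOn.const_mul ?_ _).const_mul _)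
    intro z hz
    have h := (mem_heckeIndex_spec hi).1
    have h2 := tri_im_pos h.a_pos h.d_pos i.2 hz
    rw [Int.cast_natCast] at h2
    exact (DifferentiableAt.comp (g := etaQ r) z (differentiableAt_etaQ r h2)
      (by fun_prop)).differentiableWithinAt
  · simp only [Function.comp_apply]
    rw [heckeT_eq_sum, ofComplex_apply_of_im_pos hz]

/-- The slash operator as a linear map. -/
def slashLin (w : ℤ) (γ : SL(2, ℤ)) (ε : ℤˣ) : (ℍ → ℂ) →ₗ[ℂ] (ℍ → ℂ) where
  toFun := slash w γ ε
  map_add' := slash_add w γ ε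
  map_smul' := slash_smul w γ ε

/-- Needed for the behaviour at all cusps: γ is arbitrary here, so the reduction is applied at level
1. -/
lemma exists_tri_mul {N a b d : ℕ} (h : IsHeckeTriple N a b d) (hN : 0 < N) (γ : SL(2, ℤ)) :
    ∃ (γ' : SL(2, ℤ)) (a' b' d' : ℕ), 0 < a' ∧ 0 < d' ∧
      tri a b d * γ.1 = γ'.1 * tri a' b' d' := by
  obtain ⟨x, y, z, -, -, hxyz, -⟩ := h.exists_choice hN one_pos isCoprime_one_left
  have hl := Nat.mul_pos h.a_pos h.d_pos
  have h1 : rightFactor hxyz * γ ∈ CongruenceSubgroup.Gamma0 1 :=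
    mem_Gamma0_iff_dvd.mpr (by simp)
  obtain ⟨a', b', d', ρ, -, -, -, h2, h3⟩ := exists_reduction hl h1
  refine ⟨leftFactor hxyz * ρ⁻¹, a', b', d', h2.a_pos, h2.d_pos, ?_⟩
  have inv : (ρ⁻¹ : SL(2, ℤ)).1 * ρ.1 = 1 := by
    simpa only [Matrix.SpecialLinearGroup.coe_mul, Matrix.SpecialLinearGroup.coe_one] using
      congrArg Subtype.val (inv_mul_cancel ρ)
  rw [show (leftFactor hxyz * ρ⁻¹ : SL(2, ℤ)).1 = (leftFactor hxyz).1 * (ρ⁻¹ : SL(2, ℤ)).1 from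
    Matrix.SpecialLinearGroup.coe_mul _ _, ← h3, tri_eq_mul hxyz,
    show (rightFactor hxyz * γ : SL(2, ℤ)).1 = (rightFactor hxyz).1 * γ.1 from
    Matrix.SpecialLinearGroup.coe_mul _ _]
  simp only [Matrix.mul_assoc]
  rw [← Matrix.mul_assoc _ ρ.1, inv, Matrix.one_mul]

lemma norm_csq (z : ℂ) : ‖csq z‖ = √‖z‖ := by
  conv_rhs => rw [← csq_sq z, norm_pow]
  rw [Real.sqrt_sq (norm_nonneg _)]

lemma norm_slash (w : ℤ) (γ : SL(2, ℤ)) (ε : ℤˣ) (f : ℍ → ℂ) (τ : ℍ) :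
    ‖slash w γ ε f τ‖ = √‖(γ 1 0 : ℂ) * (τ : ℂ) + (γ 1 1 : ℂ)‖ ^ (-w) * ‖f (γ • τ)‖ := by
  have hε : ‖((ε : ℤ) : ℂ)‖ = 1 := by
    rcases Int.units_eq_one_or ε with rfl | rfl <;> simp
  unfold slash
  rw [norm_mul, norm_zpow, norm_mul, hε, one_mul]
  congr 2
  exact norm_csq _

/-- The translate `τ ↦ (aτ+b)/d` on the upper half-plane. -/
def triAct (a b d : ℕ) (τ : ℍ) : ℍ := ofComplex (((a : ℂ) * (τ : ℂ) + b) / (d : ℂ))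

/-- The order at a cusp depends only on absolute values, so the ambiguity in the sign of the square
root disappears; the two automorphy factors differ by the constant d'/d. -/
lemma norm_slash_comp_triAct (w : ℤ) {a b d a' b' d' : ℕ} (ha : 0 < a) (hd : 0 < d) (ha' : 0 < a')
    (hd' : 0 < d') {γ γ' : SL(2, ℤ)} (h : tri a b d * γ.1 = γ'.1 * tri a' b' d') (ε : ℤˣ)
    (f : ℍ → ℂ) (τ : ℍ) :
    ‖slash w γ ε (f ∘ triAct a b d) τ‖ =
      √(d' / d : ℝ) ^ (-w) * ‖slash w γ' 1 f (triAct a' b' d' τ)‖ := by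
  have hτ' : ((triAct a' b' d' τ : ℍ) : ℂ) = ((a' : ℂ) * (τ : ℂ) + b') / (d' : ℂ) :=
    coe_ofComplex_tri ha' hd' b' τ
  have hγτ : ((triAct a b d (γ • τ) : ℍ) : ℂ) = ((a : ℂ) * ((γ • τ : ℍ) : ℂ) + b) / (d : ℂ) :=
    coe_ofComplex_tri ha hd b (γ • τ)
  have e (i j) := congrFun (congrFun h i) j
  simp only [tri, Matrix.mul_apply, Fin.sum_univ_two] at e
  have h00 := e 0 0
  have h01 := e 0 1
  have h10 := e 1 0
  have h11 := e 1 1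
  simp at h00 h01 h10 h11
  have k00 : (a : ℂ) * (γ 0 0 : ℤ) + b * (γ 1 0 : ℤ) = (γ' 0 0 : ℤ) * a' := by exact_mod_cast h00
  have k01 : (a : ℂ) * (γ 0 1 : ℤ) + b * (γ 1 1 : ℤ) = (γ' 0 0 : ℤ) * b' + (γ' 0 1 : ℤ) * d' := by
    exact_mod_cast h01
  have k10 : (d : ℂ) * (γ 1 0 : ℤ) = (γ' 1 0 : ℤ) * a' := by exact_mod_cast h10
  have k11 : (d : ℂ) * (γ 1 1 : ℤ) = (γ' 1 0 : ℤ) * b' + (γ' 1 1 : ℤ) * d' := by exact_mod_cast h11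
  have hd0 : (d : ℂ) ≠ 0 := by exact_mod_cast hd.ne'
  have hd0' : (d' : ℂ) ≠ 0 := by exact_mod_cast hd'.ne'
  have hj := denom_SL_ne_zero γ τ
  have hj' := denom_SL_ne_zero γ' (triAct a' b' d' τ)
  have hjj : (γ 1 0 : ℂ) * (τ : ℂ) + (γ 1 1 : ℂ) =
      (d' / d) * ((γ' 1 0 : ℂ) * ((triAct a' b' d' τ : ℍ) : ℂ) + (γ' 1 1 : ℂ)) := by
    rw [hτ']
    field_simp
    linear_combination (τ : ℂ) * k10 + k11
  have hpt : triAct a b d (γ • τ) = γ' • triAct a' b' d' τ := by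
    apply UpperHalfPlane.ext
    rw [hγτ, coe_smul_eq, coe_smul_eq]
    rw [div_eq_div_iff hd0 hj']
    have hjj' : (γ' 1 0 : ℂ) * ((triAct a' b' d' τ : ℍ) : ℂ) + (γ' 1 1 : ℂ) =
      (d / d') * ((γ 1 0 : ℂ) * (τ : ℂ) + (γ 1 1 : ℂ)) := by rw [hjj]; field_simp
    rw [hjj', hτ']
    obtain ⟨J, hJ⟩ : ∃ J, J = (γ 1 0 : ℂ) * (τ : ℂ) + (γ 1 1 : ℂ) := ⟨_, rfl⟩
    rw [← hJ] at hj ⊢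
    field_simp
    linear_combination (τ : ℂ) * k00 + k01 + b * hJ
  rw [norm_slash, norm_slash, Function.comp_apply, hpt, hjj, norm_mul, Real.sqrt_mul (norm_nonneg _),
    mul_zpow, mul_assoc]
  congr 3
  rw [norm_div, Complex.norm_natCast, Complex.norm_natCast]

lemma tendsto_triAct {a d : ℕ} (ha : 0 < a) (hd : 0 < d) (b : ℕ) :
    Filter.Tendsto (triAct a b d) atImInfty atImInfty := by
  rw [atImInfty, Filter.tendsto_comap_iff]
  have h1 : UpperHalfPlane.im ∘ triAct a b d = fun τ : ℍ => (a / d : ℝ) * τ.im := by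
    funext τ
    have h := congrArg Complex.im (coe_ofComplex_tri ha hd b τ)
    rw [Complex.div_natCast_im] at h
    change ((triAct a b d τ : ℍ) : ℂ).im = _
    rw [triAct, h]
    simp
    ring
  rw [h1]
  have : (0 : ℝ) < a / d := by
    have h1 : (0 : ℝ) < a := by exact_mod_cast ha
    have h2 : (0 : ℝ) < d := by exact_mod_cast hd
    positivity
  exact Filter.Tendsto.const_mul_atTop this Filter.tendsto_comap

lemma isBoundedAtImInfty_slash_comp_triAct {w : ℤ} {N a b d : ℕ} (h : IsHeckeTriple N a b d)
    (hN : 0 < N) {f : ℍ → ℂ}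
    (hf : ∀ (γ : SL(2, ℤ)) (ε : ℤˣ), IsBoundedAtImInfty (slash w γ ε f)) (γ : SL(2, ℤ)) (ε : ℤˣ) :
    IsBoundedAtImInfty (slash w γ ε (f ∘ triAct a b d)) := by
  obtain ⟨γ', a', b', d', ha', hd', hγ⟩ := exists_tri_mul h hN γ
  have h1 := (hf γ' 1).comp_tendsto (tendsto_triAct ha' hd' b')
  have h2 := (h1.norm_left.const_mul_left (√(d' / d : ℝ) ^ (-w)))
  refine Asymptotics.IsBigO.of_norm_left (h2.congr_left fun τ => ?_)
  exact (norm_slash_comp_triAct w h.a_pos h.d_pos ha' hd' hγ ε f τ).symm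

lemma isZeroAtImInfty_slash_comp_triAct {w : ℤ} {N a b d : ℕ} (h : IsHeckeTriple N a b d)
    (hN : 0 < N) {f : ℍ → ℂ}
    (hf : ∀ (γ : SL(2, ℤ)) (ε : ℤˣ), IsZeroAtImInfty (slash w γ ε f)) (γ : SL(2, ℤ)) (ε : ℤˣ) :
    IsZeroAtImInfty (slash w γ ε (f ∘ triAct a b d)) := by
  obtain ⟨γ', a', b', d', ha', hd', hγ⟩ := exists_tri_mul h hN γ
  have h1 := (hf γ' 1).comp (tendsto_triAct ha' hd' b')
  have h2 := h1.norm.const_mul (√(d' / d : ℝ) ^ (-w))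
  rw [norm_zero, mul_zero] at h2
  refine tendsto_zero_iff_norm_tendsto_zero.mpr (h2.congr fun τ => ?_)
  exact (norm_slash_comp_triAct w h.a_pos h.d_pos ha' hd' hγ ε f τ).symm

/-- The submodule `W` serves twice: as the functions bounded at i∞ and as those vanishing there. -/
lemma slash_heckeT_mem {r : ℕ+ →₀ ℤ} {l : ℕ} (s : HeckeChoice (level r) l)
    (W : Submodule ℂ (ℍ → ℂ)) (γ : SL(2, ℤ)) (ε : ℤˣ)
    (hW : ∀ i ∈ heckeIndex (level r) l,
      slash (twoK r) γ ε (etaQuotient r ∘ triAct i.1 i.2 (l / i.1)) ∈ W) :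
    slash (twoK r) γ ε (heckeT l (level r) (twoK r) (etaChar r) (etaChar r) s (etaQuotient r)) ∈ W
    := by
  have h1 : heckeT l (level r) (twoK r) (etaChar r) (etaChar r) s (etaQuotient r) =
      (((l : ℝ) ^ (-((twoK r : ℝ) / 2) / 2) : ℝ) : ℂ) • ∑ i ∈ heckeIndex (level r) l,
        (s.kappa i * (((i.1 : ℝ) ^ ((twoK r : ℝ) / 2) : ℝ) : ℂ)) •
          (etaQuotient r ∘ triAct i.1 i.2 (l / i.1)) := by
    funext τ
    rw [heckeT_eq_sum, Pi.smul_apply, smul_eq_mul, Finset.sum_apply]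
    congr 1
    refine Finset.sum_congr rfl fun i hi => ?_
    have h := (mem_heckeIndex_spec hi).1
    rw [Pi.smul_apply, smul_eq_mul, Function.comp_apply, triAct, etaQuotient_apply,
      coe_ofComplex_tri h.a_pos h.d_pos, mul_assoc]
  change slashLin (twoK r) γ ε _ ∈ W
  rw [h1, map_smul, map_sum]
  refine W.smul_mem _ (W.sum_mem fun i hi => ?_)
  rw [map_smul]
  exact W.smul_mem _ (hW i hi)

lemma heckeT_mem_modularForms {r : ℕ+ →₀ ℤ} (hr : IsHolomorphicEtaQuotient r) {l : ℕ}
    (hl : l ∈ Lf r) (s : HeckeChoice (level r) l) :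
    heckeT l (level r) (twoK r) (etaChar r) (etaChar r) s (etaQuotient r) ∈
      modularForms (level r) (twoK r) (etaChar r) :=
  ⟨mdifferentiable_heckeT s, fun _ hγ ε => slash_heckeT hl s hγ ε, fun γ ε =>
    slash_heckeT_mem s (Filter.boundedFilterSubmodule ℂ atImInfty) γ ε fun _ hi =>
      isBoundedAtImInfty_slash_comp_triAct (mem_heckeIndex_spec hi).1 (level_pos r) hr γ ε⟩

lemma heckeT_mem_cuspForms {r : ℕ+ →₀ ℤ}
    (hr : etaQuotient r ∈ cuspForms (level r) (twoK r) (etaChar r)) {l : ℕ}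
    (hl : l ∈ Lf r) (s : HeckeChoice (level r) l) :
    heckeT l (level r) (twoK r) (etaChar r) (etaChar r) s (etaQuotient r) ∈
      cuspForms (level r) (twoK r) (etaChar r) :=
  ⟨heckeT_mem_modularForms hr.1.2.2 hl s, fun γ ε =>
    slash_heckeT_mem s (Filter.zeroAtFilterSubmodule ℂ atImInfty) γ ε fun _ hi =>
      isZeroAtImInfty_slash_comp_triAct (mem_heckeIndex_spec hi).1 (level_pos r) hr.2 γ ε⟩

lemma etaQuotient_ne_zero (r : ℕ+ →₀ ℤ) : etaQuotient r ≠ 0 := fun h =>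
  etaQ_ne_zero r I.im_pos (congrFun h I)

/-- Weakly admissible eta-quotients are eigenfunctions of the Hecke operators. -/
theorem exists_eigenvalue {r : ℕ+ →₀ ℤ} (hr : IsWeaklyAdmissible r) {l : ℕ} (hl : l ∈ Lf r)
    (s : HeckeChoice (level r) l) :
    ∃ c : ℂ, heckeT l (level r) (twoK r) (etaChar r) (etaChar r) s (etaQuotient r) =
      c • etaQuotient r := by
  have key : ∀ W : Submodule ℂ (ℍ → ℂ), Module.finrank ℂ W = 1 → etaQuotient r ∈ W →
      heckeT l (level r) (twoK r) (etaChar r) (etaChar r) s (etaQuotient r) ∈ W →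
      ∃ c : ℂ, heckeT l (level r) (twoK r) (etaChar r) (etaChar r) s (etaQuotient r) =
        c • etaQuotient r := by
    intro W hW h1 h2
    have hne : (⟨etaQuotient r, h1⟩ : W) ≠ 0 := fun h =>
      etaQuotient_ne_zero r (congrArg Subtype.val h)
    obtain ⟨c, hc⟩ := (finrank_eq_one_iff_of_nonzero' _ hne).mp hW ⟨_, h2⟩
    exact ⟨c, (congrArg Subtype.val hc).symm⟩
  obtain ⟨hhol, h | ⟨-, h1, h2⟩⟩ := hr
  · exact key _ h (etaQuotient_mem_modularForms hhol) (heckeT_mem_modularForms hhol hl s)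
  · exact key _ h1 h2 (heckeT_mem_cuspForms h2 hl s)

lemma nonempty_heckeChoice {N : ℕ} (hN : 0 < N) (l : ℕ) : Nonempty (HeckeChoice N l) := by
  have h : ∀ a b : ℕ, ∃ x y z : ℤ, a ∈ l.divisors → N.Coprime a → b < l / a →
      Nat.gcd a (Nat.gcd b (l / a)) = 1 →
      (-(N : ℤ) * b + a * x) * y + N * ((l / a : ℕ) : ℤ) * z = 1 := by
    intro a b
    by_cases H : a ∈ l.divisors ∧ N.Coprime a ∧ b < l / a ∧ Nat.gcd a (Nat.gcd b (l / a)) = 1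
    · obtain ⟨h1, h2, h3, h4⟩ := H
      have := (isHeckeTriple_iff_gcd (Nat.pos_of_mem_divisors h1) (by omega) h2).mpr h4
      obtain ⟨x, y, z, -, -, hxyz, -⟩ := this.exists_choice hN one_pos isCoprime_one_left
      exact ⟨x, y, z, fun _ _ _ _ => hxyz⟩
    -- Outside the index set nothing is required, so 0 is only a default value.
    · exact ⟨0, 0, 0, fun h1 h2 h3 h4 => absurd ⟨h1, h2, h3, h4⟩ H⟩
  choose x y z hxyz using h
  exact ⟨⟨x, y, z, fun a ha hN b hb hg => hxyz a b ha hN hb hg⟩⟩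

end

end EtaQuot

namespace EtaQuot

noncomputable section

open scoped NumberTheorySymbols
open UpperHalfPlane

/-! ### Arithmetic of `Π` -/

lemma bigPi_eq_prod (r : ℕ+ →₀ ℤ) : bigPi r = ∏ n ∈ r.support, codiv r n ^ (r n).natAbs := rfl

lemma bigPi_ne_zero (r : ℕ+ →₀ ℤ) : bigPi r ≠ 0 := by
  rw [bigPi_eq_prod]
  exact Finset.prod_ne_zero_iff.mpr fun n hn => pow_ne_zero _ (codiv_pos r hn).ne'

lemma codiv_dvd_level (r : ℕ+ →₀ ℤ) {n : ℕ+} (hn : n ∈ r.support) : codiv r n ∣ level r :=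
  ⟨n, (codiv_mul r hn).symm⟩

lemma prime_dvd_level_of_dvd_bigPi {r : ℕ+ →₀ ℤ} {p : ℕ} (hp : p.Prime) (h : p ∣ bigPi r) :
    p ∣ level r := by
  rw [bigPi_eq_prod] at h
  obtain ⟨n, hn, hpn⟩ := (Prime.dvd_finsetProd_iff (Nat.prime_iff.mp hp) _).mp h
  exact (hp.dvd_of_dvd_pow hpn).trans (codiv_dvd_level r hn)

/-- The odd part of `Π`. -/
def oddPi (r : ℕ+ →₀ ℤ) : ℕ := bigPi r / 2 ^ (bigPi r).factorization 2

/-- The exponent of `2` in `Π`. -/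
def twoPi (r : ℕ+ →₀ ℤ) : ℕ := (bigPi r).factorization 2

lemma bigPi_eq (r : ℕ+ →₀ ℤ) : bigPi r = 2 ^ twoPi r * oddPi r :=
  (Nat.ordProj_mul_ordCompl_eq_self (bigPi r) 2).symm

lemma oddPi_odd (r : ℕ+ →₀ ℤ) : Odd (oddPi r) := by
  rw [← Nat.not_even_iff_odd, even_iff_two_dvd]
  exact Nat.not_dvd_ordCompl Nat.prime_two (bigPi_ne_zero r)

lemma oddPi_dvd (r : ℕ+ →₀ ℤ) : oddPi r ∣ bigPi r := ⟨_, by rw [mul_comm]; exact bigPi_eq r⟩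

/-- `δ` as an integer. -/
def dlt (r : ℕ+ →₀ ℤ) : ℤ := if oddPi r % 4 = 3 then 1 else 0

lemma delta_eq (r : ℕ+ →₀ ℤ) : delta r = dlt r := by
  unfold delta dlt oddPi
  split_ifs <;> simp

lemma four_dvd_oddPi_sub (r : ℕ+ →₀ ℤ) : (4 : ℤ) ∣ oddPi r - 1 - 2 * dlt r := by
  have h := Nat.odd_iff.mp (oddPi_odd r)
  unfold dlt
  split_ifs <;> omega

lemma jacobi_eq_one_of_primes {u : ℤ} {P : ℕ} (h : ∀ p : ℕ, p.Prime → p ∣ P → (p : ℤ) ∣ u - 1) :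
    J(u | P) = 1 := by
  induction P using Nat.recOnMul with
  | zero => exact jacobiSym.zero_right u
  | one => exact jacobiSym.one_right u
  | prime p hp =>
    have h1 := h p hp dvd_rfl
    have h2 : (1 : ℤ) ≡ u [ZMOD p] := Int.modEq_iff_dvd.mpr h1
    have : J(u | p) = J(1 | p) := jacobiSym.mod_left' h2.symm
    rw [this, jacobiSym.one_left]
  | mul a b ha hb =>
    rcases eq_or_ne a 0 with rfl | ha0
    · simp
    rcases eq_or_ne b 0 with rfl | hb0
    · simp
    rw [jacobiSym.mul_right' _ ha0 hb0, ha fun p hp hpa => h p hp (hpa.mul_right b),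
      hb fun p hp hpb => h p hp (hpb.mul_left a), one_mul]

lemma jacobi_oddPi_eq_one {r : ℕ+ →₀ ℤ} {u : ℤ} (h : (level r : ℤ) ∣ u - 1) :
    J(u | oddPi r) = 1 :=
  jacobi_eq_one_of_primes fun _ hp hpd => (Int.natCast_dvd_natCast.mpr
    (prime_dvd_level_of_dvd_bigPi hp (hpd.trans (oddPi_dvd r)))).trans h

/-- Every prime factor of Π divides the level, so the symbol of axy is 1. The congruence is
satisfied by every choice of x, y, z, and the lemma replaces the symbols of x and y by the symbol of
a. -/
lemma jacobi_mul_oddPi {r : ℕ+ →₀ ℤ} {a x y : ℤ} (h : (level r : ℤ) ∣ a * x * y - 1) :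
    J(x | oddPi r) * J(y | oddPi r) = J(a | oddPi r) := by
  have h1 := jacobi_oddPi_eq_one h
  rw [jacobiSym.mul_left, jacobiSym.mul_left, mul_assoc] at h1
  rcases jacobiSym.trichotomy a (oddPi r) with h2 | h2 | h2
  · rw [h2] at h1; simp at h1
  · rw [h2] at h1 ⊢; simpa using h1
  · rw [h2] at h1 ⊢; linarith

/-- Quadratic reciprocity for the odd part of `Π`. -/
lemma jacobi_oddPi_reciprocity (r : ℕ+ →₀ ℤ) {x : ℕ} (hx : Odd x) :
    ((J(oddPi r | x) : ℤ) : ℂ) = ((J(x | oddPi r) : ℤ) : ℂ) * zeta ((6 * dlt r * (x - 1) : ℤ) : ℚ) := by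
  rw [jacobi_reciprocity_zeta (oddPi_odd r) hx]
  congr 1
  have h1 := four_dvd_oddPi_sub r
  obtain ⟨u, hu⟩ := h1
  obtain ⟨v, hv⟩ := hx
  have : (3 : ℚ) * (oddPi r - 1) * (x - 1) = ((3 * (oddPi r - 1) * (x - 1) : ℤ) : ℚ) := by push_cast; ring
  rw [this]
  refine zeta_eq_of_dvd ⟨u * v, ?_⟩
  rw [hv]
  push_cast
  linear_combination (6 * v : ℤ) * hu

lemma jacobi_bigPi (r : ℕ+ →₀ ℤ) {x : ℕ} (hx : Odd x) :
    J(bigPi r | x) = ZMod.χ₈ ((x : ℤ) : ZMod 8) ^ twoPi r * J(oddPi r | x) := by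
  rw [bigPi_eq]
  push_cast
  rw [jacobiSym.mul_left, jacobiSym.pow_left, jacobiSym.at_two hx]

lemma kronecker_bigPi (r : ℕ+ →₀ ℤ) (a : ℕ) :
    kronecker a (bigPi r) = ZMod.χ₈ ((a : ℤ) : ZMod 8) ^ twoPi r * J(a | oddPi r) := by
  have h : ((bigPi r : ℕ) : ℤ) ≠ 0 := by exact_mod_cast bigPi_ne_zero r
  have h2 : ¬ (((bigPi r : ℕ) : ℤ) < 0 ∧ (a : ℤ) < 0) := by omega
  rw [kronecker, if_neg h, if_neg h2, one_mul, Int.natAbs_natCast]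
  rfl

lemma jacobi_natCast_ne {a : ℤ} {b : ℕ} (h : IsCoprime a b) : J(a | b) = 1 ∨ J(a | b) = -1 :=
  jacobiSym.eq_one_or_neg_one (Int.isCoprime_iff_gcd_eq_one.mp h)

/-- Parity of the exponent of `2` in `Π`. -/
lemma twoPi_modEq (r : ℕ+ →₀ ℤ) :
    (twoPi r : ℤ) ≡ ∑ n ∈ r.support, r n * ((codiv r n).factorization 2 : ℤ) [ZMOD 2] := by
  have h1 : twoPi r = ∑ n ∈ r.support, (r n).natAbs * (codiv r n).factorization 2 := by
    rw [twoPi, bigPi_eq_prod, Nat.factorization_prod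
      fun n hn => pow_ne_zero _ (codiv_pos r hn).ne', Finsupp.finsetSum_apply]
    refine Finset.sum_congr rfl fun n _ => ?_
    rw [Nat.factorization_pow]; rfl
  rw [h1]
  push_cast
  refine Int.ModEq.sum fun n _ => Int.ModEq.mul_right _ ?_
  rw [Int.ModEq]
  rcases abs_cases (r n) with h | h <;> omega

lemma xOne_eq_sum (r : ℕ+ →₀ ℤ) : xOne r = ∑ n ∈ r.support, r n * (codiv r n : ℤ) :=
  Finset.sum_congr rfl fun _ _ => mul_comm _ _

lemma xN_eq_sum (r : ℕ+ →₀ ℤ) : xN r = ∑ n ∈ r.support, r n * ((n : ℕ) : ℤ) :=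
  Finset.sum_congr rfl fun _ _ => mul_comm _ _

lemma twoK_eq_sum (r : ℕ+ →₀ ℤ) : twoK r = ∑ n ∈ r.support, r n := rfl

lemma sum_modEq {r : ℕ+ →₀ ℤ} {m : ℤ} {f g : ℕ+ → ℤ}
    (h : ∀ n ∈ r.support, f n ≡ g n [ZMOD m]) :
    ∑ n ∈ r.support, r n * f n ≡ ∑ n ∈ r.support, r n * g n [ZMOD m] :=
  Int.ModEq.sum fun n hn => (h n hn).mul_left _

/-- Term by term: with N = mn one has N(n - Nm) = n²(m - m³), and 3 divides m - m³. -/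
lemma three_dvd_level_mul (r : ℕ+ →₀ ℤ) : (3 : ℤ) ∣ level r * (xN r - level r * xOne r) := by
  have h : (level r : ℤ) * (xN r - level r * xOne r) =
      ∑ n ∈ r.support, r n * (level r * ((n : ℕ) - level r * codiv r n)) := by
    rw [xN_eq_sum, xOne_eq_sum, Finset.mul_sum, ← Finset.sum_sub_distrib, Finset.mul_sum]
    refine Finset.sum_congr rfl fun n _ => ?_
    ring
  rw [h]
  refine Finset.dvd_sum fun n hn => Dvd.dvd.mul_left ?_ _
  rw [← codiv_mul_int r hn]
  generalize (codiv r n : ℤ) = m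
  generalize (((n : ℕ)) : ℤ) = n
  have : (m * n) * (n - m * n * m) = n ^ 2 * (m - m ^ 3) := by ring
  rw [this]
  refine Dvd.dvd.mul_left ?_ _
  have h3 : m % 3 = 0 ∨ m % 3 = 1 ∨ m % 3 = 2 := by omega
  apply Int.dvd_of_emod_eq_zero
  rcases h3 with h | h | h <;> simp [pow_succ, Int.mul_emod, Int.sub_emod, h]

lemma eight_dvd_xOne_sub {r : ℕ+ →₀ ℤ} (hN : Odd (level r)) :
    (8 : ℤ) ∣ xOne r - level r * xN r := by
  have h : xOne r - level r * xN r =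
      ∑ n ∈ r.support, r n * (codiv r n - level r * (n : ℕ)) := by
    rw [xN_eq_sum, xOne_eq_sum, Finset.mul_sum, ← Finset.sum_sub_distrib]
    refine Finset.sum_congr rfl fun n _ => ?_
    ring
  rw [h]
  refine Finset.dvd_sum fun n hn => Dvd.dvd.mul_left ?_ _
  rw [← codiv_mul r hn] at hN
  have h2 : Odd (((n : ℕ)) : ℤ) := by exact_mod_cast (Nat.odd_mul.mp hN).2
  obtain ⟨u, hu⟩ := Int.eight_dvd_sq_sub_one_of_odd h2
  rw [← codiv_mul_int r hn]
  exact ⟨-(codiv r n * u), by linear_combination (-(codiv r n : ℤ)) * hu⟩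

lemma twoPi_eq_zero {r : ℕ+ →₀ ℤ} (hN : Odd (level r)) : twoPi r = 0 := by
  refine Nat.factorization_eq_zero_of_not_dvd fun h => ?_
  have := prime_dvd_level_of_dvd_bigPi Nat.prime_two h
  exact (Nat.not_even_iff_odd.mpr hN) (even_iff_two_dvd.mpr this)

/-- On odd integers m ↦ m - 1 turns products into sums modulo 4. Its values are even, so only the
parity of the exponents matters and |r_n| may be replaced by r_n. -/
lemma bigPi_modEq_four {r : ℕ+ →₀ ℤ} (hN : Odd (level r)) :
    (bigPi r : ℤ) ≡ 1 + (xOne r - twoK r) [ZMOD 4] := by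
  have hodd : ∀ n ∈ r.support, Odd (codiv r n) := fun n hn => by
    rw [← codiv_mul r hn] at hN; exact (Nat.odd_mul.mp hN).1
  have h : xOne r - twoK r = ∑ n ∈ r.support, r n * (codiv r n - 1) := by
    rw [xOne_eq_sum, twoK_eq_sum, ← Finset.sum_sub_distrib]
    refine Finset.sum_congr rfl fun n _ => ?_
    ring
  have hpow : ∀ (m k : ℕ), Odd m → ((m ^ k : ℕ) : ℤ) ≡ 1 + k * (m - 1) [ZMOD 4] := by
    intro m k hm
    induction k with
    | zero => simp [Int.ModEq]
    | succ k ih =>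
      have := ih.mul_right (m : ℤ)
      push_cast at this ⊢
      rw [pow_succ]
      refine this.trans ?_
      obtain ⟨u, rfl⟩ := hm
      refine (Int.modEq_iff_dvd.mpr ⟨-(k * u ^ 2), ?_⟩)
      push_cast
      ring
  rw [h, bigPi_eq_prod]
  revert hodd
  generalize r.support = s
  intro hodd
  induction s using Finset.cons_induction with
  | empty => simp [Int.ModEq]
  | cons n s hn ih =>
    rw [Finset.prod_cons, Finset.sum_cons]
    have h1 := hpow (codiv r n) (r n).natAbs (hodd n (Finset.mem_cons_self n s))
    have h2 := ih fun m hm => hodd m (Finset.mem_cons_of_mem hm)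
    have h3 := h1.mul h2
    rw [Nat.cast_mul]
    refine h3.trans ?_
    obtain ⟨u, hu⟩ := hodd n (Finset.mem_cons_self n s)
    have hS : (2 : ℤ) ∣ ∑ n ∈ s, r n * ((codiv r n : ℤ) - 1) :=
      Finset.dvd_sum fun m hm => by
        obtain ⟨v, hv⟩ := hodd m (Finset.mem_cons_of_mem hm)
        exact ⟨r m * v, by rw [hv]; push_cast; ring⟩
    obtain ⟨S, hS⟩ := hS
    rw [hS, hu]
    have habs : ∃ t : ℤ, ((r n).natAbs : ℤ) = r n + 2 * t := by
      rcases Int.natAbs_eq (r n) with h | h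
      · exact ⟨0, by omega⟩
      · exact ⟨(r n).natAbs, by omega⟩
    obtain ⟨t, ht⟩ := habs
    rw [ht]
    refine Int.modEq_iff_dvd.mpr ⟨-(t * u + (r n + 2 * t) * u * S), ?_⟩
    push_cast
    ring

/-- For odd level, `w + 2δ ≡ N x_N` modulo `4`. -/
lemma four_dvd_twoK_add {r : ℕ+ →₀ ℤ} (hN : Odd (level r)) (h : (4 : ℤ) ∣ xN r) :
    (4 : ℤ) ∣ twoK r + 2 * dlt r := by
  have h1 := bigPi_modEq_four hN
  have h2 := eight_dvd_xOne_sub hN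
  have h3 := four_dvd_oddPi_sub r
  have h4 : bigPi r = oddPi r := by
    rw [bigPi_eq, twoPi_eq_zero hN, pow_zero, one_mul]
  rw [h4] at h1
  obtain ⟨u, hu⟩ := h
  rw [hu, show (level r : ℤ) * (4 * u) = 4 * (level r * u) by ring] at h2
  have h5 := h1.dvd
  generalize (level r : ℤ) * u = c at h2
  omega

/-- Used with mn = N. When the 2-part of N is 2 or 4, the parity of v₂(N/n) is affine in N/n and n,
so the parity of v₂(Π) becomes a combination of `xOne r`, `xN r` and `twoK r`. -/
lemma factorization_two_mod {m n : ℕ} (hm : 0 < m) (hn : 0 < n) (h4 : ¬ 8 ∣ m * n) (h2 : 2 ∣ m * n) :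
    (m.factorization 2 : ℤ) ≡ (if 4 ∣ m * n then 1 else 0) + m + (if 4 ∣ m * n then (n : ℤ) else 1)
      [ZMOD 2] := by
  obtain ⟨i, m', hm', rfl⟩ := Nat.exists_eq_two_pow_mul_odd hm.ne'
  obtain ⟨j, n', hn', rfl⟩ := Nat.exists_eq_two_pow_mul_odd hn.ne'
  have hm0 : m' ≠ 0 := by rintro rfl; simp at hm'
  have hf : (2 ^ i * m').factorization 2 = i := by
    rw [Nat.factorization_mul (by positivity) hm0, Nat.Prime.factorization_pow Nat.prime_two]
    simp [Nat.factorization_eq_zero_of_not_dvd (fun h => (Nat.not_even_iff_odd.mpr hm')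
      (even_iff_two_dvd.mpr h))]
  have hprod : 2 ^ i * m' * (2 ^ j * n') = 2 ^ (i + j) * (m' * n') := by rw [pow_add]; ring
  rw [hf]
  rw [hprod] at h4 h2 ⊢
  have hij : i + j < 3 := by
    by_contra hc
    exact h4 ((pow_dvd_pow 2 (not_lt.mp hc)).mul_right (m' * n'))
  have hmn : Odd (m' * n') := hm'.mul hn'
  have hij1 : 1 ≤ i + j := by
    by_contra hc
    have : i + j = 0 := by omega
    rw [this, pow_zero, one_mul] at h2
    exact (Nat.not_even_iff_odd.mpr hmn) (even_iff_two_dvd.mpr h2)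
  obtain ⟨u, hu⟩ := hm'
  obtain ⟨v, hv⟩ := hn'
  have hw := Nat.odd_iff.mp hmn
  rw [Int.ModEq]
  have hi : i = 0 ∨ i = 1 ∨ i = 2 := by omega
  have hj : j = 0 ∨ j = 1 ∨ j = 2 := by omega
  rcases hi with rfl | rfl | rfl <;> rcases hj with rfl | rfl | rfl <;>
    simp only [add_zero, zero_add, Nat.reduceAdd, pow_zero, pow_one, one_mul, Nat.reducePow] at * <;>
    split_ifs <;> omega

/-- If `N ≡ 2 mod 4` and `x_N`, `∑ (N/n) r_n` are even, then `2k` and `v₂(Π)` are even. -/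
lemma even_of_level_two {r : ℕ+ →₀ ℤ} (h2 : 2 ∣ level r) (h4 : ¬ 4 ∣ level r)
    (h1 : (2 : ℤ) ∣ xOne r) (hN : (2 : ℤ) ∣ xN r) : Even (twoK r) ∧ Even (twoPi r) := by
  have e1 : xOne r + xN r ≡ twoK r [ZMOD 2] := by
    rw [xOne_eq_sum, xN_eq_sum, twoK_eq_sum, ← Finset.sum_add_distrib]
    refine Int.ModEq.sum fun n hn => ?_
    have hmn := codiv_mul r hn
    rw [← mul_add]
    conv_rhs => rw [← mul_one (r n)]
    refine Int.ModEq.mul_left _ ?_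
    rw [← hmn] at h2 h4
    rw [Int.ModEq]
    rcases Nat.even_or_odd' (codiv r n) with ⟨u, hu | hu⟩ <;>
      rcases Nat.even_or_odd' (n : ℕ) with ⟨v, hv | hv⟩
    · exact absurd ⟨u * v, by rw [hu, hv]; ring⟩ h4
    · omega
    · omega
    · rw [hu, hv] at h2
      have : (2 * u + 1) * (2 * v + 1) = 2 * (2 * u * v + u + v) + 1 := by ring
      omega
  have hw : Even (twoK r) := by
    have := e1.dvd
    rw [even_iff_two_dvd]
    omega
  refine ⟨hw, ?_⟩
  have e2 := (twoPi_modEq r).trans (sum_modEq (g := fun n => (codiv r n : ℤ) + 1) fun n hn => by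
    have := factorization_two_mod (codiv_pos r hn) n.pos (m := codiv r n) (n := n)
      (by rw [codiv_mul r hn]; omega) (by rw [codiv_mul r hn]; exact h2)
    rw [codiv_mul r hn, if_neg h4, if_neg h4, zero_add] at this
    exact this)
  simp only [mul_add, mul_one, Finset.sum_add_distrib] at e2
  rw [← xOne_eq_sum, ← twoK_eq_sum] at e2
  have := e2.dvd
  have h5 : (2 : ℤ) ∣ twoPi r := by
    rw [even_iff_two_dvd] at hw
    omega
  rw [even_iff_two_dvd]
  exact_mod_cast h5

/-- If `N ≡ 4 mod 8` and `x_N`, `∑ (N/n) r_n` are even, then `v₂(Π) ≡ 2k mod 2`. -/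
lemma even_of_level_four {r : ℕ+ →₀ ℤ} (h4 : 4 ∣ level r) (h8 : ¬ 8 ∣ level r)
    (h1 : (2 : ℤ) ∣ xOne r) (hN : (2 : ℤ) ∣ xN r) : (2 : ℤ) ∣ twoPi r - twoK r := by
  have e2 := (twoPi_modEq r).trans (sum_modEq (g := fun n => 1 + (codiv r n : ℤ) + (n : ℕ)) fun n hn => by
    have := factorization_two_mod (codiv_pos r hn) n.pos (m := codiv r n) (n := n)
      (by rw [codiv_mul r hn]; exact h8) (by rw [codiv_mul r hn]; omega)
    rw [codiv_mul r hn, if_pos h4, if_pos h4] at this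
    exact this)
  simp only [mul_add, mul_one, Finset.sum_add_distrib] at e2
  rw [← xOne_eq_sum, ← twoK_eq_sum, ← xN_eq_sum] at e2
  have := e2.dvd
  omega

end

end EtaQuot

namespace EtaQuot

noncomputable section

open scoped NumberTheorySymbols
open UpperHalfPlane

/-! ### Evaluation of the coefficients of the Hecke operator -/

/-- The product of the values of the character at the two factors of `(a, b; 0, d)`. -/
def chiProd (r : ℕ+ →₀ ℤ) (a : ℕ) (b : ℤ) (d : ℕ) (x y z : ℤ) : ℂ :=
  etaChar r !![-(level r : ℤ) * b + a * x, z; -(level r : ℤ) * d, y] 1 *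
    etaChar r !![a * y, b * y - d * z; (level r : ℤ), x] 1

lemma etaChar_T (r : ℕ+ →₀ ℤ) (j : ℤ) : etaChar r !![1, j; 0, 1] 1 = zeta (j * xN r) := by
  have := etaChar_odd_right r (a := 1) (b := j) (t := 0) one_pos odd_one (by ring)
  rw [mul_zero] at this
  rw [this]
  simp [jacobiSym.one_right]

lemma etaQ_add_int (r : ℕ+ →₀ ℤ) (j : ℤ) {τ : ℂ} (hτ : 0 < τ.im) :
    etaQ r (τ + j) = zeta (j * xN r) * etaQ r τ := by
  have := etaQ_mobius r (a := 1) (b := j) (c := 0) (d := 1) (dvd_zero _) (by ring) hτ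
  rw [etaChar_T] at this
  simpa [csq_one] using this

/-- The value of `chiProd` does not depend on the choices, and changes in a simple way under
translation of `b` by multiples of `d`. -/
lemma chiProd_shift {r : ℕ+ →₀ ℤ} {a d : ℕ} {b j x y z x' y' z' : ℤ} (ha : 0 < a) (hd : 0 < d)
    (hl : a * d ∈ Lf r) (h : (-(level r : ℤ) * b + a * x) * y + level r * d * z = 1)
    (h' : (-(level r : ℤ) * (b + j * d) + a * x') * y' + level r * d * z' = 1) :
    chiProd r a (b + j * d) d x' y' z' = chiProd r a b d x y z * zeta (j * xN r) := by
  let T : SL(2, ℤ) := ⟨!![1, j; 0, 1], by simp⟩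
  have hT : tri a (b + j * d) d = T.1 * tri a b d := by
    simp only [T, tri, Matrix.mul_fin_two]
    congr 1
    ext i k
    fin_cases i <;> fin_cases k <;> simp
  have h1 : diagOne (a * d) * (rightFactor h').1 =
      ((leftFactor h')⁻¹ * T * leftFactor h : SL(2, ℤ)).1 * diagOne (a * d) * (rightFactor h).1 := by
    have inv : ((leftFactor h')⁻¹ : SL(2, ℤ)).1 * (leftFactor h').1 = 1 := by
      simpa only [Matrix.SpecialLinearGroup.coe_mul, Matrix.SpecialLinearGroup.coe_one] using
        congrArg Subtype.val (inv_mul_cancel (leftFactor h'))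
    rw [show ((leftFactor h')⁻¹ * T * leftFactor h : SL(2, ℤ)).1 =
      ((leftFactor h')⁻¹ : SL(2, ℤ)).1 * T.1 * (leftFactor h).1 by
        rw [← Matrix.SpecialLinearGroup.coe_mul, ← Matrix.SpecialLinearGroup.coe_mul]]
    simp only [Matrix.mul_assoc]
    rw [← Matrix.mul_assoc (leftFactor h).1, ← tri_eq_mul, ← hT, tri_eq_mul h', Matrix.mul_assoc,
      ← Matrix.mul_assoc _ (leftFactor h').1, inv, Matrix.one_mul]
  -- Both choices belong to the same coset, so the translates of f(τ/l)/f(τ) agree. Comparing what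
  -- they say about f((aτ + b)/d) and its translate by `j` at one point determines the quotient of
  -- the character products without evaluating any symbol.
  have h2 := etaRatio_eq_of_decomposition hl (rightFactor_mem h) (rightFactor_mem h') h1 I
  have h3 := etaRatio_rightFactor_mul r ha hd h I
  have h4 := etaRatio_rightFactor_mul r ha hd h' I
  rw [h2, h3] at h4
  have him := tri_im_pos ha hd b I.im_pos
  have h5 : ((a : ℂ) * (I : ℍ) + ((b + j * d : ℤ) : ℂ)) / d = ((a : ℂ) * (I : ℍ) + b) / d + j := by
    have : (d : ℂ) ≠ 0 := by exact_mod_cast hd.ne'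
    push_cast
    field_simp
    ring
  rw [h5, etaQ_add_int r j him] at h4
  have h6 := etaQ_ne_zero r him
  have h7 : (((a : ℝ) ^ ((twoK r : ℝ) / 2) : ℝ) : ℂ) ≠ 0 := by
    have : (0 : ℝ) < (a : ℝ) ^ ((twoK r : ℝ) / 2) := Real.rpow_pos_of_pos (by exact_mod_cast ha) _
    exact_mod_cast this.ne'
  have hne : ∀ {a b c d : ℤ}, (level r : ℤ) ∣ c → a * d - b * c = 1 →
      etaChar r !![a, b; c, d] 1 ≠ 0 := by
    intro a b c d hc hdet H
    have := etaQ_mobius r hc hdet I.im_pos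
    rw [H, zero_mul, zero_mul] at this
    exact etaQ_ne_zero r (mobius_im_pos hdet I.im_pos) this
  have n1 := hne (⟨-d, by ring⟩ : (level r : ℤ) ∣ -(level r : ℤ) * d)
    (a := -(level r : ℤ) * b + a * x) (b := z) (d := y) (by linear_combination h)
  have n2 := hne (dvd_refl (level r : ℤ)) (a := a * y) (b := b * y - d * z) (d := x)
    (by linear_combination h)
  have n3 := hne (⟨-d, by ring⟩ : (level r : ℤ) ∣ -(level r : ℤ) * d)
    (a := -(level r : ℤ) * (b + j * d) + a * x') (b := z') (d := y') (by linear_combination h')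
  have n4 := hne (dvd_refl (level r : ℤ)) (a := a * y') (b := (b + j * d) * y' - d * z') (d := x')
    (by linear_combination h')
  unfold chiProd
  field_simp at h4
  linear_combination h4

lemma isCoprime_choice {N a : ℕ} {b : ℤ} {d : ℕ} {x y z : ℤ}
    (h : (-(N : ℤ) * b + a * x) * y + N * d * z = 1) :
    IsCoprime y (N * d) ∧ IsCoprime x N ∧ (N : ℤ) ∣ a * x * y - 1 :=
  ⟨⟨-(N : ℤ) * b + a * x, z, by linear_combination h⟩, ⟨a * y, d * z - b * y, by linear_combination h⟩,
    ⟨b * y - d * z, by linear_combination h⟩⟩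

/-- Divisors of perfect squares: if `ad` is a square then `d = gcd(a,d) β²`. -/
lemma exists_eq_gcd_mul_sq {a d : ℕ} (ha : 0 < a) (h : IsSquare (a * d)) :
    ∃ β, d = Nat.gcd a d * β ^ 2 := by
  obtain ⟨g, α, β, hg, hcop, rfl, rfl⟩ := Nat.exists_coprime' (m := a) (n := d)
    (Nat.gcd_pos_of_pos_left _ ha)
  have hgcd : Nat.gcd (α * g) (β * g) = g := by
    rw [Nat.gcd_mul_right, hcop, one_mul]
  have h2 : IsSquare (α * β) := by
    obtain ⟨s, hs⟩ := h
    have h3 : g ^ 2 ∣ s ^ 2 := ⟨α * β, by rw [sq s, ← hs]; ring⟩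
    obtain ⟨t, rfl⟩ := (Nat.pow_dvd_pow_iff two_ne_zero).mp h3
    refine ⟨t, ?_⟩
    have : (g * g) * (α * β) = (g * g) * (t * t) := by linear_combination hs
    exact Nat.eq_of_mul_eq_mul_left (Nat.mul_pos hg hg) this
  obtain ⟨u, hu⟩ := h2
  obtain ⟨v, hv⟩ := exists_eq_pow_of_mul_eq_pow (k := 2) (a := β) (b := α) (c := u)
    (Nat.isUnit_iff.mpr hcop.symm) (by rw [mul_comm, hu, sq])
  exact ⟨v, by rw [hgcd, hv]; ring⟩

/-- For even `twoK r` both sides are 1. Otherwise ad is a square, so d is g = gcd(a, d) times a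
square; as y ≡ 1 modulo 8, (-d/y) = (g/y) = (y/g), and modulo g the defining equation of x, y, z
reads -Nb·y ≡ 1. -/
lemma jacobi_neg_d_zpow {r : ℕ+ →₀ ℤ} {a d : ℕ} {b z : ℤ} {x y : ℕ} (ha : 0 < a) (hodd : Odd a)
    (hl : a * d ∈ Lf r) (h : (-(level r : ℤ) * b + a * x) * y + level r * d * z = 1)
    (hy : (8 : ℤ) ∣ y - 1) :
    ((J(-(d : ℤ) | y) : ℤ) : ℂ) ^ twoK r =
      ((J(-(level r : ℤ) * b | Nat.gcd a d) : ℤ) : ℂ) ^ twoK r := by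
  have hyd : IsCoprime (d : ℤ) y := (isCoprime_choice h).1.of_mul_right_right.symm
  have hyodd : Odd y := by rw [Nat.odd_iff]; omega
  set g := Nat.gcd a d with hg
  have hgodd : Odd g := by
    obtain ⟨t, ht⟩ := Nat.gcd_dvd_left a d
    rw [ht] at hodd
    exact (Nat.odd_mul.mp hodd).1
  obtain ⟨α, hα⟩ : (g : ℤ) ∣ a := Int.natCast_dvd_natCast.mpr (Nat.gcd_dvd_left a d)
  obtain ⟨β, hβ⟩ : (g : ℤ) ∣ d := Int.natCast_dvd_natCast.mpr (Nat.gcd_dvd_right a d)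
  have hbg : IsCoprime (-(level r : ℤ) * b) g :=
    ⟨y, α * x * y + level r * β * z, by
      linear_combination h - (x * y : ℤ) * hα - level r * z * hβ⟩
  rcases Int.even_or_odd (twoK r) with hw | hw
  · rw [jacobi_zpow_even (Int.isCoprime_iff_gcd_eq_one.mp hyd.neg_left) hw,
      jacobi_zpow_even (Int.isCoprime_iff_gcd_eq_one.mp hbg) hw]
  · congr 2
    obtain ⟨β₀, hβ₀⟩ := exists_eq_gcd_mul_sq ha (hl.2.2 hw)
    rw [← hg] at hβ₀
    have h1 : J(-1 | y) = 1 := by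
      rw [jacobiSym.at_neg_one hyodd]
      exact ZMod.χ₄_nat_one_mod_four (by omega)
    have h2 : J((β₀ : ℤ) | y) ^ 2 = 1 := by
      refine jacobiSym.sq_one (Int.isCoprime_iff_gcd_eq_one.mp ?_)
      rw [hβ₀] at hyd
      push_cast at hyd
      exact hyd.of_mul_left_right.of_isCoprime_of_dvd_left (dvd_pow_self _ two_ne_zero)
    have h3 : J(-(d : ℤ) | y) = J((g : ℤ) | y) := by
      rw [neg_eq_neg_one_mul, jacobiSym.mul_left, h1, one_mul, hβ₀]
      push_cast
      rw [jacobiSym.mul_left, jacobiSym.pow_left, h2, mul_one]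
    have h4 : J((g : ℤ) | y) = J((y : ℤ) | g) :=
      jacobiSym.quadratic_reciprocity_one_mod_four' hgodd (by omega)
    have h5 : J((-(level r : ℤ) * b) * y | g) = 1 := by
      have : J((-(level r : ℤ) * b) * y | g) = J(1 | g) := by
        refine jacobiSym.mod_left' (Int.ModEq.symm (Int.modEq_iff_dvd.mpr
          ⟨-(α * x * y + level r * β * z), ?_⟩))
        linear_combination h - (x * y : ℤ) * hα - level r * z * hβ
      rw [this, jacobiSym.one_left]
    rw [jacobiSym.mul_left] at h5
    rw [h3, h4]
    rcases jacobi_natCast_ne hbg with h6 | h6 <;> rw [h6] at h5 ⊢ <;> linarith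

/-- The part of the exponent modulo `3`. -/
lemma three_dvd_exponent {r : ℕ+ →₀ ℤ} {a d : ℕ} {b x y z : ℤ} (hl : a * d ∈ Lf r)
    (h3 : (3 : ℤ) ∣ a ∨ ((3 : ℤ) ∣ -(level r : ℤ) * b + a * x - 1 ∧ (3 : ℤ) ∣ y - 1 ∧ (3 : ℤ) ∣ z)) :
    (3 : ℤ) ∣ (((-(level r : ℤ) * b + a * x - 2 * y) * -d - level r * z * y * d ^ 2) * xOne r
      + z * y * xN r + (((a * y - 2 * x) * 1 - level r * (b * y - d * z) * x * 1 ^ 2) * xOne r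
      + (b * y - d * z) * x * xN r)) - b * d * xN r := by
  obtain ⟨h1, h2⟩ := twentyFour_dvd_of_mem_Lf hl
  have h1' : (3 : ℤ) ∣ ((a * d : ℕ) - 1) * xOne r := (by norm_num : (3 : ℤ) ∣ 24).trans h1
  have h2' : (3 : ℤ) ∣ ((a * d : ℕ) - 1) * xN r := (by norm_num : (3 : ℤ) ∣ 24).trans h2
  obtain ⟨u, hu⟩ := h1'
  obtain ⟨v, hv⟩ := h2'
  push_cast at hu hv
  rcases h3 with ⟨c, hc⟩ | ⟨⟨p, hp⟩, ⟨q, hq⟩, ⟨s, hs⟩⟩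
  -- If 3 divides a, then l - 1 is a unit modulo 3, so both sums vanish modulo 3 and every term of
  -- the exponent does.
  · have e1 : (3 : ℤ) ∣ xOne r := ⟨c * d * xOne r - u, by rw [hc] at hu; linear_combination -hu⟩
    have e2 : (3 : ℤ) ∣ xN r := ⟨c * d * xN r - v, by rw [hc] at hv; linear_combination -hv⟩
    exact dvd_sub (dvd_add (dvd_add (e1.mul_left _) (e2.mul_left _))
      (dvd_add (e1.mul_left _) (e2.mul_left _))) (e2.mul_left _)
  · obtain ⟨t, ht⟩ := three_dvd_level_mul r
    have ha3 : ∃ c : ℤ, (a : ℤ) ^ 3 = a + 3 * c := by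
      have : (a : ℤ) % 3 = 0 ∨ (a : ℤ) % 3 = 1 ∨ (a : ℤ) % 3 = 2 := by omega
      have h : ((a : ℤ) ^ 3 - a) % 3 = 0 := by
        rcases this with h | h | h <;> simp [pow_succ, Int.mul_emod, Int.sub_emod, h]
      exact ⟨((a : ℤ) ^ 3 - a) / 3, by omega⟩
    obtain ⟨c, hc⟩ := ha3
    have key : ((-(level r : ℤ) * b + a * x - 2 * y) * -d - level r * z * y * d ^ 2) * xOne r
      + z * y * xN r + (((a * y - 2 * x) * 1 - level r * (b * y - d * z) * x * 1 ^ 2) * xOne r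
      + (b * y - d * z) * x * xN r) - b * d * xN r ≡ 0 [ZMOD 3] := by
      have hy : y ≡ 1 [ZMOD 3] := (Int.modEq_iff_dvd.mpr ⟨q, hq⟩).symm
      have hz : z ≡ 0 [ZMOD 3] := (Int.modEq_iff_dvd.mpr ⟨s, by rw [hs]; ring⟩).symm
      have hA : -(level r : ℤ) * b + a * x ≡ 1 [ZMOD 3] := (Int.modEq_iff_dvd.mpr ⟨p, hp⟩).symm
      have hX1 : (a : ℤ) * d * xOne r ≡ xOne r [ZMOD 3] :=
        (Int.modEq_iff_dvd.mpr ⟨u, by linear_combination hu⟩).symm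
      have hXN : (a : ℤ) * d * xN r ≡ xN r [ZMOD 3] :=
        (Int.modEq_iff_dvd.mpr ⟨v, by linear_combination hv⟩).symm
      have hR : (level r : ℤ) * (xN r - level r * xOne r) ≡ 0 [ZMOD 3] :=
        (Int.modEq_iff_dvd.mpr ⟨t, by linear_combination ht⟩).symm
      have ha : (a : ℤ) ^ 3 ≡ a [ZMOD 3] :=
        (Int.modEq_iff_dvd.mpr ⟨c, by linear_combination hc⟩).symm
      have h30 : (3 : ℤ) ≡ 0 [ZMOD 3] := by decide
      have cast {m n : ℤ} : m ≡ n [ZMOD 3] ↔ (m : ZMod 3) = n := (ZMod.intCast_eq_intCast_iff _ _ 3).symm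
      rw [cast] at hy hz hA hX1 hXN hR ha h30 ⊢
      push_cast at hy hz hA hX1 hXN hR ha h30 ⊢
      rw [hy, hz, hA]
      generalize (a : ZMod 3) = a', (d : ZMod 3) = d', (b : ZMod 3) = b', (x : ZMod 3) = x',
        (level r : ZMod 3) = N, (xOne r : ZMod 3) = X, (xN r : ZMod 3) = Y at *
      -- Since ad acts as 1 on both sums modulo 3 and a³ = a, a² also acts as 1; hence d may be
      -- replaced by a, and x by a(1 + Nb).
      have k1 : a' ^ 2 * X = X := by linear_combination (1 - a' ^ 2) * hX1 + d' * X * ha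
      have k2 : a' ^ 2 * Y = Y := by linear_combination (1 - a' ^ 2) * hXN + d' * Y * ha
      have k3 : d' * X = a' * X := by linear_combination a' * hX1 - d' * k1
      have k4 : d' * Y = a' * Y := by linear_combination a' * hXN - d' * k2
      have k5 : x' * X = a' * (1 + N * b') * X := by linear_combination -x' * k1 + a' * X * hA
      have k6 : x' * Y = a' * (1 + N * b') * Y := by linear_combination -x' * k2 + a' * Y * hA
      linear_combination k3 + (-2 - N * b') * k5 + b' * k6 - b' * k4 + a' * b' ^ 2 * hR
        - N * b' * a' * X * h30
    exact (Int.modEq_zero_iff_dvd).mp key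

end

end EtaQuot

/-! ### Evaluation of the coefficients for odd `l` -/

namespace EtaQuot

noncomputable section

open scoped NumberTheorySymbols
open UpperHalfPlane

lemma zeta_mul_int (m n : ℤ) : zeta (m : ℚ) * zeta (n : ℚ) = zeta ((m + n : ℤ) : ℚ) := by
  rw [← zeta_add]; push_cast; rfl

lemma chi_eight_of_dvd {x y : ℤ} (h : (8 : ℤ) ∣ x - y) :
    ZMod.χ₈ (x : ZMod 8) = ZMod.χ₈ (y : ZMod 8) := by
  have : (x : ZMod 8) = y := (ZMod.intCast_eq_intCast_iff_dvd_sub _ _ 8).mpr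
    (by rw [← dvd_neg, neg_sub]; exact_mod_cast h)
  rw [this]

lemma etaChar_left_factor {r : ℕ+ →₀ ℤ} {a d y : ℕ} {b x z : ℤ} (hy : Odd y)
    (h : (-(level r : ℤ) * b + a * x) * y + level r * d * z = 1) :
    etaChar r !![-(level r : ℤ) * b + a * x, z; -(level r : ℤ) * d, (y : ℤ)] 1 =
      ((J(-(d : ℤ) | y) : ℤ) : ℂ) ^ twoK r * ((J(bigPi r | y) : ℤ) : ℂ) *
      zeta ((((-(level r : ℤ) * b + a * x - 2 * y) * -d - level r * z * y * d ^ 2) * xOne r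
        + z * y * xN r + 3 * (y - 1) * twoK r : ℤ) : ℚ) := by
  have := etaChar_odd_right r (a := -(level r : ℤ) * b + a * x) (b := z) (t := -(d : ℤ))
    (d := (y : ℤ)) (by exact_mod_cast hy.pos) (by exact_mod_cast hy) (by linear_combination h)
  rw [show -(level r : ℤ) * d = level r * -(d : ℤ) by ring, this, Int.natAbs_natCast]
  congr 3
  ring

lemma chiProd_eq_of_odd {r : ℕ+ →₀ ℤ} {a d x y : ℕ} {b z : ℤ} (hx : Odd x) (hy : Odd y)
    (h : (-(level r : ℤ) * b + a * x) * y + level r * d * z = 1) :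
    chiProd r a b d x y z =
      ((J(-(d : ℤ) | y) : ℤ) : ℂ) ^ twoK r * ((J(bigPi r | y) : ℤ) : ℂ) *
      ((J(bigPi r | x) : ℤ) : ℂ) *
      zeta (((((-(level r : ℤ) * b + a * x - 2 * y) * -d - level r * z * y * d ^ 2) * xOne r
        + z * y * xN r + (((a * y - 2 * x) * 1 - level r * (b * y - d * z) * x * 1 ^ 2) * xOne r
        + (b * y - d * z) * x * xN r)) + 3 * (y - 1) * twoK r + 3 * (x - 1) * twoK r : ℤ) : ℚ) := by
  have h2 := etaChar_odd_right r (a := a * y) (b := b * y - d * z) (t := 1) (d := (x : ℤ))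
    (by exact_mod_cast hx.pos) (by exact_mod_cast hx) (by linear_combination h)
  rw [mul_one] at h2
  rw [chiProd, etaChar_left_factor hy h, h2, Int.natAbs_natCast, jacobiSym.one_left, Int.cast_one,
    one_zpow, one_mul]
  rw [mul_mul_mul_comm, zeta_mul_int]
  congr 3
  ring

lemma jacobi_bigPi_eq {r : ℕ+ →₀ ℤ} {x : ℕ} (hx : Odd x) :
    ((J(bigPi r | x) : ℤ) : ℂ) = ((ZMod.χ₈ ((x : ℤ) : ZMod 8) ^ twoPi r * J(x | oddPi r) : ℤ) : ℂ) *
      zeta ((6 * dlt r * (x - 1) : ℤ) : ℚ) := by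
  rw [jacobi_bigPi r hx, Int.cast_mul, jacobi_oddPi_reciprocity r hx]
  push_cast
  ring

/-- The value of `chiProd` when `a` and `x` are odd and the remaining entries are normalized. -/
lemma chiProd_normalized {r : ℕ+ →₀ ℤ} {a d x y : ℕ} {b z : ℤ} (ha : 0 < a) (hodd : Odd a)
    (hl : a * d ∈ Lf r) (hx : Odd x)
    (h : (-(level r : ℤ) * b + a * x) * y + level r * d * z = 1)
    (hA : (8 : ℤ) ∣ -(level r : ℤ) * b + a * x - 1) (hy : (8 : ℤ) ∣ y - 1) (hz : (8 : ℤ) ∣ z)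
    (h3 : (3 : ℤ) ∣ a ∨
      ((3 : ℤ) ∣ -(level r : ℤ) * b + a * x - 1 ∧ (3 : ℤ) ∣ y - 1 ∧ (3 : ℤ) ∣ z))
    (h8 : (8 : ℤ) ∣ (d + a - 2 * x - level r * b * x) * xOne r + b * x * xN r - b * d * xN r) :
    chiProd r a b d x y z =
      ((J(-(level r : ℤ) * b | Nat.gcd a d) : ℤ) : ℂ) ^ twoK r *
      ((ZMod.χ₈ ((x : ℤ) : ZMod 8) ^ twoPi r * J(a | oddPi r) : ℤ) : ℂ) *
      zeta ((b * d * xN r + 3 * (twoK r + 2 * dlt r) * (x - 1) : ℤ) : ℚ) := by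
  have hyodd : Odd y := by rw [Nat.odd_iff]; omega
  have e3 := three_dvd_exponent hl h3
  have e8 : (8 : ℤ) ∣ (((-(level r : ℤ) * b + a * x - 2 * y) * -d - level r * z * y * d ^ 2) * xOne r
      + z * y * xN r + (((a * y - 2 * x) * 1 - level r * (b * y - d * z) * x * 1 ^ 2) * xOne r
      + (b * y - d * z) * x * xN r)) - b * d * xN r := by
    obtain ⟨p, hp⟩ := hA
    obtain ⟨q, hq⟩ := hy
    obtain ⟨s, rfl⟩ := hz
    obtain ⟨t, ht⟩ := h8
    have hp' : -(level r : ℤ) * b + a * x = 1 + 8 * p := by linear_combination hp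
    have hq' : (y : ℤ) = 1 + 8 * q := by linear_combination hq
    rw [hp', hq']
    refine ⟨t + ((p - 2 * q) * -d - level r * s * (1 + 8 * q) * d ^ 2) * xOne r
      + s * (1 + 8 * q) * xN r + (a * q - level r * (b * q - d * s) * x) * xOne r
      + (b * q - d * s) * x * xN r, ?_⟩
    linear_combination ht
  have hP := jacobi_mul_oddPi (isCoprime_choice h).2.2
  rw [chiProd_eq_of_odd hx hyodd h, jacobi_neg_d_zpow ha hodd hl h hy, jacobi_bigPi_eq hx,
    jacobi_bigPi_eq hyodd, ← hP, chi_eight_of_dvd (y := 1) hy, Int.cast_one, map_one, one_pow, one_mul]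
  have key : zeta ((b * d * xN r + 3 * (twoK r + 2 * dlt r) * (x - 1) : ℤ) : ℚ) =
      zeta ((6 * dlt r * (y - 1) : ℤ) : ℚ) * zeta ((6 * dlt r * (x - 1) : ℤ) : ℚ) *
      zeta (((((-(level r : ℤ) * b + a * x - 2 * y) * -d - level r * z * y * d ^ 2) * xOne r
        + z * y * xN r + (((a * y - 2 * x) * 1 - level r * (b * y - d * z) * x * 1 ^ 2) * xOne r
        + (b * y - d * z) * x * xN r)) + 3 * (y - 1) * twoK r + 3 * (x - 1) * twoK r : ℤ) : ℚ) := by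
    rw [zeta_mul_int, zeta_mul_int]
    refine zeta_eq_of_dvd ?_
    obtain ⟨q, hq⟩ := hy
    have e24 := IsCoprime.mul_dvd (by norm_num : IsCoprime (3 : ℤ) 8) e3 e8
    obtain ⟨u, hu⟩ := e24
    refine ⟨-u - q * (2 * dlt r + twoK r), ?_⟩
    linear_combination -hu - (6 * dlt r + 3 * twoK r) * hq
  rw [key]
  push_cast
  ring

lemma Lf_odd_twoK_modEq {r : ℕ+ →₀ ℤ} {l : ℕ} (hl : l ∈ Lf r) (hw : Odd (twoK r)) (hodd : Odd l) :
    (8 : ℤ) ∣ l - 1 := by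
  obtain ⟨s, rfl⟩ := hl.2.2 hw
  have hs : Odd s := (Nat.odd_mul.mp hodd).1
  have h8 : (8 : ℤ) ∣ (s : ℤ) ^ 2 - 1 := Int.eight_dvd_sq_sub_one_of_odd (by exact_mod_cast hs)
  push_cast
  rwa [← sq]

lemma eight_dvd_of_odd {a : ℤ} (ha : Odd a) : (8 : ℤ) ∣ a ^ 2 - 1 :=
  Int.eight_dvd_sq_sub_one_of_odd ha

/-- Congruences modulo 3 can be imposed only if 3 does not divide a, because the modulus must be
prime to a; the alternative matches the two cases of `three_dvd_exponent`. -/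
lemma exists_normalized_choice {N a : ℕ} {b : ℤ} {d : ℕ} (h : IsHeckeTriple N a b d) (hN : 0 < N)
    {q : ℤ} (hq : 0 < q) (hqa : IsCoprime q a) :
    ∃ (x y : ℕ) (z : ℤ), 0 < x ∧ 0 < y ∧ (-(N : ℤ) * b + a * x) * y + N * d * z = 1 ∧
      q ∣ -(N : ℤ) * b + a * x - 1 ∧ q ∣ y - 1 ∧ q ∣ z ∧
      ((3 : ℤ) ∣ a ∨ ((3 : ℤ) ∣ -(N : ℤ) * b + a * x - 1 ∧ (3 : ℤ) ∣ y - 1 ∧ (3 : ℤ) ∣ z)) := by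
  by_cases h3 : (3 : ℤ) ∣ a
  · obtain ⟨x, y, z, hx, hy, h1, h2, h4, h5⟩ := h.exists_choice hN hq hqa
    lift x to ℕ using hx.le
    lift y to ℕ using hy.le
    exact ⟨x, y, z, by exact_mod_cast hx, by exact_mod_cast hy, h1, h2, h4, h5, Or.inl h3⟩
  · have h3' : IsCoprime (3 : ℤ) a := (Int.prime_three.coprime_iff_not_dvd).mpr h3
    obtain ⟨x, y, z, hx, hy, h1, h2, h4, h5⟩ := h.exists_choice hN (q := 3 * q) (by positivity)
      (h3'.mul_left hqa)
    lift x to ℕ using hx.le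
    lift y to ℕ using hy.le
    have d1 : (3 : ℤ) ∣ 3 * q := dvd_mul_right _ _
    have d2 : q ∣ 3 * q := dvd_mul_left _ _
    exact ⟨x, y, z, by exact_mod_cast hx, by exact_mod_cast hy, h1, d2.trans h2, d2.trans h4,
      d2.trans h5, Or.inr ⟨d1.trans h2, d1.trans h4, d1.trans h5⟩⟩

lemma isCoprime_eight {a : ℕ} (ha : Odd a) : IsCoprime (8 : ℤ) a := by
  have := Nat.isCoprime_iff_coprime.mpr ((Nat.coprime_two_left.mpr ha).pow_left 3)
  exact_mod_cast this

/-- The exponent comparison for odd `l`. -/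
lemma eight_dvd_odd_case {r : ℕ+ →₀ ℤ} {a d : ℕ} (hl : a * d ∈ Lf r) (hodd : Odd (a * d)) :
    (8 : ℤ) ∣ (twoK r + 2 * dlt r) * (a - d + (a * d - 1) * (level r - 1)) := by
  obtain ⟨ha, hd⟩ := Nat.odd_mul.mp hodd
  obtain ⟨α, hα⟩ : Odd (a : ℤ) := by exact_mod_cast ha
  obtain ⟨β, hβ⟩ : Odd (d : ℤ) := by exact_mod_cast hd
  rcases Int.even_or_odd (twoK r) with ⟨u, hu⟩ | hw
  · have h4 : (4 : ℤ) ∣ (u + dlt r) * (a - d + (a * d - 1) * (level r - 1)) := by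
      rcases Nat.even_or_odd (level r) with hN | hN
      · obtain ⟨n, hn⟩ : Even (level r : ℤ) := by exact_mod_cast hN
        refine Dvd.dvd.mul_left ?_ _
        rw [hα, hβ, hn]
        refine ⟨α * (β + 1) + (2 * α * β + α + β) * (n - 1), ?_⟩
        ring
      -- If ad ≡ 3 modulo 4, then 8 ∣ (ad - 1)x_N gives 4 ∣ x_N, hence 4 ∣ `twoK r + 2 * dlt r`;
      -- each half of the product then contributes a factor 2.
      · by_cases hm : (4 : ℤ) ∣ a * d - 1
        · obtain ⟨t, ht⟩ := hm
          refine Dvd.dvd.mul_left ?_ _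
          rw [ht]
          refine dvd_add ?_ ⟨t * (level r - 1), by ring⟩
          rw [hα, hβ] at ht ⊢
          have : α + β = 2 * t - 2 * (α * β) := by linarith
          omega
        · have h24 := (twentyFour_dvd_of_mem_Lf hl).2
          push_cast at h24
          have hx : (4 : ℤ) ∣ xN r := by
            have h8 : (8 : ℤ) ∣ ((a : ℤ) * d - 1) * xN r := (by norm_num : (8 : ℤ) ∣ 24).trans h24
            have hm2 : ((a : ℤ) * d - 1) = 2 * (2 * α * β + α + β) := by rw [hα, hβ]; ring
            rw [hm2] at h8 hm
            have hcop : IsCoprime (4 : ℤ) (2 * α * β + α + β) := by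
              obtain ⟨k, hk⟩ : Odd (2 * α * β + α + β) := by
                rw [← Int.not_even_iff_odd]
                rintro ⟨t, ht⟩
                exact hm ⟨t, by rw [ht]; ring⟩
              rw [hk]
              exact ⟨-(k * (k + 1)), 2 * k + 1, by ring⟩
            refine hcop.dvd_of_dvd_mul_left ?_
            obtain ⟨t, ht⟩ := h8
            exact ⟨t, by linarith⟩
          have h1 := four_dvd_twoK_add hN hx
          obtain ⟨n, hn⟩ : Odd (level r : ℤ) := by exact_mod_cast hN
          have h2 : (2 : ℤ) ∣ u + dlt r := by omega
          have h3 : (2 : ℤ) ∣ (a : ℤ) - d + (a * d - 1) * (level r - 1) := by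
            rw [hα, hβ, hn]
            exact ⟨α - β + (2 * (2 * α * β + α + β)) * n, by ring⟩
          exact mul_dvd_mul h2 h3
    obtain ⟨t, ht⟩ := h4
    refine ⟨t, ?_⟩
    rw [hu]
    linear_combination 2 * ht
  · refine Dvd.dvd.mul_left ?_ _
    have h1 := Lf_odd_twoK_modEq hl hw hodd
    push_cast at h1
    refine dvd_add ?_ (h1.mul_right _)
    have h2 := eight_dvd_of_odd (a := (d : ℤ)) (by exact_mod_cast hd)
    have : (a : ℤ) - d = d * (a * d - 1) - a * (d ^ 2 - 1) := by ring
    rw [this]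
    exact dvd_sub (h1.mul_left _) (h2.mul_left _)

lemma twentyFour_dvd_mul_sq_sub_one {d : ℤ} (hd : Odd d) : (24 : ℤ) ∣ d * (d ^ 2 - 1) := by
  have h8 : (8 : ℤ) ∣ d * (d ^ 2 - 1) := (eight_dvd_of_odd hd).mul_left _
  have h3 : (3 : ℤ) ∣ d * (d ^ 2 - 1) := by
    have : d % 3 = 0 ∨ d % 3 = 1 ∨ d % 3 = 2 := by omega
    refine Int.dvd_of_emod_eq_zero ?_
    rcases this with h | h | h <;> simp [pow_succ, Int.mul_emod, Int.sub_emod, h]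
  exact IsCoprime.mul_dvd (by norm_num : IsCoprime (3 : ℤ) 8) h3 h8

/-- The value of `chiProd` for odd `l`. -/
lemma chiProd_of_odd {r : ℕ+ →₀ ℤ} {a d : ℕ} {b x y z : ℤ} (hT : IsHeckeTriple (level r) a b d)
    (hl : a * d ∈ Lf r) (hodd : Odd (a * d))
    (h : (-(level r : ℤ) * b + a * x) * y + level r * d * z = 1) :
    chiProd r a b d x y z =
      ((J(-(level r : ℤ) * b | Nat.gcd a d) : ℤ) : ℂ) ^ twoK r * (kronecker a (bigPi r) : ℂ) *
      zeta ((b * d * xN r + 3 * (twoK r + 2 * dlt r) * (d - 1)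
        - 3 * (twoK r + 2 * dlt r) * (a * d - 1) * (level r - 1) : ℤ) : ℚ) := by
  obtain ⟨ha, hd⟩ := Nat.odd_mul.mp hodd
  have ha' : Odd (a : ℤ) := by exact_mod_cast ha
  have hd' : Odd (d : ℤ) := by exact_mod_cast hd
  -- The translate b(1 - d²) of b is divisible by 8. For it the normalized x satisfies x ≡ a modulo
  -- 8, and `chiProd_shift` undoes the translation.
  have hT' : IsHeckeTriple (level r) a (b + -(b * d) * d) d :=
    ⟨hT.a_pos, hT.d_pos, hT.coprime, fun p hp h1 h2 h3 =>
      hT.primitive p hp h1 (by simpa using dvd_sub h2 (h3.mul_left (-(b * d)))) h3⟩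
  obtain ⟨x', y', z', hx, hy, h', hA, hy1, hz, h3⟩ :=
    exists_normalized_choice hT' (level_pos r) (q := 8) (by norm_num) (isCoprime_eight ha)
  have hb8 : (8 : ℤ) ∣ b + -(b * d) * d := by
    have := (eight_dvd_of_odd hd').mul_left (-b)
    rwa [show -b * ((d : ℤ) ^ 2 - 1) = b + -(b * d) * d by ring] at this
  have hxa : (8 : ℤ) ∣ x' - a := by
    have h1 := (eight_dvd_of_odd ha').mul_left (x' : ℤ)
    have h2 := (dvd_add hA (hb8.mul_left (level r : ℤ))).mul_left (a : ℤ)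
    have := dvd_sub h2 h1
    rwa [show (a : ℤ) * (-(level r : ℤ) * (b + -(b * d) * d) + a * x' - 1 +
      level r * (b + -(b * d) * d)) - x' * (a ^ 2 - 1) = x' - a by ring] at this
  have hx' : Odd x' := by
    rw [Nat.odd_iff] at ha ⊢
    omega
  have hX : (8 : ℤ) ∣ (a * d - 1) * xOne r := by
    have := (twentyFour_dvd_of_mem_Lf hl).1
    push_cast at this
    exact (by norm_num : (8 : ℤ) ∣ 24).trans this
  have h8 : (8 : ℤ) ∣ (d + a - 2 * x' - level r * (b + -(b * d) * d) * x') * xOne r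
      + (b + -(b * d) * d) * x' * xN r - (b + -(b * d) * d) * d * xN r := by
    obtain ⟨s, hs⟩ := hb8
    obtain ⟨t, ht⟩ := hxa
    obtain ⟨u, hu⟩ := hX
    obtain ⟨v, hv⟩ := eight_dvd_of_odd ha'
    rw [hs]
    refine ⟨-2 * t * xOne r - level r * s * x' * xOne r + s * x' * xN r - s * d * xN r
      + a * u - d * v * xOne r, ?_⟩
    linear_combination -2 * xOne r * ht + a * hu - d * xOne r * hv
  have key := chiProd_normalized hT.a_pos ha hl hx' h' hA hy1 hz h3 h8
  rw [chiProd_shift hT.a_pos hT.d_pos hl h h'] at key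
  have hJ : J(-(level r : ℤ) * (b + -(b * d) * d) | Nat.gcd a d) = J(-(level r : ℤ) * b | Nat.gcd a d) := by
    refine jacobiSym.mod_left' ?_
    obtain ⟨β, hβ⟩ : (Nat.gcd a d : ℤ) ∣ d := Int.natCast_dvd_natCast.mpr (Nat.gcd_dvd_right a d)
    refine (Int.modEq_iff_dvd.mpr ⟨-(level r * b * d * β), ?_⟩)
    linear_combination -(level r * b * d : ℤ) * hβ
  rw [hJ, chi_eight_of_dvd hxa, ← kronecker_bigPi] at key
  have h1 : chiProd r a b d x y z = chiProd r a b d x y z * zeta ((-(b * d) * xN r : ℤ) : ℚ) *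
      zeta ((b * d * xN r : ℤ) : ℚ) := by
    rw [mul_assoc, zeta_mul_int]
    simp [zeta_zero]
  rw [h1]
  push_cast at key ⊢
  rw [key, mul_assoc]
  congr 1
  have := zeta_mul_int ((b + -(b * d) * d) * d * xN r + 3 * (twoK r + 2 * dlt r) * (x' - 1))
    (b * d * xN r)
  have h2 : zeta (((b + -(b * d) * d) * d * xN r + 3 * (twoK r + 2 * dlt r) * (x' - 1) +
      b * d * xN r : ℤ) : ℚ) = zeta ((b * d * xN r + 3 * (twoK r + 2 * dlt r) * (d - 1)
        - 3 * (twoK r + 2 * dlt r) * (a * d - 1) * (level r - 1) : ℤ) : ℚ) := by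
    refine zeta_eq_of_dvd ?_
    obtain ⟨s, hs⟩ := eight_dvd_odd_case hl hodd
    obtain ⟨t, ht⟩ := hxa
    obtain ⟨u, hu⟩ := twentyFour_dvd_mul_sq_sub_one hd'
    refine ⟨-b * xN r * u + (twoK r + 2 * dlt r) * t + s, ?_⟩
    linear_combination -b * xN r * hu + 3 * (twoK r + 2 * dlt r) * ht + 3 * hs
  rw [h2] at this
  push_cast at this
  exact this

end

end EtaQuot

/-! ### Evaluation of the coefficients for even `l`, and the closed form -/

namespace EtaQuot

noncomputable section

open scoped NumberTheorySymbols
open UpperHalfPlane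

/-- Here l - 1 is odd, hence invertible modulo 8. So for even `l` the contributions of both sums to
the exponent vanish modulo 8. -/
lemma eight_dvd_of_even {r : ℕ+ →₀ ℤ} {l : ℕ} (hl : l ∈ Lf r) (h2 : Even l) :
    (8 : ℤ) ∣ xOne r ∧ (8 : ℤ) ∣ xN r := by
  obtain ⟨h1, h3⟩ := twentyFour_dvd_of_mem_Lf hl
  have hodd : Odd ((l : ℤ) - 1) := by
    have : Even (l : ℤ) := by exact_mod_cast h2
    exact this.sub_odd odd_one
  have hcop : IsCoprime (8 : ℤ) ((l : ℤ) - 1) := by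
    obtain ⟨c, hc⟩ := eight_dvd_of_odd hodd
    exact ⟨-c, (l : ℤ) - 1, by linear_combination hc⟩
  exact ⟨hcop.dvd_of_dvd_mul_left ((by norm_num : (8 : ℤ) ∣ 24).trans h1),
    hcop.dvd_of_dvd_mul_left ((by norm_num : (8 : ℤ) ∣ 24).trans h3)⟩

/-- `δ₁` as an integer, for even `l`. -/
def dltOne (r : ℕ+ →₀ ℤ) : ℤ := if 4 ∣ level r ∧ Odd (twoK r) ∧ Odd (twoPi r) then 1 else 0

lemma deltaOne_eq {r : ℕ+ →₀ ℤ} {l : ℕ} (hl : 2 ∣ l) : deltaOne r l = dltOne r := by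
  unfold deltaOne dltOne twoPi
  simp only [hl, true_and]
  split_ifs <;> simp

lemma zeta_twentyFour_mul (m : ℤ) : zeta ((24 * m : ℤ) : ℚ) = 1 := by
  rw [zeta_eq_of_dvd (y := 0) ⟨m, by ring⟩]
  simp [zeta_zero]

/-- The value of `χ₈(1 + Nb)^{v₂(Π)}` as a root of unity. -/
lemma chi_eight_level {r : ℕ+ →₀ ℤ} {l a : ℕ} (hl : l ∈ Lf r) (h2 : Even l) (ha : Odd a)
    (hN : Even (level r)) (b : ℤ) :
    ((ZMod.χ₈ ((1 + level r * b : ℤ) : ZMod 8) ^ twoPi r : ℤ) : ℂ) *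
      zeta ((3 * (twoK r + 2 * dlt r) * (level r * b * (a - 1 - dltOne r)) : ℤ) : ℚ) = 1 := by
  obtain ⟨h8X, h8N⟩ := eight_dvd_of_even hl h2
  have h2X : (2 : ℤ) ∣ xOne r := (by norm_num : (2 : ℤ) ∣ 8).trans h8X
  have h2N : (2 : ℤ) ∣ xN r := (by norm_num : (2 : ℤ) ∣ 8).trans h8N
  obtain ⟨α, hα⟩ : Odd (a : ℤ) := by exact_mod_cast ha
  -- For 8 ∣ N both factors are trivial. If 2 is the exact power of 2 in N, `twoK r` and v₂(Π) are
  -- both even. If it is 4, they have equal parity, and in the odd case `dltOne r = 1`: for odd b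
  -- both factors are -1, which is the purpose of δ₁.
  by_cases h8 : 8 ∣ level r
  · obtain ⟨n, hn⟩ : (8 : ℤ) ∣ level r := by exact_mod_cast h8
    have e1 : (8 : ℤ) ∣ (1 + level r * b) - 1 := ⟨n * b, by rw [hn]; ring⟩
    rw [chi_eight_of_dvd e1, Int.cast_one, map_one, one_pow, Int.cast_one, one_mul]
    have := zeta_twentyFour_mul ((twoK r + 2 * dlt r) * (n * b * (a - 1 - dltOne r)))
    rw [← this, hn]
    congr 2
    ring
  by_cases h4 : 4 ∣ level r
  · have hvw := even_of_level_four h4 h8 h2X h2N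
    obtain ⟨m, hm⟩ : ∃ m : ℤ, (level r : ℤ) = 4 * (2 * m + 1) := ⟨(level r : ℤ) / 8, by omega⟩
    rcases Int.even_or_odd (twoK r) with ⟨u, hu⟩ | hw
    · have hv : Even (twoPi r) := by
        rw [even_iff_two_dvd]; omega
      have hne : ZMod.χ₈ ((1 + level r * b : ℤ) : ZMod 8) ^ twoPi r = 1 := by
        obtain ⟨t, ht⟩ := hv
        rw [ht, ← two_mul, pow_mul, ← map_pow]
        have hodd : Odd (1 + level r * b) := by rw [hm]; exact ⟨2 * (2 * m + 1) * b, by ring⟩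
        have := chi_eight_of_dvd (eight_dvd_of_odd hodd)
        push_cast at this ⊢
        rw [this, map_one, one_pow]
      rw [hne, Int.cast_one, one_mul]
      have := zeta_twentyFour_mul ((u + dlt r) * ((2 * m + 1) * b * (a - 1 - dltOne r)))
      rw [← this, hm, hu]
      congr 2
      ring
    · have hv : Odd (twoPi r) := by
        rw [Nat.odd_iff]
        obtain ⟨t, ht⟩ := hw
        omega
      have hd1 : dltOne r = 1 := if_pos ⟨h4, hw, hv⟩
      have e1 : ZMod.χ₈ ((1 + level r * b : ℤ) : ZMod 8) = if Even b then 1 else -1 := by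
        rw [hm]
        split_ifs with hb
        · obtain ⟨t, ht⟩ := hb
          have : (8 : ℤ) ∣ (1 + 4 * (2 * m + 1) * b) - 1 := ⟨(2 * m + 1) * t, by rw [ht]; ring⟩
          rw [chi_eight_of_dvd this, Int.cast_one, map_one]
        · obtain ⟨t, ht⟩ := Int.not_even_iff_odd.mp hb
          have : (8 : ℤ) ∣ (1 + 4 * (2 * m + 1) * b) - 5 := ⟨2 * m * t + m + t, by rw [ht]; ring⟩
          rw [chi_eight_of_dvd this]
          decide
      obtain ⟨u, hu⟩ := hw
      rw [e1, hd1]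
      split_ifs with hb
      · obtain ⟨t, ht⟩ := hb
        rw [one_pow, Int.cast_one, one_mul]
        have := zeta_twentyFour_mul ((twoK r + 2 * dlt r) * ((2 * m + 1) * t * (a - 2)))
        rw [← this, hm, ht]
        congr 2
        ring
      · obtain ⟨t, ht⟩ := Int.not_even_iff_odd.mp hb
        rw [hv.neg_one_pow]
        have : zeta ((3 * (twoK r + 2 * dlt r) * (level r * b * (a - 1 - 1)) : ℤ) : ℚ) =
            zeta ((12 : ℤ) : ℚ) := by
          refine zeta_eq_of_dvd ?_
          rw [hu, hm, ht, hα]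
          have hodd : Odd ((2 * u + 1 + 2 * dlt r) * ((2 * m + 1) * (2 * t + 1) * (2 * α + 1 - 1 - 1))) := by
            refine Odd.mul ⟨u + dlt r, by ring⟩ (Odd.mul (Odd.mul ⟨m, rfl⟩ ⟨t, rfl⟩) ⟨α - 1, by ring⟩)
          obtain ⟨c, hc⟩ := hodd
          exact ⟨c, by linear_combination 12 * hc⟩
        rw [this]
        have h12 : zeta ((12 : ℤ) : ℚ) = -1 := by exact_mod_cast zeta_twelve
        rw [h12]
        simp
  · obtain ⟨⟨u, hu⟩, ⟨v, hv⟩⟩ := even_of_level_two (even_iff_two_dvd.mp hN) h4 h2X h2N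
    obtain ⟨m, hm⟩ : Even (level r : ℤ) := by exact_mod_cast hN
    have hd1 : dltOne r = 0 := if_neg fun h => h4 h.1
    have hne : ZMod.χ₈ ((1 + level r * b : ℤ) : ZMod 8) ^ twoPi r = 1 := by
      rw [hv, ← two_mul, pow_mul, ← map_pow]
      have hodd : Odd (1 + level r * b) := by rw [hm]; exact ⟨m * b, by ring⟩
      have := chi_eight_of_dvd (eight_dvd_of_odd hodd)
      push_cast at this ⊢
      rw [this, map_one, one_pow]
    rw [hne, Int.cast_one, one_mul, hd1]
    have := zeta_twentyFour_mul ((u + dlt r) * (m * b * α))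
    rw [← this, hm, hu, hα]
    congr 2
    ring

/-- The value of `chiProd` for even `l` and even `N`. -/
lemma chiProd_of_even_of_even {r : ℕ+ →₀ ℤ} {a d : ℕ} {b x y z : ℤ}
    (hT : IsHeckeTriple (level r) a b d) (hl : a * d ∈ Lf r) (h2 : Even (a * d))
    (hN : Even (level r)) (h : (-(level r : ℤ) * b + a * x) * y + level r * d * z = 1) :
    chiProd r a b d x y z =
      ((J(-(level r : ℤ) * b | Nat.gcd a d) : ℤ) : ℂ) ^ twoK r * (kronecker a (bigPi r) : ℂ) *
      zeta ((b * d * xN r + 3 * (twoK r + 2 * dlt r) * (a - 1)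
        + 3 * level r * (twoK r + 2 * dlt r) * (1 + dltOne r) * b : ℤ) : ℚ) := by
  have ha : Odd a := by
    rw [← Nat.not_even_iff_odd]
    intro ha
    have := Nat.dvd_gcd (even_iff_two_dvd.mp hN) (even_iff_two_dvd.mp ha)
    rw [hT.coprime] at this
    omega
  have ha' : Odd (a : ℤ) := by exact_mod_cast ha
  obtain ⟨x', y', z', hx, hy, h', hA, hy1, hz, h3⟩ :=
    exists_normalized_choice hT (level_pos r) (q := 8) (by norm_num) (isCoprime_eight ha)
  -- From -Nb + ax ≡ 1 and a² ≡ 1 modulo 8.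
  have hxa : (8 : ℤ) ∣ x' - a * (1 + level r * b) := by
    have := dvd_sub (hA.mul_left (a : ℤ)) ((eight_dvd_of_odd ha').mul_left (x' : ℤ))
    rwa [show (a : ℤ) * (-(level r : ℤ) * b + a * x' - 1) - x' * (a ^ 2 - 1) =
      x' - a * (1 + level r * b) by ring] at this
  have hx' : Odd x' := by
    have h1 : Odd ((a : ℤ) * (1 + level r * b)) := by
      refine ha'.mul (odd_one.add_even (Even.mul_right ?_ _))
      exact_mod_cast hN
    have h4 : Even ((x' : ℤ) - a * (1 + level r * b)) :=
      even_iff_two_dvd.mpr ((by norm_num : (2 : ℤ) ∣ 8).trans hxa)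
    have := h4.add_odd h1
    rw [sub_add_cancel] at this
    exact_mod_cast this
  obtain ⟨h8X, h8N⟩ := eight_dvd_of_even hl h2
  have key := chiProd_normalized hT.a_pos ha hl hx' h' hA hy1 hz h3
    (dvd_sub (dvd_add (h8X.mul_left _) (h8N.mul_left _)) (h8N.mul_left _))
  have shift := chiProd_shift hT.a_pos hT.d_pos hl h' (j := 0) (x' := x) (y' := y) (z' := z)
    (by simpa using h)
  simp only [zero_mul, add_zero, Int.cast_zero, zeta_zero, mul_one] at shift
  rw [shift, key, chi_eight_of_dvd hxa, kronecker_bigPi]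
  have hc := chi_eight_level hl h2 ha hN b
  have e1 : zeta ((b * d * xN r + 3 * (twoK r + 2 * dlt r) * (x' - 1) : ℤ) : ℚ) =
      zeta ((b * d * xN r + 3 * (twoK r + 2 * dlt r) * (a - 1)
        + 3 * level r * (twoK r + 2 * dlt r) * (1 + dltOne r) * b : ℤ) : ℚ) *
      zeta ((3 * (twoK r + 2 * dlt r) * (level r * b * (a - 1 - dltOne r)) : ℤ) : ℚ) := by
    rw [zeta_mul_int]
    refine zeta_eq_of_dvd ?_
    obtain ⟨t, ht⟩ := hxa
    exact ⟨(twoK r + 2 * dlt r) * t, by linear_combination 3 * (twoK r + 2 * dlt r) * ht⟩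
  rw [e1]
  push_cast at hc ⊢
  rw [map_mul]
  push_cast
  linear_combination ((J(-(level r : ℤ) * b | Nat.gcd a d) : ℤ) : ℂ) ^ twoK r *
    (((ZMod.χ₈ (a : ZMod 8) : ℤ) : ℂ) ^ twoPi r * ((J(a | oddPi r) : ℤ) : ℂ)) *
    zeta ((b * d * xN r + 3 * (twoK r + 2 * dlt r) * (a - 1)
        + 3 * level r * (twoK r + 2 * dlt r) * (1 + dltOne r) * b)) * hc

/-- The value of `chiProd` for even `l` and odd `N`. -/
lemma chiProd_of_even_of_odd {r : ℕ+ →₀ ℤ} {a d : ℕ} {b x y z : ℤ}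
    (hT : IsHeckeTriple (level r) a b d) (hl : a * d ∈ Lf r) (h2 : Even (a * d))
    (hN : Odd (level r)) (h : (-(level r : ℤ) * b + a * x) * y + level r * d * z = 1) :
    Even (twoK r) ∧
    chiProd r a b d x y z = (kronecker a (bigPi r) : ℂ) * zeta ((b * d * xN r : ℤ) : ℚ) := by
  obtain ⟨h8X, h8N⟩ := eight_dvd_of_even hl h2
  have hw4 := four_dvd_twoK_add hN ((by norm_num : (4 : ℤ) ∣ 8).trans h8N)
  have hw : Even (twoK r) := by rw [even_iff_two_dvd]; omega
  refine ⟨hw, ?_⟩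
  -- Now a may be even, so no congruence modulo 8 is available. An odd y suffices, since the right
  -- factor has the odd lower left entry N. If y is even, then d is odd, and adding 3Nd to y makes
  -- it odd without changing it modulo 3.
  obtain ⟨x', y', z', hy', h', h3⟩ : ∃ (x' : ℤ) (y' : ℕ) (z' : ℤ), Odd y' ∧
      (-(level r : ℤ) * b + a * x') * y' + level r * d * z' = 1 ∧
      ((3 : ℤ) ∣ a ∨ ((3 : ℤ) ∣ -(level r : ℤ) * b + a * x' - 1 ∧ (3 : ℤ) ∣ y' - 1 ∧ (3 : ℤ) ∣ z')) := by
    obtain ⟨x', y', z', hx, hy, h', -, -, -, h3⟩ :=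
      exists_normalized_choice hT (level_pos r) (q := 1) (by norm_num) isCoprime_one_left
    by_cases hy' : Odd y'
    · exact ⟨x', y', z', hy', h', h3⟩
    · rw [Nat.not_odd_iff_even] at hy'
      have hd : Odd d := by
        rw [← Nat.not_even_iff_odd]
        intro hd
        obtain ⟨s, hs⟩ : Even (y' : ℤ) := by exact_mod_cast hy'
        obtain ⟨t, ht⟩ : Even (d : ℤ) := by exact_mod_cast hd
        rw [hs, ht] at h'
        have : (2 : ℤ) ∣ 1 := ⟨(-(level r : ℤ) * b + a * x') * s + level r * t * z', by
          linear_combination -h'⟩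
        omega
      refine ⟨x', y' + level r * d * 3, z' - (-(level r : ℤ) * b + a * x') * 3,
        hy'.add_odd ((hN.mul hd).mul (by decide)), ?_, ?_⟩
      · push_cast
        linear_combination h'
      · refine h3.imp_right fun ⟨h4, h5, h6⟩ => ⟨h4, ?_, dvd_sub h6 ⟨_, mul_comm _ _⟩⟩
        push_cast
        rw [add_sub_right_comm]
        exact dvd_add h5 ⟨_, mul_comm _ _⟩
  have shift := chiProd_shift hT.a_pos hT.d_pos hl h' (j := 0) (x' := x) (y' := y) (z' := z)
    (by simpa using h)
  simp only [zero_mul, add_zero, Int.cast_zero, zeta_zero, mul_one] at shift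
  have hv := twoPi_eq_zero hN
  have hPi : bigPi r = oddPi r := by rw [bigPi_eq, hv, pow_zero, one_mul]
  have hJ : ((J(-(d : ℤ) | y') : ℤ) : ℂ) ^ twoK r = 1 :=
    jacobi_zpow_even (Int.isCoprime_iff_gcd_eq_one.mp
      (isCoprime_choice h').1.of_mul_right_right.symm.neg_left) hw
  have hP := jacobi_mul_oddPi (isCoprime_choice h').2.2
  have hleft := etaChar_odd_left r (a := a * y') (b := b * y' - d * z') (t := 1) (d := x')
    one_pos (by rw [mul_one]; exact_mod_cast hN) (by linear_combination h')
  rw [mul_one, Int.natAbs_one, jacobiSym.one_right, Int.cast_one, one_zpow, one_mul] at hleft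
  rw [shift, chiProd, etaChar_left_factor hy' h', hleft, hJ, one_mul, jacobi_bigPi_eq hy',
    kronecker_bigPi, hv, ← hP, hPi]
  have e3 := three_dvd_exponent hl h3
  have key : zeta ((6 * dlt r * (y' - 1) : ℤ) : ℚ) *
      (zeta ((((-(level r : ℤ) * b + a * x' - 2 * y') * -d - level r * z' * y' * d ^ 2) * xOne r
        + z' * y' * xN r + 3 * (y' - 1) * twoK r : ℤ) : ℚ) *
      zeta ((((a * y' + x' - 3) * 1 - level r * (b * y' - d * z') * x' * 1 ^ 2) * xOne r +
        (b * y' - d * z') * x' * xN r : ℤ) : ℚ)) = zeta ((b * d * xN r : ℤ) : ℚ) := by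
    rw [zeta_mul_int, zeta_mul_int]
    refine zeta_eq_of_dvd ?_
    have e8 : (8 : ℤ) ∣ (((-(level r : ℤ) * b + a * x' - 2 * y') * -d - level r * z' * y' * d ^ 2) *
        xOne r + z' * y' * xN r + (((a * y' - 2 * x') * 1 - level r * (b * y' - d * z') * x' * 1 ^ 2) *
        xOne r + (b * y' - d * z') * x' * xN r)) - b * d * xN r :=
      dvd_sub (dvd_add (dvd_add (h8X.mul_left _) (h8N.mul_left _))
        (dvd_add (h8X.mul_left _) (h8N.mul_left _))) (h8N.mul_left _)
    obtain ⟨u, hu⟩ := IsCoprime.mul_dvd (by norm_num : IsCoprime (3 : ℤ) 8) e3 e8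
    obtain ⟨s, hs⟩ := hw4
    obtain ⟨t, ht⟩ : Odd (y' : ℤ) := by exact_mod_cast hy'
    obtain ⟨v, hv⟩ := h8X
    refine ⟨u + t * s + (x' - 1) * v, ?_⟩
    linear_combination hu + 3 * (y' - 1) * hs + 12 * s * ht + 3 * (x' - 1) * hv
  rw [← key]
  push_cast
  ring

lemma kronecker_of_odd {m : ℤ} {g : ℕ} (hg : Odd g) : kronecker m g = J(m | g) := by
  have h0 : (g : ℤ) ≠ 0 := by exact_mod_cast hg.pos.ne'
  have h1 : ¬ ((g : ℤ) < 0 ∧ m < 0) := by omega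
  have h2 : g.factorization 2 = 0 :=
    Nat.factorization_eq_zero_of_not_dvd fun h => Nat.not_even_iff_odd.mpr hg (even_iff_two_dvd.mpr h)
  rw [kronecker, if_neg h0, if_neg h1, Int.natAbs_natCast, h2]
  simp

lemma chi_eight_sq {a : ℤ} (ha : Odd a) : ZMod.χ₈ (a : ZMod 8) ^ 2 = 1 := by
  rw [← map_pow]
  have := chi_eight_of_dvd (eight_dvd_of_odd ha)
  push_cast at this
  rw [this, map_one]

lemma kronecker_sq {m : ℤ} {g : ℕ} (hg : 0 < g) (h : IsCoprime m g) : kronecker m g ^ 2 = 1 := by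
  have h0 : (g : ℤ) ≠ 0 := by exact_mod_cast hg.ne'
  have h1 : ¬ ((g : ℤ) < 0 ∧ m < 0) := by omega
  have h2 : J(m | g / 2 ^ g.factorization 2) ^ 2 = 1 := by
    refine jacobiSym.sq_one (Int.isCoprime_iff_gcd_eq_one.mp (h.of_isCoprime_of_dvd_right ?_))
    exact_mod_cast Nat.ordCompl_dvd g 2
  rw [kronecker, if_neg h0, if_neg h1, Int.natAbs_natCast, one_mul, mul_pow, h2, mul_one, ← pow_mul]
  rcases Nat.eq_zero_or_pos (g.factorization 2) with h3 | h3
  · simp [h3]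
  · have h4 : 2 ∣ g := Nat.dvd_of_factorization_pos h3.ne'
    have hm : Odd m := by
      rw [← Int.not_even_iff_odd]
      intro he
      have : IsUnit (2 : ℤ) := h.isUnit_of_dvd' (even_iff_two_dvd.mp he) (by exact_mod_cast h4)
      rw [Int.isUnit_iff] at this
      omega
    rw [mul_comm, pow_mul, chi_eight_sq hm, one_pow]

lemma coprime_bigPi {r : ℕ+ →₀ ℤ} {a : ℕ} (h : Nat.Coprime (level r) a) :
    Nat.Coprime a (bigPi r) :=
  Nat.Coprime.symm <| Nat.coprime_of_dvd fun p hp h1 h2 => hp.one_lt.ne' <| Nat.dvd_one.mp <| by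
    rw [← h.gcd_eq_one]
    exact Nat.dvd_gcd (prime_dvd_level_of_dvd_bigPi hp h1) h2

lemma psi_of_odd {r : ℕ+ →₀ ℤ} {l a b : ℕ} (hl : Odd l) :
    psi r l a b = zeta ((-(3 * (twoK r + 2 * dlt r) * (((l / a : ℕ) : ℤ) - 1))
      + 3 * (twoK r + 2 * dlt r) * (l - 1) * (level r - 1) : ℤ) : ℚ) := by
  rw [psi, if_pos (by rwa [← even_iff_two_dvd, Nat.not_even_iff_odd]), zeta, delta_eq]
  generalize l / a = d
  congr 2
  push_cast
  ring

lemma psi_of_even_of_even {r : ℕ+ →₀ ℤ} {l a b : ℕ} (hl : Even l) (hN : Even (level r)) :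
    psi r l a b = zeta ((-(3 * (twoK r + 2 * dlt r) * (a - 1)
      + 3 * level r * (twoK r + 2 * dlt r) * (1 + dltOne r) * b) : ℤ) : ℚ) := by
  rw [even_iff_two_dvd] at hl hN
  rw [psi, if_neg (not_not.mpr hl), if_pos hN, zeta, delta_eq, deltaOne_eq hl]
  congr 2
  push_cast
  ring

lemma psi_of_even_of_odd {r : ℕ+ →₀ ℤ} {l a b : ℕ} (hl : Even l) (hN : Odd (level r)) :
    psi r l a b = 1 := by
  rw [psi, if_neg (not_not.mpr (even_iff_two_dvd.mp hl)),
    if_neg (by rwa [← even_iff_two_dvd, Nat.not_even_iff_odd])]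

lemma inv_eq_self_of_sq {k : ℤ} (h : k ^ 2 = 1) (n : ℤ) :
    (((k : ℤ) : ℂ) ^ n)⁻¹ = ((k : ℤ) : ℂ) ^ n := by
  rcases mul_self_eq_one_iff.mp (sq k ▸ h) with rfl | rfl <;> simp [← inv_zpow, inv_neg]

lemma zeta_inv_int (m : ℤ) : (zeta (m : ℚ))⁻¹ = zeta ((-m : ℤ) : ℚ) := by
  rw [← zeta_neg]; push_cast; rfl

/-- The coefficients of the Hecke operator in closed form. -/
theorem HeckeChoice.kappa_eq {r : ℕ+ →₀ ℤ} {l : ℕ} (hl : l ∈ Lf r) (s : HeckeChoice (level r) l)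
    {i : Σ _ : ℕ, ℕ} (hi : i ∈ heckeIndex (level r) l) :
    s.kappa i = (kronecker i.1 (bigPi r) : ℂ) *
      (kronecker (-(level r : ℤ) * i.2) (Nat.gcd i.1 (l / i.1)) : ℂ) ^ twoK r *
      zeta ((-(i.2 * ((l / i.1 : ℕ) : ℤ) * xN r) : ℤ) : ℚ) * psi r l i.1 i.2 := by
  obtain ⟨hT, had, -⟩ := mem_heckeIndex_spec hi
  have h := s.spec_of_mem hi
  have hl' : i.1 * (l / i.1) ∈ Lf r := by rwa [had]
  have hadZ : (i.1 : ℤ) * ((l / i.1 : ℕ) : ℤ) = l := by exact_mod_cast had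
  have hk : s.kappa i = (chiProd r i.1 i.2 (l / i.1) (s.x i.1 i.2) (s.y i.1 i.2) (s.z i.1 i.2))⁻¹ := by
    rw [chiProd, mul_inv]; rfl
  have hg0 : 0 < Nat.gcd i.1 (l / i.1) := Nat.gcd_pos_of_pos_left _ hT.a_pos
  have hbg : IsCoprime (-(level r : ℤ) * i.2) (Nat.gcd i.1 (l / i.1)) := by
    obtain ⟨α, hα⟩ : ((Nat.gcd i.1 (l / i.1) : ℕ) : ℤ) ∣ i.1 :=
      Int.natCast_dvd_natCast.mpr (Nat.gcd_dvd_left _ _)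
    obtain ⟨β, hβ⟩ : ((Nat.gcd i.1 (l / i.1) : ℕ) : ℤ) ∣ ((l / i.1 : ℕ) : ℤ) :=
      Int.natCast_dvd_natCast.mpr (Nat.gcd_dvd_right _ _)
    refine ⟨s.y i.1 i.2, α * s.x i.1 i.2 * s.y i.1 i.2 + level r * β * s.z i.1 i.2, ?_⟩
    linear_combination h - (s.x i.1 i.2 * s.y i.1 i.2) * hα - level r * s.z i.1 i.2 * hβ
  have hinv := inv_eq_self_of_sq (kronecker_sq hg0 hbg) (twoK r)
  have hinv' := inv_eq_self_of_sq (kronecker_sq (m := i.1) (Nat.pos_of_ne_zero (bigPi_ne_zero r))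
    (Nat.isCoprime_iff_coprime.mpr (coprime_bigPi hT.coprime))) 1
  rw [zpow_one] at hinv'
  have hgodd : Odd i.1 → Odd (Nat.gcd i.1 (l / i.1)) := fun ho =>
    Odd.of_dvd_nat ho (Nat.gcd_dvd_left _ _)
  rw [hk]
  rcases Nat.even_or_odd l with h2 | h2
  · have h2' : Even (i.1 * (l / i.1)) := by rwa [had]
    rcases Nat.even_or_odd (level r) with hN | hN
    · have ho : Odd i.1 := by
        rw [← Nat.not_even_iff_odd]
        intro ha
        have := Nat.dvd_gcd (even_iff_two_dvd.mp hN) (even_iff_two_dvd.mp ha)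
        rw [hT.coprime] at this
        omega
      rw [chiProd_of_even_of_even hT hl' h2' hN h, psi_of_even_of_even h2 hN,
        ← kronecker_of_odd (hgodd ho), mul_inv, mul_inv, hinv, hinv', zeta_inv_int,
        mul_assoc _ (zeta _) (zeta _), zeta_mul_int]
      rw [mul_comm (_ ^ _)]
      congr 3
      ring
    · obtain ⟨hw, hc⟩ := chiProd_of_even_of_odd hT hl' h2' hN h
      have h1 : (kronecker (-(level r : ℤ) * i.2) (Nat.gcd i.1 (l / i.1)) : ℂ) ^ twoK r = 1 := by
        rcases mul_self_eq_one_iff.mp (sq (kronecker _ _) ▸ kronecker_sq hg0 hbg) with h3 | h3 <;>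
        simp only [h3] <;> simp [hw.neg_one_zpow]
      rw [hc, psi_of_even_of_odd h2 hN, h1, mul_inv, hinv', zeta_inv_int, mul_one, mul_one]
  · have h2' : Odd (i.1 * (l / i.1)) := by rwa [had]
    rw [chiProd_of_odd hT hl' h2' h, psi_of_odd h2,
      ← kronecker_of_odd (hgodd (Nat.odd_mul.mp h2').1), mul_inv, mul_inv, hinv, hinv', zeta_inv_int,
      mul_assoc _ (zeta _) (zeta _), zeta_mul_int]
    rw [mul_comm (_ ^ _)]
    congr 3
    linear_combination 3 * (twoK r + 2 * dlt r) * (level r - 1) * hadZ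

end

end EtaQuot

namespace EtaQuot

noncomputable section

open scoped NumberTheorySymbols
open UpperHalfPlane

/-! ### Fourier expansions -/

lemma norm_e_ofReal (x : ℝ) : ‖e (x : ℂ)‖ = 1 := by
  rw [e, show 2 * (π : ℂ) * Complex.I * x = ((2 * π * x : ℝ) : ℂ) * Complex.I by push_cast; ring,
    Complex.norm_exp_ofReal_mul_I]

lemma integral_e_int {k : ℤ} (hk : k ≠ 0) : ∫ x in (0 : ℝ)..1, e ((k : ℂ) * x) = 0 := by
  have hc : 2 * (π : ℂ) * Complex.I * k ≠ 0 := by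
    simp [Complex.I_ne_zero, Real.pi_ne_zero, hk]
  have : ∀ x : ℝ, e ((k : ℂ) * x) = Complex.exp (2 * (π : ℂ) * Complex.I * k * x) := fun x => by
    rw [e]; ring_nf
  simp only [this]
  rw [integral_exp_mul_complex hc]
  have h1 : Complex.exp (2 * (π : ℂ) * Complex.I * k) = 1 := by
    rw [mul_comm]; exact Complex.exp_int_mul_two_pi_mul_I k
  simp [h1]

/-- A Fourier series on the upper half-plane that represents `0` has zero coefficients. -/
lemma fourier_coeff_eq_zero {d : ℤ → ℂ} {D : ℕ} (hD : 0 < D)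
    (h : ∀ τ : ℂ, 0 < τ.im → HasSum (fun j : ℤ => d j * e ((((j : ℚ) / D : ℚ) : ℂ) * τ)) 0) (m : ℤ) :
    d m = 0 := by
  have hD' : (D : ℂ) ≠ 0 := by exact_mod_cast hD.ne'
  -- On the line τ = D(x + i) the series is an absolutely convergent Fourier series of period 1 in
  -- x; integration against e(-mx) isolates the coefficient.
  have h1 : ∀ x : ℝ, HasSum (fun j : ℤ => d j * e ((j : ℂ) * Complex.I) * e ((j : ℂ) * x)) 0 := by
    intro x
    convert h (D * (x + Complex.I)) (by simpa using hD) using 2 with j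
    rw [mul_assoc, ← e_add]
    congr 2
    push_cast
    field_simp
    ring
  have hnorm : ∀ (j : ℤ) (x : ℝ), ‖e ((j : ℂ) * x)‖ = 1 := fun j x => by
    have := norm_e_ofReal (j * x)
    push_cast at this
    exact this
  have hs : Summable fun j : ℤ => ‖d j * e ((j : ℂ) * Complex.I)‖ := by
    have := (h1 0).summable.norm
    simpa [e_zero] using this
  have h2 := intervalIntegral.hasSum_integral_of_dominated_convergence (μ := MeasureTheory.volume)
    (a := 0) (b := 1)
    (F := fun (j : ℤ) (x : ℝ) => d j * e ((j : ℂ) * Complex.I) * e (((j - m : ℤ) : ℂ) * x))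
    (f := fun _ => (0 : ℂ)) (fun j _ => ‖d j * e ((j : ℂ) * Complex.I)‖)
    (fun j => by
      refine Continuous.aestronglyMeasurable ?_
      unfold e
      fun_prop)
    (fun j => Filter.Eventually.of_forall fun x _ => by rw [norm_mul _ (e _), hnorm, mul_one])
    (Filter.Eventually.of_forall fun x _ => hs) intervalIntegrable_const
    (Filter.Eventually.of_forall fun x _ => by
      have := (h1 x).mul_right (e (((-m : ℤ) : ℂ) * x))
      rw [zero_mul] at this
      refine Eq.mp (congrArg (fun F : ℤ → ℂ => HasSum F 0) (funext fun j => ?_)) this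
      rw [mul_assoc (d j * _), ← e_add]
      congr 2
      push_cast
      ring)
  rw [intervalIntegral.integral_zero] at h2
  have h3 : (fun j : ℤ => ∫ x in (0 : ℝ)..1,
      d j * e ((j : ℂ) * Complex.I) * e (((j - m : ℤ) : ℂ) * x)) =
      fun j => if j = m then d m * e ((m : ℂ) * Complex.I) else 0 := by
    funext j
    rw [intervalIntegral.integral_const_mul]
    split_ifs with hj
    · subst hj
      simp [e_zero]
    · rw [integral_e_int (sub_ne_zero.mpr hj), mul_zero]
  rw [h3] at h2
  have h4 := h2.unique (hasSum_ite_eq m _)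
  exact (mul_eq_zero.mp h4.symm).resolve_right (e_ne_zero _)

/-- Reindexing of a Fourier expansion with exponents in `X/24 + ℤ`. -/
lemma IsFourierExpansion.hasSum_reindex {X : ℤ} {f : ℍ → ℂ} {c : ℚ → ℂ}
    (hc : IsFourierExpansion ((X : ℚ) / 24) f c) {A : ℕ} (hA : 0 < A) (τ : ℍ) :
    HasSum (fun j : ℤ => c ((j : ℚ) / (24 * A)) * e ((((j : ℚ) / (24 * A) : ℚ) : ℂ) * τ)) (f τ) := by
  have hA' : (A : ℚ) ≠ 0 := by exact_mod_cast hA.ne'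
  have hinj : Function.Injective fun m : ℤ => (X + 24 * m) * A := by
    intro m n hmn
    have hA'' : (A : ℤ) ≠ 0 := by exact_mod_cast hA.ne'
    have := mul_right_cancel₀ hA'' hmn
    omega
  rw [← hinj.hasSum_iff]
  · convert hc.hasSum τ using 2 with m
    have : ((((X + 24 * m) * A : ℤ) : ℚ) / (24 * A)) = (X : ℚ) / 24 + m := by
      push_cast
      field_simp
    simp only [Function.comp_apply, this]
  · intro j hj
    rw [hc.eq_zero, zero_mul]
    rintro ⟨m, hm⟩
    refine hj ⟨m, ?_⟩
    have : (j : ℚ) = ((X + 24 * m) * A : ℤ) := by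
      push_cast
      field_simp at hm
      linear_combination hm
    exact_mod_cast this.symm

lemma IsFourierExpansion.unique {X : ℤ} {f : ℍ → ℂ} {c c' : ℚ → ℂ}
    (hc : IsFourierExpansion ((X : ℚ) / 24) f c) (hc' : IsFourierExpansion ((X : ℚ) / 24) f c') :
    c = c' := by
  have key : ∀ j : ℤ, c ((j : ℚ) / (24 * (1 : ℕ))) - c' ((j : ℚ) / (24 * (1 : ℕ))) = 0 := by
    refine fourier_coeff_eq_zero (D := 24) (by norm_num) (fun τ hτ => ?_)
    have := (hc.hasSum_reindex one_pos ⟨τ, hτ⟩).sub (hc'.hasSum_reindex one_pos ⟨τ, hτ⟩)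
    rw [sub_self] at this
    refine Eq.mp (congrArg (fun F : ℤ → ℂ => HasSum F 0) (funext fun j => ?_)) this
    rw [← sub_mul]
    norm_num
  funext n
  by_cases hn : ∃ m : ℤ, n = (X : ℚ) / 24 + m
  · obtain ⟨m, rfl⟩ := hn
    have := key (X + 24 * m)
    have h2 : (((X + 24 * m : ℤ) : ℚ) / (24 * (1 : ℕ))) = (X : ℚ) / 24 + m := by
      push_cast
      ring
    rw [h2] at this
    exact sub_eq_zero.mp this
  · rw [hc.eq_zero n hn, hc'.eq_zero n hn]

/-- The Euler product `∏ (1 - q^{m+1})`. -/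
def eulerProd (q : ℂ) : ℂ := ∏' m : ℕ, (1 - q ^ (m + 1))

lemma eulerProd_ne_zero {q : ℂ} (hq : ‖q‖ < 1) : eulerProd q ≠ 0 := by
  have h1 : Summable fun n : ℕ => ‖-q ^ (n + 1)‖ := by
    simpa using (summable_nat_add_iff 1).mpr (summable_geometric_of_lt_one (norm_nonneg _) hq)
  have := tprod_one_add_ne_zero_of_summable (f := fun n : ℕ => -q ^ (n + 1)) (fun n => ?_) h1
  · simpa [eulerProd, sub_eq_add_neg] using this
  · rw [← sub_eq_add_neg, sub_ne_zero]
    intro h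
    have h2 := pow_lt_one₀ (norm_nonneg q) hq n.succ_ne_zero
    rw [← norm_pow, ← h, norm_one] at h2
    exact lt_irrefl _ h2

/-- The product `∏_n ∏_m (1 - q^{nm})^{r_n}`. -/
def eulerQuotient (r : ℕ+ →₀ ℤ) (q : ℂ) : ℂ := r.prod fun n k => eulerProd (q ^ (n : ℕ)) ^ k

lemma norm_pow_lt_one {q : ℂ} (hq : ‖q‖ < 1) (n : ℕ+) : ‖q ^ (n : ℕ)‖ < 1 := by
  rw [norm_pow]
  exact pow_lt_one₀ (norm_nonneg q) hq n.ne_zero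

lemma differentiableOn_eulerQuotient (r : ℕ+ →₀ ℤ) :
    DifferentiableOn ℂ (eulerQuotient r) (Metric.ball 0 1) := by
  intro q hq
  have hq' : ‖q‖ < 1 := by simpa using hq
  refine DifferentiableAt.differentiableWithinAt ?_
  unfold eulerQuotient Finsupp.prod
  refine DifferentiableAt.fun_finsetProd fun n _ => ?_
  refine DifferentiableAt.zpow ?_ (Or.inl (eulerProd_ne_zero (norm_pow_lt_one hq' n)))
  have h1 : DifferentiableAt ℂ eulerProd (q ^ (n : ℕ)) :=
    ModularForm.differentiableOn_tprod_one_sub_pow.differentiableAt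
      (Metric.isOpen_ball.mem_nhds (by simpa using norm_pow_lt_one hq' n))
  exact h1.comp q (differentiableAt_pow _)

lemma eulerQuotient_zero (r : ℕ+ →₀ ℤ) : eulerQuotient r 0 = 1 := by
  unfold eulerQuotient Finsupp.prod
  refine Finset.prod_eq_one fun n _ => ?_
  simp [eulerProd]

lemma norm_e_lt_one (τ : ℍ) : ‖e (τ : ℂ)‖ < 1 := by
  have := norm_exp_two_pi_I_lt_one τ
  exact this

lemma e_nat_mul (n : ℕ) (x : ℂ) : e ((n : ℂ) * x) = e x ^ n := by
  rw [e, e, ← Complex.exp_nat_mul]; ring_nf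

lemma e_int_mul (n : ℤ) (x : ℂ) : e ((n : ℂ) * x) = e x ^ n := by
  rw [e, e, ← Complex.exp_int_mul]; ring_nf

lemma eta_nat_mul (n : ℕ+) (τ : ℍ) : ModularForm.eta ((n : ℂ) * τ) =
    e (((n : ℂ) * τ) / 24) * eulerProd (e τ ^ (n : ℕ)) := by
  have h1 : Function.Periodic.qParam 24 ((n : ℂ) * τ) = e (((n : ℂ) * τ) / 24) := by
    rw [Function.Periodic.qParam, e]; push_cast; ring_nf
  have h2 : Function.Periodic.qParam 1 ((n : ℂ) * τ) = e τ ^ (n : ℕ) := by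
    rw [← e_nat_mul, Function.Periodic.qParam, e]; push_cast; ring_nf
  rw [ModularForm.eta, h1, eulerProd]
  simp only [ModularForm.eta_q, h2]

lemma etaQuotient_eq_eulerQuotient (r : ℕ+ →₀ ℤ) (τ : ℍ) :
    etaQuotient r τ = e ((((xN r : ℚ) / 24 : ℚ) : ℂ) * τ) * eulerQuotient r (e τ) := by
  have h1 : e ((((xN r : ℚ) / 24 : ℚ) : ℂ) * τ) = ∏ n ∈ r.support, e (((n : ℂ) * τ) / 24) ^ r n := by
    have h2 : ((((xN r : ℚ) / 24 : ℚ) : ℂ) * τ) = ∑ n ∈ r.support, ((r n : ℤ) : ℂ) * (((n : ℂ) * τ) / 24) := by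
      unfold xN Finsupp.sum
      push_cast
      rw [Finset.sum_div, Finset.sum_mul]
      refine Finset.sum_congr rfl fun n _ => ?_
      ring
    rw [h2, e, Finset.mul_sum, Complex.exp_sum]
    exact Finset.prod_congr rfl fun n _ => e_int_mul _ _
  rw [h1, etaQuotient, eulerQuotient, Finsupp.prod, Finsupp.prod, ← Finset.prod_mul_distrib]
  refine Finset.prod_congr rfl fun n _ => ?_
  rw [eta_nat_mul, mul_zpow]

/-- Existence of the Fourier expansion, with leading coefficient `1`. -/
lemma exists_isFourierExpansion (r : ℕ+ →₀ ℤ) :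
    ∃ c : ℚ → ℂ, IsFourierExpansion ((xN r : ℚ) / 24) (etaQuotient r) c ∧ c ((xN r : ℚ) / 24) = 1 := by
  have hinj : Function.Injective fun m : ℕ => (xN r : ℚ) / 24 + m := by
    intro m n hmn
    simpa using hmn
  let α : ℕ → ℂ := fun n => (n.factorial : ℂ)⁻¹ * iteratedDeriv n (eulerQuotient r) 0
  refine ⟨Function.extend (fun m : ℕ => (xN r : ℚ) / 24 + m) α 0, ⟨fun n hn => ?_, fun τ => ?_⟩, ?_⟩
  · refine Function.extend_apply' _ _ _ ?_
    rintro ⟨m, rfl⟩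
    exact hn ⟨m, by simp⟩
  · rw [← (Nat.cast_injective (R := ℤ)).hasSum_iff]
    · have h1 := Complex.hasSum_taylorSeries_on_ball (differentiableOn_eulerQuotient r)
        (z := e τ) (by simpa using norm_e_lt_one τ)
      have h2 := h1.mul_left (e ((((xN r : ℚ) / 24 : ℚ) : ℂ) * τ))
      rw [← etaQuotient_eq_eulerQuotient] at h2
      refine Eq.mp (congrArg (fun F : ℕ → ℂ => HasSum F _) (funext fun m => ?_)) h2
      have h3 := hinj.extend_apply α 0 m
      simp only [Function.comp_apply, Int.cast_natCast]
      rw [h3]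
      push_cast
      rw [add_mul, e_add, e_nat_mul]
      simp only [α, smul_eq_mul, sub_zero]
      ring
    · intro j hj
      rw [Function.extend_apply', Pi.zero_apply, zero_mul]
      rintro ⟨m, hm⟩
      refine hj ⟨m, ?_⟩
      have : (m : ℚ) = j := by simpa using hm
      exact_mod_cast this
  · have h3 := hinj.extend_apply α 0 0
    simp only [Nat.cast_zero, add_zero] at h3
    rw [h3]
    simp [α, eulerQuotient_zero]

end

end EtaQuot

namespace EtaQuot

noncomputable section

open scoped NumberTheorySymbols
open UpperHalfPlane

/-! ### Comparison of Fourier coefficients -/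

/-- The expansion of `f((aτ + b)/d)` with exponents in `(1/24ad) ℤ`. -/
lemma IsFourierExpansion.hasSum_tri {r : ℕ+ →₀ ℤ} {c : ℚ → ℂ}
    (hc : IsFourierExpansion ((xN r : ℚ) / 24) (etaQuotient r) c) {l a d : ℕ} (ha : 0 < a)
    (hd : 0 < d) (hl : a * d = l) (b : ℕ) {τ : ℂ} (hτ : 0 < τ.im) :
    HasSum (fun j : ℤ => c ((l : ℚ) * (j / ((24 * l : ℕ) : ℚ)) / (a : ℚ) ^ 2) *
      e (((b : ℚ) * (j / ((24 * l : ℕ) : ℚ)) / a : ℚ) : ℂ) *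
      e ((((j : ℚ) / ((24 * l : ℕ) : ℚ) : ℚ) : ℂ) * τ)) (etaQ r (((a : ℂ) * τ + b) / d)) := by
  have him := tri_im_pos ha hd (b : ℤ) hτ
  rw [Int.cast_natCast] at him
  have ha' : (a : ℚ) ≠ 0 := by exact_mod_cast ha.ne'
  have hd' : (d : ℚ) ≠ 0 := by exact_mod_cast hd.ne'
  have ha'' : (a : ℂ) ≠ 0 := by exact_mod_cast ha.ne'
  have hd'' : (d : ℂ) ≠ 0 := by exact_mod_cast hd.ne'
  -- Exponents j/(24a²) at (aτ + b)/d become j/(24l) in τ, so all terms of T_l f share one exponent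
  -- lattice.
  have h := hc.hasSum_reindex (pow_pos ha 2) ⟨_, him⟩
  refine Eq.mp (congrArg (fun F : ℤ → ℂ => HasSum F _) (funext fun j => ?_)) h
  subst hl
  have h1 : ((a * d : ℕ) : ℚ) * (j / ((24 * (a * d) : ℕ) : ℚ)) / (a : ℚ) ^ 2 =
      (j : ℚ) / (24 * (a ^ 2 : ℕ)) := by
    push_cast
    field_simp
  rw [h1, mul_assoc, ← e_add]
  congr 2
  push_cast
  field_simp
  ring

lemma coeffLHS_eq_sum (r : ℕ+ →₀ ℤ) (c : ℚ → ℂ) (l : ℕ) (n : ℚ) :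
    coeffLHS r c l n = (((l : ℝ) ^ (-((twoK r : ℝ) / 2) / 2) : ℝ) : ℂ) *
      ∑ i ∈ heckeIndex (level r) l,
        (kronecker i.1 (bigPi r) : ℂ) * (((i.1 : ℝ) ^ ((twoK r : ℝ) / 2) : ℝ) : ℂ) *
        c ((l : ℚ) * n / (i.1 : ℚ) ^ 2) *
        ((kronecker (-(level r : ℤ) * i.2) (Nat.gcd i.1 (l / i.1)) : ℂ) ^ twoK r *
        e (((i.2 : ℚ) * ((l / i.1 : ℕ) : ℚ) * (n / l - (xN r : ℚ) / 24) : ℚ) : ℂ) *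
        psi r l i.1 i.2) := by
  unfold coeffLHS
  congr 1
  rw [heckeIndex, Finset.sum_sigma]
  simp only [Nat.coprime_comm (n := level r)]
  refine Finset.sum_congr rfl fun a _ => ?_
  rw [Finset.mul_sum]

/-- The eigenvalue equation on Fourier coefficients. -/
theorem coeffLHS_eq_of_heckeT_eq {r : ℕ+ →₀ ℤ} {c : ℚ → ℂ}
    (hc : IsFourierExpansion ((xN r : ℚ) / 24) (etaQuotient r) c) {l : ℕ} (hl : l ∈ Lf r)
    (s : HeckeChoice (level r) l) {cl : ℂ}
    (h : heckeT l (level r) (twoK r) (etaChar r) (etaChar r) s (etaQuotient r) =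
      cl • etaQuotient r) {n : ℚ} (hn : ∃ m : ℤ, n = (xN r : ℚ) / 24 + m) :
    coeffLHS r c l n = cl * c n := by
  have hl0 : 0 < l := hl.1
  have hl' : (l : ℚ) ≠ 0 := by exact_mod_cast hl0.ne'
  have key : ∀ j : ℤ, coeffLHS r c l (j / ((24 * l : ℕ) : ℚ)) -
      cl * c (j / ((24 * l : ℕ) : ℚ)) = 0 := by
    refine fourier_coeff_eq_zero (D := 24 * l) (by positivity) fun τ hτ => ?_
    have h1 : HasSum (fun j : ℤ => (((l : ℝ) ^ (-((twoK r : ℝ) / 2) / 2) : ℝ) : ℂ) *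
        ∑ i ∈ heckeIndex (level r) l, s.kappa i * ((((i.1 : ℝ) ^ ((twoK r : ℝ) / 2) : ℝ) : ℂ) *
          (c ((l : ℚ) * (j / ((24 * l : ℕ) : ℚ)) / (i.1 : ℚ) ^ 2) *
          e (((i.2 : ℚ) * (j / ((24 * l : ℕ) : ℚ)) / i.1 : ℚ) : ℂ) *
          e ((((j : ℚ) / ((24 * l : ℕ) : ℚ) : ℚ) : ℂ) * τ)))) (cl * etaQ r τ) := by
      have h2 : heckeT l (level r) (twoK r) (etaChar r) (etaChar r) s (etaQuotient r) ⟨τ, hτ⟩ =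
          cl * etaQ r τ := by rw [h]; rfl
      rw [← h2, heckeT_eq_sum]
      refine HasSum.mul_left _ (hasSum_sum fun i hi => ?_)
      obtain ⟨hT, had, -⟩ := mem_heckeIndex_spec hi
      exact ((hc.hasSum_tri hT.a_pos hT.d_pos had i.2 hτ).mul_left _).mul_left _
    have h3 := (hc.hasSum_reindex hl0 ⟨τ, hτ⟩).mul_left cl
    have h4 := h1.sub h3
    rw [show cl * etaQ r τ - cl * etaQuotient r ⟨τ, hτ⟩ = 0 from sub_self _] at h4
    refine Eq.mp (congrArg (fun F : ℤ → ℂ => HasSum F 0) (funext fun j => ?_)) h4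
    rw [sub_mul, coeffLHS_eq_sum]
    push_cast
    rw [mul_assoc cl]
    congr 1
    rw [mul_assoc, Finset.sum_mul]
    congr 1
    refine Finset.sum_congr rfl fun i hi => ?_
    obtain ⟨hT, had, -⟩ := mem_heckeIndex_spec hi
    rw [s.kappa_eq hl hi]
    have ha' : (i.1 : ℚ) ≠ 0 := by exact_mod_cast hT.a_pos.ne'
    have hd' : ((l / i.1 : ℕ) : ℚ) ≠ 0 := by exact_mod_cast hT.d_pos.ne'
    have hle : (l : ℚ) = i.1 * ((l / i.1 : ℕ) : ℚ) := by exact_mod_cast had.symm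
    -- As d/l = 1/a, the phase splits into e(-bd x_N/24), which comes from the character, and
    -- e(bn/a), which comes from the translation by b/d.
    have h5 : e (((i.2 : ℚ) * ((l / i.1 : ℕ) : ℚ) *
          ((j / ((24 * l : ℕ) : ℚ)) / l - (xN r : ℚ) / 24) : ℚ) : ℂ) =
        zeta ((-(i.2 * ((l / i.1 : ℕ) : ℤ) * xN r) : ℤ) : ℚ) *
        e (((i.2 : ℚ) * (j / ((24 * l : ℕ) : ℚ)) / i.1 : ℚ) : ℂ) := by
      rw [zeta, ← e_add, ← Rat.cast_add]
      congr 2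
      generalize l / i.1 = d at *
      rw [hle]
      push_cast
      rw [hle]
      field_simp
      ring
    push_cast at h5 ⊢
    rw [h5]
    ring
  obtain ⟨m, rfl⟩ := hn
  have h6 : (((xN r + 24 * m) * l : ℤ) : ℚ) / ((24 * l : ℕ) : ℚ) = (xN r : ℚ) / 24 + m := by
    push_cast
    field_simp
  have := key ((xN r + 24 * m) * l)
  rw [h6] at this
  exact sub_eq_zero.mp this

end

end EtaQuot

/-! ### The main theorem -/

theorem theorem9p8 (r : ℕ+ →₀ ℤ) (hr : EtaQuot.IsWeaklyAdmissible r) :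
    (∃! c : ℚ → ℂ,
      EtaQuot.IsFourierExpansion ((EtaQuot.xN r : ℚ) / 24) (EtaQuot.etaQuotient r) c) ∧
    ∀ c : ℚ → ℂ,
      EtaQuot.IsFourierExpansion ((EtaQuot.xN r : ℚ) / 24) (EtaQuot.etaQuotient r) c →
      ∀ l ∈ EtaQuot.Lf r,
        Nonempty (EtaQuot.HeckeChoice (EtaQuot.level r) l) ∧
        ∃ cl : ℂ,
          (∀ s : EtaQuot.HeckeChoice (EtaQuot.level r) l,
            EtaQuot.heckeT l (EtaQuot.level r) (EtaQuot.twoK r) (EtaQuot.etaChar r)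
              (EtaQuot.etaChar r) s (EtaQuot.etaQuotient r) = cl • EtaQuot.etaQuotient r) ∧
          (∀ n : ℚ, (∃ m : ℤ, n = (EtaQuot.xN r : ℚ) / 24 + m) →
            EtaQuot.coeffLHS r c l n = cl * c n) ∧
          (∀ cl' : ℂ, (∀ n : ℚ, (∃ m : ℤ, n = (EtaQuot.xN r : ℚ) / 24 + m) →
            EtaQuot.coeffLHS r c l n = cl' * c n) → cl' = cl) ∧
          cl = EtaQuot.coeffLHS r c l ((EtaQuot.xN r : ℚ) / 24) := by
  obtain ⟨c₀, hc₀, h1⟩ := EtaQuot.exists_isFourierExpansion r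
  refine ⟨⟨c₀, hc₀, fun c hc => hc.unique hc₀⟩, fun c hc l hl => ?_⟩
  obtain rfl := hc.unique hc₀
  have hx : ∃ m : ℤ, (EtaQuot.xN r : ℚ) / 24 = (EtaQuot.xN r : ℚ) / 24 + m := ⟨0, by simp⟩
  -- The leading coefficient is 1, so any eigenvalue equals the left-hand side at x_N/24. That
  -- expression does not involve `s`, hence neither does the eigenvalue.
  have key : ∀ (s : EtaQuot.HeckeChoice (EtaQuot.level r) l) (a : ℂ),
      EtaQuot.heckeT l (EtaQuot.level r) (EtaQuot.twoK r) (EtaQuot.etaChar r)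
        (EtaQuot.etaChar r) s (EtaQuot.etaQuotient r) = a • EtaQuot.etaQuotient r →
      a = EtaQuot.coeffLHS r c l ((EtaQuot.xN r : ℚ) / 24) := fun s a ha => by
    rw [EtaQuot.coeffLHS_eq_of_heckeT_eq hc hl s ha hx, h1, mul_one]
  obtain ⟨s₀⟩ := EtaQuot.nonempty_heckeChoice (EtaQuot.level_pos r) l
  obtain ⟨a₀, ha₀⟩ := EtaQuot.exists_eigenvalue hr hl s₀
  refine ⟨⟨s₀⟩, a₀, fun s => ?_, fun n hn => EtaQuot.coeffLHS_eq_of_heckeT_eq hc hl s₀ ha₀ hn,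
    fun a' ha' => ?_, key s₀ a₀ ha₀⟩
  · obtain ⟨a, ha⟩ := EtaQuot.exists_eigenvalue hr hl s
    rw [ha, key s a ha, key s₀ a₀ ha₀]
  · rw [key s₀ a₀ ha₀, ha' _ hx, h1, mul_one]
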